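/- Let $f:\hat{\mathbb C}\to\hat{\mathbb C}$ be a rational map of degree at least $2$ with Julia set $J=\hat{\mathbb C}$, normalized by $f(\infty)=\infty$, $f(1)=1$, $f(0)=0$, and not a flexible Lattès map (i.e. not double covered by an integral torus endomorphism). Let $P=\overline{\{f^n(c): n\ge 1,\ c\in\hat{\mathbb C} \text{ a critical point of } f\}}$ be the postcritical set. Assume $P\ne\hat{\mathbb C}$ and that $d(f^n(z),P)\to 0$ for almost every $z\in J$, where $d$ is the spherical distance. Area means Lebesgue measure on $\mathbb C$. **Notation.** A measurable set $K\subset J$ is *fundamental* if $P\cap J\subset K$, $f(K)\subset K$, $K$ and $K':=f^{-1}(K)\setminus K$ have positive area, and $J\setminus(K\cup\bigcup_{j\ge0}f^{-j}(K'))$ has area $0$. Fix a decreasing sequence of fundamental sets $K_n$, and put $K_n'=f^{-1}(K_n)\setminus K_n$, $K_\infty=\bigcap_nK_n$, $K_\infty'=f^{-1}(K_\infty)\setminus K_\infty$, $K_{\pm\infty}=\bigcup_{i\ge0}f^{-i}(K_\infty)$. Let $v_1,\dots,v_p$ be the distinct critical values of $f$ in $\mathbb C$, and $\mathcal C=\{\psi_{v_1},\dots,\psi_{v_p}\}$,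 where $\psi_v(x)=\frac{v(v-1)}{x(x-1)(x-v)}$. Let $(Tg)(x)=\sum_{f(y)=x}g(y)/f'(y)^2$, $f^*\nu=(\nu\circ f)\,|f'|^2/(f')^2$, $\Omega=\mathbb C\setminus(P\cup\{0,1\})$. For $\psi\in\mathcal C$ let $r_\psi=(1-T)^{-1}\psi=\sum_{i\ge0}T^i\psi$ and $\sigma^\psi=|r_\psi|/r_\psi$ (with value $0$ where $r_\psi=0$), and let $\sigma_n^\psi$ be equal to $(f^i)^*\sigma^\psi$ on $f^{-i}(K_n'\setminus K_\infty')$, $i\ge0$, and to $0$ elsewhere. An *invariant line field* is a measurable $\mu$ with $|\mu|=1$ on a subset $E_\mu$ of $J$ of positive area, $\mu=0$ elsewhere, and $f^*\mu=\mu$. It is *ergodic* if $E_\mu$ is a completely invariant ergodic subset and every invariant line field with support in $E_\mu$ is $t\mu$ for a constant $t$ with $|t|=1$. Equalities, invariance and inclusions of supports are understood up to null sets; the weak* topology is that of $L_\infty(\mathbb C)=L_1(\mathbb C)^*$; convergence in measure on a set means convergence in measure on each of its subsets of finite area. **Theorem.** Each $\psi\in\mathcal C$ is integrable on $\mathbb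 C$; the series for $r_\psi$ converges at every point of $\Omega$ to a holomorphic function on $\Omega$ with $r_\psi-Tr_\psi=\psi$ there; $r_\psi$ is integrable on each $K_n'$, and $\sigma_n^\psi\in L_\infty(\mathbb C)$. Moreover: **(A)** The following are equivalent: (1) $f$ has an invariant line field supported in $J\setminus K_{\pm\infty}$; (2) there is $\psi\in\mathcal C$ with $$\liminf_{n\to\infty}\int_{K_n'\setminus K_\infty'}|r_\psi(x)|\,|dx|^2>0.\qquad(\ast)$$ Furthermore, for every $\psi\in\mathcal C$ satisfying $(\ast)$, every weak* limit $\nu$ of a subsequence of $(\sigma_n^\psi)$ is a nonzero fixed point of $f^*$ with $\|\nu\|_\infty\le1$ and support in $J\setminus K_{\pm\infty}$. **(B)** Let $\mu$ be an ergodic invariant line field with $E_\mu\subset J\setminus K_{\pm\infty}$. Then $\int\mu\psi\ne0$ for at least one $\psi\in\mathcal C$. For each $\psi\in\mathcal C$ with $\int\mu\psi\neq0$, after replacing $\mu$ by $t\mu$ for some $|t|=1$ we have $\int\mu\psi>0$ and, with $\sigma_{E,n}^\psi=\mathbf 1_{E_\mu}\sigma_n^\psi$: 1. $\sigma_{E,n}^\psi\to\mu$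 in the weak* topology; 2. the following limits exist and satisfy $$\lim_{n\to\infty}\int_{E_\mu\cap K_n'}|r_\psi|\,|dx|^2=\lim_{n\to\infty}\Big|\int_{K_n'}r_\psi\,\mu\,|dx|^2\Big|=\Big|\int_J\mu\psi\,|dx|^2\Big|>0;$$ 3. $\sigma_{E,n}^\psi\to\mu$ in measure on $E_\mu$; equivalently, the functions $\Delta_n$ defined by $\Delta_n=(\mu-\sigma^\psi)\circ f^j$ on $f^{-j}(K_n'\cap E_\mu)$, $j\ge0$, whose domains of definition exhaust $E_\mu$ in measure as $n\to\infty$, tend to $0$ in measure on $E_\mu$. -/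

import Mathlib

open MeasureTheory Filter Topology Set
open scoped OnePoint

noncomputable section

namespace RatDyn

/-! ### The Riemann sphere `OnePoint ℂ` -/

/-- The affine coordinate on the sphere (with the conventional value `0` at `∞`). -/
def coord : OnePoint ℂ → ℂ
  | ∞ => 0
  | (z : ℂ) => z

open Classical in
/-- The inversion `z ↦ 1 / z` of the sphere. -/
def sphInv : OnePoint ℂ → OnePoint ℂ
  | ∞ => ((0 : ℂ) : OnePoint ℂ)
  | (z : ℂ) => if z = 0 then ∞ else ((z⁻¹ : ℂ) : OnePoint ℂ)

/-- The chordal distance on the sphere; it is bi-Lipschitz equivalent to the geodesic spherical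
distance. -/
def chordal : OnePoint ℂ → OnePoint ℂ → ℝ
  | ∞, ∞ => 0
  | ∞, (w : ℂ) => 2 / √(1 + ‖w‖ ^ 2)
  | (z : ℂ), ∞ => 2 / √(1 + ‖z‖ ^ 2)
  | (z : ℂ), (w : ℂ) => 2 * ‖z - w‖ / (√(1 + ‖z‖ ^ 2) * √(1 + ‖w‖ ^ 2))

/-- The finite part of a subset of the sphere. -/
def fin (A : Set (OnePoint ℂ)) : Set ℂ := (fun z : ℂ => (z : OnePoint ℂ)) ⁻¹' A

/-- Lebesgue area of a subset of the sphere (the point `∞` is disregarded). -/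
def area (A : Set (OnePoint ℂ)) : ENNReal := volume (fin A)

/-! ### Rational maps -/

/-- The degree of a rational map. -/
def degree (R : RatFunc ℂ) : ℕ := max R.num.natDegree R.denom.natDegree

open Classical in
/-- The self-map of the sphere given by a rational function. -/
def toMap (R : RatFunc ℂ) : OnePoint ℂ → OnePoint ℂ
  | ∞ =>
    if R.denom.natDegree < R.num.natDegree then ∞
    else ((R.num.coeff R.denom.natDegree / R.denom.leadingCoeff : ℂ) : OnePoint ℂ)
  | (z : ℂ) =>
    if R.denom.eval z = 0 then ∞
    else ((R.num.eval z / R.denom.eval z : ℂ) : OnePoint ℂ)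

/-- The rational function as a function of the complex variable (with value `0` at poles). -/
def fC (R : RatFunc ℂ) (z : ℂ) : ℂ := R.num.eval z / R.denom.eval z

/-- The derivative of the rational function in the complex coordinate. -/
def fD (R : RatFunc ℂ) (z : ℂ) : ℂ := deriv (fC R) z

open Classical in
/-- `c` is a critical point of the map of the sphere: the derivative vanishes, where the coordinate
`1 / z` is used in the source if `c = ∞`, and in the target if the value at `c` is `∞`. -/
def IsCriticalPt (R : RatFunc ℂ) (c : OnePoint ℂ) : Prop :=
  deriv (fun t : ℂ =>
    let w := toMap R (if c = ∞ then sphInv (t : OnePoint ℂ) else (t : OnePoint ℂ))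
    if toMap R c = ∞ then coord (sphInv w) else coord w) (coord c) = 0

/-- The postcritical set: the closure of the forward orbits of the critical values. -/
def postcritical (R : RatFunc ℂ) : Set (OnePoint ℂ) :=
  closure {w | ∃ c, IsCriticalPt R c ∧ ∃ n : ℕ, 1 ≤ n ∧ w = (toMap R)^[n] c}

/-- The critical values that lie in the complex plane. -/
def critValues (R : RatFunc ℂ) : Set ℂ :=
  {v | ∃ c, IsCriticalPt R c ∧ toMap R c = (v : OnePoint ℂ)}

/-- The Fatou set: the points with a neighbourhood on which the iterates are equicontinuous for the
spherical metric (equivalently, by Arzelà–Ascoli, form a normal family). -/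
def fatouSet (R : RatFunc ℂ) : Set (OnePoint ℂ) :=
  {z | ∃ U ∈ 𝓝 z, ∀ x ∈ U, ∀ ε : ℝ, 0 < ε →
    ∀ᶠ y in 𝓝 x, ∀ n : ℕ, chordal ((toMap R)^[n] x) ((toMap R)^[n] y) < ε}

/-- The Julia set. -/
def juliaSet (R : RatFunc ℂ) : Set (OnePoint ℂ) := (fatouSet R)ᶜ

/-- A function from the plane to the sphere is holomorphic. -/
def IsHolomorphic (Θ : ℂ → OnePoint ℂ) : Prop :=
  Continuous Θ ∧ ∀ z, (Θ z ≠ ∞ → DifferentiableAt ℂ (fun w => coord (Θ w)) z) ∧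
    (Θ z = ∞ → DifferentiableAt ℂ (fun w => coord (sphInv (Θ w))) z)

/-- Flexible Lattès maps (maps double covered by an integral torus endomorphism): there are a
lattice `Λ` and a holomorphic `Θ` on `ℂ` inducing an injection of `(ℂ / Λ) / {±1}` into the sphere
such that `Θ` semiconjugates some `z ↦ a z + b`, with an integer `a`, `|a| ≥ 2`, to the map. -/
def IsFlexibleLattes (R : RatFunc ℂ) : Prop :=
  ∃ ω₁ ω₂ : ℂ, LinearIndependent ℝ ![ω₁, ω₂] ∧
    ∃ Θ : ℂ → OnePoint ℂ, IsHolomorphic Θ ∧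
      (∀ z w, Θ z = Θ w ↔ z - w ∈ AddSubgroup.closure ({ω₁, ω₂} : Set ℂ) ∨
        z + w ∈ AddSubgroup.closure ({ω₁, ω₂} : Set ℂ)) ∧
      ∃ (a : ℤ) (b : ℂ), 2 ≤ |a| ∧ ∀ z, toMap R (Θ z) = Θ ((a : ℂ) * z + b)

/-- For almost every point of the Julia set, the spherical distance from the iterates of the point
to the postcritical set tends to `0`. -/
def AeAttractedToPostcritical (R : RatFunc ℂ) : Prop :=
  ∀ᵐ z : ℂ, (z : OnePoint ℂ) ∈ juliaSet R →
    ∀ ε : ℝ, 0 < ε → ∀ᶠ n : ℕ in atTop,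
      ∃ w ∈ postcritical R, chordal ((toMap R)^[n] (z : OnePoint ℂ)) w < ε

/-! ### Fundamental sets -/

/-- `K' = f⁻¹(K) \ K`. -/
def primed (R : RatFunc ℂ) (K : Set (OnePoint ℂ)) : Set (OnePoint ℂ) := toMap R ⁻¹' K \ K

/-- The union of all iterated preimages of a set. -/
def backward (R : RatFunc ℂ) (K : Set (OnePoint ℂ)) : Set (OnePoint ℂ) :=
  ⋃ i : ℕ, (toMap R)^[i] ⁻¹' K

/-- Fundamental sets. -/
structure IsFundamental (R : RatFunc ℂ) (K : Set (OnePoint ℂ)) : Prop where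
  measurable : NullMeasurableSet (fin K) volume
  subset_julia : K ⊆ juliaSet R
  postcritical_subset : postcritical R ∩ juliaSet R ⊆ K
  mapsTo : MapsTo (toMap R) K K
  area_pos : 0 < area K
  area_primed_pos : 0 < area (primed R K)
  area_rest : area (juliaSet R \ (K ∪ backward R (primed R K))) = 0

/-! ### The operators, and the resolvent of the test functions -/

/-- The pullback (Ruelle–Thurston) operator `(T g)(x) = ∑_{f(y) = x} g(y) / f'(y)²`. -/
def T (R : RatFunc ℂ) (g : ℂ → ℂ) (x : ℂ) : ℂ :=
  ∑ᶠ y ∈ {y : ℂ | toMap R (y : OnePoint ℂ) = (x : OnePoint ℂ)}, g y / fD R y ^ 2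

/-- The pushforward operator `f^* ν = (ν ∘ f) |f'|² / (f')²`. -/
def push (R : RatFunc ℂ) (ν : ℂ → ℂ) (x : ℂ) : ℂ :=
  ν (fC R x) * ((‖fD R x‖ : ℂ) ^ 2 / fD R x ^ 2)

/-- The kernel `ψ_z(x) = z (z - 1) / (x (x - 1) (x - z))`. -/
def ψ (z x : ℂ) : ℂ := z * (z - 1) / (x * (x - 1) * (x - z))

/-- `Ω = ℂ \ (P ∪ {0, 1})`. -/
def Ω (R : RatFunc ℂ) : Set ℂ := {x | (x : OnePoint ℂ) ∉ postcritical R ∧ x ≠ 0 ∧ x ≠ 1}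

/-- The resolvent function `r_ψ = (1 - T)⁻¹ ψ = ∑_i T^i ψ` for `ψ = ψ_v`. -/
def r (R : RatFunc ℂ) (v x : ℂ) : ℂ := ∑' i : ℕ, ((T R)^[i] (ψ v)) x

/-- `σ^ψ = |r_ψ| / r_ψ` (with value `0` where `r_ψ` vanishes). -/
def σ (R : RatFunc ℂ) (v x : ℂ) : ℂ := (‖r R v x‖ : ℂ) / r R v x

/-- The set `K_∞`. -/
def Kinf (K : ℕ → Set (OnePoint ℂ)) : Set (OnePoint ℂ) := ⋂ n, K n

open Classical in
/-- The line field `σ^ψ_n`: it is `(f^i)^* σ^ψ` on `f^{-i}(K_n' \ K_∞')`, `i ≥ 0`, and `0`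
elsewhere. -/
def σn (R : RatFunc ℂ) (K : ℕ → Set (OnePoint ℂ)) (v : ℂ) (n : ℕ) (x : ℂ) : ℂ :=
  if h : ∃ i : ℕ, (toMap R)^[i] (x : OnePoint ℂ) ∈ primed R (K n) \ primed R (Kinf K) then
    ((push R)^[Nat.find h] (σ R v)) x
  else 0

/-! ### Invariant line fields -/

/-- `μ` is a measurable function of modulus `1` on a subset of positive area of the Julia set and
`0` elsewhere, and `f^* μ = μ` (all almost everywhere). -/
structure IsInvariantLineField (R : RatFunc ℂ) (μ : ℂ → ℂ) : Prop where
  aemeasurable : AEMeasurable μ volume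
  unimodular : ∀ᵐ x : ℂ, μ x = 0 ∨ (‖μ x‖ = 1 ∧ (x : OnePoint ℂ) ∈ juliaSet R)
  nontrivial : 0 < volume (Function.support μ)
  invariant : push R μ =ᵐ[volume] μ

/-- `μ` vanishes almost everywhere on `A`, i.e. it is supported on the complement of `A`. -/
def VanishesOn (μ : ℂ → ℂ) (A : Set (OnePoint ℂ)) : Prop :=
  ∀ᵐ x : ℂ, (x : OnePoint ℂ) ∈ A → μ x = 0

/-- The support `E_μ`, as a subset of the sphere. -/
def E (μ : ℂ → ℂ) : Set (OnePoint ℂ) := (fun z : ℂ => (z : OnePoint ℂ)) '' Function.support μ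

/-- Ergodic invariant line fields: the support is completely invariant and ergodic, and every
invariant line field with support contained in it agrees with `μ` up to a rotation. -/
structure IsErgodicInvariantLineField (R : RatFunc ℂ) (μ : ℂ → ℂ) : Prop
    extends IsInvariantLineField R μ where
  completely_invariant : ∀ᵐ x : ℂ, toMap R (x : OnePoint ℂ) ∈ E μ ↔ (x : OnePoint ℂ) ∈ E μ
  ergodic : ∀ A : Set (OnePoint ℂ), NullMeasurableSet (fin A) volume → toMap R ⁻¹' A = A →
    area (E μ ∩ A) = 0 ∨ area (E μ \ A) = 0
  unique : ∀ ν : ℂ → ℂ, IsInvariantLineField R ν → VanishesOn ν (E μ)ᶜ →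
    ∃ t : ℂ, ‖t‖ = 1 ∧ ν =ᵐ[volume] fun x => t * μ x

open Classical in
/-- The function `Δ_n = (μ - σ^ψ) ∘ f^j` on `f^{-j}(K_n' ∩ E_μ)`, `j ≥ 0` (and `0` elsewhere). -/
def Δn (R : RatFunc ℂ) (K : ℕ → Set (OnePoint ℂ)) (v : ℂ) (μ : ℂ → ℂ) (n : ℕ) (x : ℂ) : ℂ :=
  if h : ∃ j : ℕ, (toMap R)^[j] (x : OnePoint ℂ) ∈ primed R (K n) ∩ E μ then
    let y := coord ((toMap R)^[Nat.find h] (x : OnePoint ℂ))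
    μ y - σ R v y
  else 0

/-! ### Modes of convergence -/

/-- Convergence in the weak* topology of `L_∞(ℂ)`, the dual of `L_1(ℂ)`. -/
def WeakStarTendsto (u : ℕ → ℂ → ℂ) (ν : ℂ → ℂ) : Prop :=
  (∀ n, MemLp (u n) ⊤ volume) ∧ MemLp ν ⊤ volume ∧
    ∀ g : ℂ → ℂ, Integrable g volume →
      Tendsto (fun n => ∫ x, u n x * g x) atTop (𝓝 (∫ x, ν x * g x))

/-- Convergence in measure on a set of possibly infinite area: convergence in measure on each of its
subsets of finite area. -/
def TendstoInMeasureOn (A : Set (OnePoint ℂ)) (u : ℕ → ℂ → ℂ) (w : ℂ → ℂ) : Prop :=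
  ∀ F : Set ℂ, MeasurableSet F → volume F < ⊤ →
    TendstoInMeasure (volume.restrict (fin A ∩ F)) u atTop w

end RatDyn

end

/-!
The pullback `f^*` of line fields (`push`) is dual to the transfer operator `T`, which contracts
`L¹(ℂ)`: both facts are the change of variables formula, applied on the pieces of a partition of
the plane into sets where `f` is injective (`integrable_T_and_integral_T`, `integral_push_mul`).

*The resolvent.* Call a set `A` wandering if an orbit visits it at most once. Its preimages
`f^{-i}(A)` are disjoint, so `∑ ∫_A |T^i ψ| ≤ ∑ ∫_{f^{-i}(A)} |ψ| ≤ ∫ |ψ|`. Hence `r = ∑ T^i ψ` is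
integrable on `A`, and `∫_A ν r = ∫ ν̃ ψ`, where `ν̃` equals `(f^i)^* ν` on `f^{-i}(A)`
(`integral_mul_resolvent`). The sets `K_n'` are wandering, as is the set of points of a disc `D ⊆ Ω`
that never return to `D`. The latter has positive area, because almost every orbit tends to the
postcritical set and so visits `D` a last time (`volume_nonreturning_pos`). Over `D` the iterates
have univalent inverse branches `g`, and `T^i ψ = ∑ ψ(g) g'²`. Koebe distortion bounds, derived from
the area theorem, control the logarithmic derivative of each summand, since `g` omits the poles of
`ψ`. So the size of a summand at a point is comparable to its mean over the nonreturning set, and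
the disjointness of the preimages gives the pointwise convergence of the series
(`exists_summable_bound`, `resolvent_on_Ω`).

*The weak limits.* Let `S_n = K_n' \ K_∞'`. Duality with `ν = |r| / r` gives
`∫ σ_n ψ = ∫_{S_n} |r|`, and `f^* σ_n` differs from `σ_n` by `1_{S_n} |r| / r`. Every point outside
a null set lies in only finitely many `S_n`, so weak* limits of `σ_n` are fixed points of `f^*`
(`weakStar_limit`), and they are nonzero if `∫_{S_n} |r|` stays away from `0`. Conversely, if `μ` is
a fixed point of `f^*` that vanishes on the preimages of `K_∞`, then duality with `ν = μ` gives
`∫_{K_n'} μ r → ∫ μ ψ` (`tendsto_integral_primed`), so `∫_{S_n} |r|` stays away from `0` once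
`∫ μ ψ ≠ 0`.

*Detection by the critical values.* It remains to find a `ψ` with `∫ μ ψ ≠ 0`. Suppose that `μ`
annihilates every `ψ_v` with `v` a critical value. The function `T ψ_z` is integrable and
holomorphic except at `f(z)`, `0`, `1` and the critical values, so it is `ψ_{f(z)} / f'(z)` plus a
combination of the `ψ_v` (`exists_T_ψ_eq`). Therefore the potential `F(z) = ∫ μ ψ_z` satisfies
`F ∘ f = f' F`. It is continuous and `|F(z)| ≤ C (1 + |z|²)`, so on a disc where `F` is bounded away
from `0` the spherical derivatives of all the iterates are bounded, and the disc lies in the Fatou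
set. As the Julia set is the whole sphere, `F = 0`; integrating `F` over circles gives
`∫_D μ = 0` for every disc `D`, and `μ = 0` (`exists_integral_ψ_ne_zero`).

*Extremality.* Let `μ` be ergodic with `∫ μ ψ > 0`. A weak* limit of `1_{E_μ} σ_n` is a fixed point
of `f^*` supported in `E_μ`, hence `c μ` with `|c| ≤ 1`. Its pairing with `ψ` is
`lim ∫_{S_n ∩ E_μ} |r| ≥ lim |∫_{K_n'} μ r| = ∫ μ ψ`, which forces `c = 1` (`weakStar_limit_eq`).
Since the closed unit disc is strictly convex and `|μ| = 1` on `E_μ`, the weak* convergence improves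
to convergence in measure (`tendstoInMeasure_of_weakStar`).
-/

noncomputable section

namespace RatDyn

/-! ### Rational maps fixing the point at infinity: fibres and critical values -/

section

variable {R : RatFunc ℂ}

lemma denom_lt_num_of_map_infty (h : toMap R ∞ = ∞) : R.denom.natDegree < R.num.natDegree := by
  by_contra hlt
  simp only [toMap, if_neg hlt] at h
  exact OnePoint.coe_ne_infty _ h

lemma coord_coe (z : ℂ) : coord (z : OnePoint ℂ) = z := rfl

lemma toMap_coe_of_ne {z : ℂ} (h : R.denom.eval z ≠ 0) :
    toMap R (z : OnePoint ℂ) = ((fC R z : ℂ) : OnePoint ℂ) := by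
  simp [toMap, h, fC]

lemma toMap_coe_of_eq {z : ℂ} (h : R.denom.eval z = 0) : toMap R (z : OnePoint ℂ) = ∞ := by
  simp [toMap, h]

lemma coord_toMap (z : ℂ) : coord (toMap R (z : OnePoint ℂ)) = fC R z := by
  by_cases h : R.denom.eval z = 0
  · rw [toMap_coe_of_eq h]
    simp [coord, fC, h]
  · rw [toMap_coe_of_ne h, coord_coe]

lemma toMap_coe_eq_coe_iff {y x : ℂ} :
    toMap R (y : OnePoint ℂ) = (x : OnePoint ℂ) ↔ R.denom.eval y ≠ 0 ∧ fC R y = x := by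
  by_cases h : R.denom.eval y = 0
  · simp [toMap_coe_of_eq h, h]
  · simp [toMap_coe_of_ne h, h]

/-- The polynomial `num - x * denom`, whose roots are the finite preimages of `x`. -/
def fibrePoly (R : RatFunc ℂ) (x : ℂ) : Polynomial ℂ := R.num - Polynomial.C x * R.denom

/-- The preimages of `x` in the plane. -/
def fibre (R : RatFunc ℂ) (x : ℂ) : Set ℂ := {y : ℂ | toMap R (y : OnePoint ℂ) = (x : OnePoint ℂ)}

lemma num_ne_zero_of_denom_eq_zero {y : ℂ} (h : R.denom.eval y = 0) : R.num.eval y ≠ 0 := by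
  intro hn
  obtain ⟨a, b, hab⟩ := R.isCoprime_num_denom
  simpa [hn, h] using congrArg (Polynomial.eval y) hab

lemma mem_fibre_iff {x y : ℂ} : y ∈ fibre R x ↔ (fibrePoly R x).eval y = 0 := by
  rw [fibre, mem_ofPred_eq, toMap_coe_eq_coe_iff]
  simp only [fibrePoly, Polynomial.eval_sub, Polynomial.eval_mul, Polynomial.eval_C, fC]
  constructor
  · rintro ⟨h, rfl⟩
    field_simp
    simp
  · intro h
    by_cases hd : R.denom.eval y = 0
    · exact absurd (by simpa [hd] using h) (num_ne_zero_of_denom_eq_zero hd)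
    · exact ⟨hd, by field_simp; linear_combination h⟩

lemma denom_ne_zero_of_mem_fibre {x y : ℂ} (h : y ∈ fibre R x) : R.denom.eval y ≠ 0 :=
  (toMap_coe_eq_coe_iff.1 h).1

lemma fC_of_mem_fibre {x y : ℂ} (h : y ∈ fibre R x) : fC R y = x :=
  (toMap_coe_eq_coe_iff.1 h).2

lemma mem_fibre_fC {y : ℂ} (h : R.denom.eval y ≠ 0) : y ∈ fibre R (fC R y) :=
  toMap_coe_eq_coe_iff.2 ⟨h, rfl⟩

lemma natDegree_fibrePoly (hR : R.denom.natDegree < R.num.natDegree) (x : ℂ) :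
    (fibrePoly R x).natDegree = R.num.natDegree :=
  Polynomial.natDegree_sub_eq_left_of_natDegree_lt
    ((Polynomial.natDegree_C_mul_le _ _).trans_lt hR)

lemma fibrePoly_ne_zero (hR : R.denom.natDegree < R.num.natDegree) (x : ℂ) :
    fibrePoly R x ≠ 0 := by
  intro h
  have := natDegree_fibrePoly hR x
  rw [h, Polynomial.natDegree_zero] at this
  omega

lemma fibre_eq_roots (hR : R.denom.natDegree < R.num.natDegree) (x : ℂ) :
    fibre R x = ((fibrePoly R x).roots.toFinset : Set ℂ) := by
  ext y
  simp [mem_fibre_iff, fibrePoly_ne_zero hR x]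

lemma finite_fibre (hR : R.denom.natDegree < R.num.natDegree) (x : ℂ) : (fibre R x).Finite := by
  rw [fibre_eq_roots hR]
  exact Finset.finite_toSet _

lemma hasStrictDerivAt_fC {z : ℂ} (h : R.denom.eval z ≠ 0) :
    HasStrictDerivAt (fC R) (fD R z) z := by
  have h1 := (R.num.hasStrictDerivAt z).fun_div (R.denom.hasStrictDerivAt z) h
  have h2 : fD R z = _ := h1.hasDerivAt.deriv
  rw [h2]
  exact h1

lemma hasDerivAt_fC {z : ℂ} (h : R.denom.eval z ≠ 0) : HasDerivAt (fC R) (fD R z) z :=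
  (hasStrictDerivAt_fC h).hasDerivAt

lemma fD_eq {z : ℂ} (h : R.denom.eval z ≠ 0) :
    fD R z = (R.num.derivative.eval z * R.denom.eval z - R.num.eval z * R.denom.derivative.eval z)
      / R.denom.eval z ^ 2 :=
  ((R.num.hasStrictDerivAt z).fun_div (R.denom.hasStrictDerivAt z) h).hasDerivAt.deriv

lemma isOpen_denom_ne : IsOpen {z : ℂ | R.denom.eval z ≠ 0} :=
  isOpen_ne_fun R.denom.continuous continuous_const

lemma denom_eval_set_finite : {z : ℂ | R.denom.eval z = 0}.Finite := by
  have : {z : ℂ | R.denom.eval z = 0} = (R.denom.roots.toFinset : Set ℂ) := by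
    ext z
    simp [R.denom_ne_zero]
  rw [this]
  exact Finset.finite_toSet _

lemma differentiableOn_fC : DifferentiableOn ℂ (fC R) {z : ℂ | R.denom.eval z ≠ 0} :=
  fun _ hz => (hasDerivAt_fC hz).differentiableAt.differentiableWithinAt

lemma differentiableOn_fD : DifferentiableOn ℂ (fD R) {z : ℂ | R.denom.eval z ≠ 0} :=
  differentiableOn_fC.deriv isOpen_denom_ne

lemma isCriticalPt_coe_iff {y : ℂ} (h : R.denom.eval y ≠ 0) :
    IsCriticalPt R (y : OnePoint ℂ) ↔ fD R y = 0 := by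
  simp [IsCriticalPt, toMap_coe_of_ne h, coord_toMap, fD, coord_coe]

lemma mem_critValues_of_fD_eq_zero {x y : ℂ} (h : y ∈ fibre R x) (hd : fD R y = 0) :
    x ∈ critValues R :=
  ⟨y, (isCriticalPt_coe_iff (denom_ne_zero_of_mem_fibre h)).2 hd, h⟩

lemma fD_ne_zero_of_notMem {x y : ℂ} (h : y ∈ fibre R x) (hx : x ∉ critValues R) : fD R y ≠ 0 :=
  fun hd => hx (mem_critValues_of_fD_eq_zero h hd)

lemma fibrePoly_derivative_eval {x y : ℂ} (h : y ∈ fibre R x) :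
    (fibrePoly R x).derivative.eval y = fD R y * R.denom.eval y := by
  have hq := denom_ne_zero_of_mem_fibre h
  rw [fD_eq hq]
  have := mem_fibre_iff.1 h
  simp only [fibrePoly, Polynomial.eval_sub, Polynomial.eval_mul, Polynomial.eval_C,
    Polynomial.derivative_sub, Polynomial.derivative_mul, Polynomial.derivative_C, zero_mul,
    zero_add] at this ⊢
  field_simp
  linear_combination (R.denom.derivative.eval y) * this

/-- Away from the critical values all fibres have the same number of points. -/
lemma ncard_fibre (hR : R.denom.natDegree < R.num.natDegree) {x : ℂ} (hx : x ∉ critValues R) :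
    (fibre R x).ncard = R.num.natDegree := by
  classical
  have hnodup : (fibrePoly R x).roots.Nodup := by
    rw [Multiset.nodup_iff_count_le_one]
    intro y
    rw [Polynomial.count_roots]
    by_contra hlt
    obtain ⟨h1, h2⟩ :=
      (Polynomial.one_lt_rootMultiplicity_iff_isRoot (fibrePoly_ne_zero hR x)).1 (not_le.1 hlt)
    have hy : y ∈ fibre R x := mem_fibre_iff.2 h1
    have h3 := fibrePoly_derivative_eval hy
    rw [h2] at h3
    exact mul_ne_zero (fD_ne_zero_of_notMem hy hx) (denom_ne_zero_of_mem_fibre hy) h3.symm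
  rw [fibre_eq_roots hR, Set.ncard_coe_finset, Multiset.toFinset_card_of_nodup hnodup,
    IsAlgClosed.card_roots_eq_natDegree, natDegree_fibrePoly hR]

/-- The numerator of the derivative is not the zero polynomial. -/
lemma wronskian_ne_zero (hR : R.denom.natDegree < R.num.natDegree) :
    R.num.derivative * R.denom - R.num * R.denom.derivative ≠ 0 := by
  intro h
  -- `denom` divides `denom'`, hence is constant, and then `num' = 0`
  have h1 : R.denom ∣ R.num * R.denom.derivative :=
    ⟨R.num.derivative, by linear_combination -h⟩
  have h2 : R.denom ∣ R.denom.derivative := R.isCoprime_num_denom.symm.dvd_of_dvd_mul_left h1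
  have h3 : R.denom.derivative = 0 := by
    by_contra hne
    have h4 := Polynomial.degree_le_of_dvd h2 hne
    exact absurd (Polynomial.degree_derivative_lt R.denom_ne_zero) (not_lt.2 h4)
  rw [h3, mul_zero, sub_zero] at h
  rcases mul_eq_zero.1 h with h | h
  · have := Polynomial.derivative_eq_zero.1 h
    omega
  · exact R.denom_ne_zero h

lemma finite_setOf_fD_eq_zero (hR : R.denom.natDegree < R.num.natDegree) :
    {z : ℂ | R.denom.eval z ≠ 0 ∧ fD R z = 0}.Finite := by
  refine (Finset.finite_toSet
    (R.num.derivative * R.denom - R.num * R.denom.derivative).roots.toFinset).subset ?_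
  rintro z ⟨hz, h0⟩
  rw [fD_eq hz, div_eq_zero_iff] at h0
  have : R.num.derivative.eval z * R.denom.eval z - R.num.eval z * R.denom.derivative.eval z = 0 :=
    h0.resolve_right (pow_ne_zero 2 hz)
  simpa [wronskian_ne_zero hR] using this

lemma finite_critValues (hR : R.denom.natDegree < R.num.natDegree) (hinf : toMap R ∞ = ∞) :
    (critValues R).Finite := by
  refine ((finite_setOf_fD_eq_zero hR).image (fC R)).subset ?_
  rintro v ⟨c, hc, hv⟩
  induction c using OnePoint.rec with
  | infty => rw [hinf] at hv; exact absurd hv.symm (OnePoint.coe_ne_infty v)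
  | coe y =>
    have hy : y ∈ fibre R v := hv
    have hq := denom_ne_zero_of_mem_fibre hy
    exact ⟨y, ⟨hq, (isCriticalPt_coe_iff hq).1 hc⟩, fC_of_mem_fibre hy⟩

/-! ### Continuity on the sphere -/

lemma tendsto_fC_cobounded (hR : R.denom.natDegree < R.num.natDegree) :
    Tendsto (fC R) (Bornology.cobounded ℂ) (Bornology.cobounded ℂ) := by
  have hdeg : R.denom.degree < R.num.degree := Polynomial.degree_lt_degree hR
  have h := Polynomial.isLittleO_cobounded_of_degree_lt hdeg
  have h1 : Tendsto (fun z => R.denom.eval z / R.num.eval z) (Bornology.cobounded ℂ) (𝓝 0) :=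
    h.tendsto_div_nhds_zero
  have hne : ∀ᶠ z in Bornology.cobounded ℂ, R.denom.eval z / R.num.eval z ≠ 0 := by
    have hfin : {z : ℂ | R.denom.eval z / R.num.eval z = 0}.Finite := by
      refine ((denom_eval_set_finite (R := R)).union
        (Finset.finite_toSet R.num.roots.toFinset)).subset ?_
      intro z hz
      rcases div_eq_zero_iff.1 hz with h | h
      · exact Or.inl h
      · refine Or.inr ?_
        have : R.num ≠ 0 := by rintro h0; rw [h0] at hR; simp at hR
        simpa [this] using h
    exact Bornology.isBounded_def.1 hfin.isBounded
  have h2 : Tendsto (fun z => R.denom.eval z / R.num.eval z) (Bornology.cobounded ℂ) (𝓝[≠] 0) :=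
    tendsto_nhdsWithin_iff.2 ⟨h1, hne⟩
  have h3 := tendsto_inv₀_nhdsNE_zero.comp h2
  refine h3.congr fun z => ?_
  simp [fC]

lemma coclosedCompact_eq : coclosedCompact ℂ = Bornology.cobounded ℂ := by
  rw [coclosedCompact_eq_cocompact, Metric.cobounded_eq_cocompact]

lemma tendsto_coe_infty_iff {α : Type*} {l : Filter α} {u : α → ℂ}
    (h : Tendsto u l (Bornology.cobounded ℂ)) :
    Tendsto (fun a => (u a : OnePoint ℂ)) l (𝓝 ∞) := by
  have := OnePoint.tendsto_coe_infty (X := ℂ)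
  rw [coclosedCompact_eq] at this
  exact this.comp h

lemma continuousAt_toMap_coe {z : ℂ} (h : R.denom.eval z ≠ 0) :
    ContinuousAt (toMap R) (z : OnePoint ℂ) := by
  rw [OnePoint.continuousAt_coe]
  have h1 : ContinuousAt (fun w : ℂ => ((fC R w : ℂ) : OnePoint ℂ)) z :=
    (OnePoint.continuous_coe.continuousAt (x := fC R z)).comp
      (hasDerivAt_fC h).continuousAt
  refine h1.congr ?_
  filter_upwards [isOpen_denom_ne.mem_nhds h] with w hw
  exact (toMap_coe_of_ne hw).symm

/-- A rational map fixing infinity is continuous on the sphere. -/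
lemma continuous_toMap (hR : R.denom.natDegree < R.num.natDegree) (hinf : toMap R ∞ = ∞) :
    Continuous (toMap R) := by
  have key : ∀ (l : Filter ℂ), (∀ᶠ z in l, R.denom.eval z ≠ 0 →
      toMap R (z : OnePoint ℂ) = ((fC R z : ℂ) : OnePoint ℂ)) := fun l =>
    Eventually.of_forall fun z hz => toMap_coe_of_ne hz
  rw [continuous_iff_continuousAt]
  intro z
  induction z using OnePoint.rec with
  | infty =>
    rw [OnePoint.continuousAt_infty', hinf, coclosedCompact_eq]
    refine (tendsto_coe_infty_iff (tendsto_fC_cobounded hR)).congr' ?_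
    filter_upwards [Bornology.isBounded_def.1 (denom_eval_set_finite (R := R)).isBounded] with z hz
    exact (toMap_coe_of_ne hz).symm
  | coe z =>
    by_cases hz : R.denom.eval z = 0
    · rw [OnePoint.continuousAt_coe, ContinuousAt, Function.comp_apply, toMap_coe_of_eq hz]
      -- near a pole `1 / f` tends to `0`
      have hn := num_ne_zero_of_denom_eq_zero hz
      have h1 : Tendsto (fun w => R.denom.eval w / R.num.eval w) (𝓝[≠] z) (𝓝[≠] 0) := by
        refine tendsto_nhdsWithin_iff.2 ⟨?_, ?_⟩
        · have : ContinuousAt (fun w => R.denom.eval w / R.num.eval w) z :=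
            R.denom.continuous.continuousAt.div R.num.continuous.continuousAt hn
          have := this.tendsto
          rw [hz, zero_div] at this
          exact this.mono_left nhdsWithin_le_nhds
        · have e1 : ∀ᶠ w in 𝓝[≠] z, R.num.eval w ≠ 0 :=
            nhdsWithin_le_nhds (R.num.continuous.continuousAt.eventually_ne hn)
          have e2 : ∀ᶠ w in 𝓝[≠] z, R.denom.eval w ≠ 0 := by
            have : ({w : ℂ | R.denom.eval w = 0} \ {z}).Finite :=
              (denom_eval_set_finite (R := R)).subset sdiff_subset
            have h2 := this.isClosed.isOpen_compl.mem_nhds (x := z) (by simp)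
            filter_upwards [nhdsWithin_le_nhds h2, self_mem_nhdsWithin] with w hw hwz h0
            exact hw ⟨h0, hwz⟩
          filter_upwards [e1, e2] with w h1 h2
          exact div_ne_zero h2 h1
      have h3 : Tendsto (fC R) (𝓝[≠] z) (Bornology.cobounded ℂ) := by
        refine (tendsto_inv₀_nhdsNE_zero.comp h1).congr fun w => ?_
        simp [fC]
      have h4 : Tendsto (fun w : ℂ => toMap R (w : OnePoint ℂ)) (𝓝[≠] z) (𝓝 ∞) := by
        refine (tendsto_coe_infty_iff h3).congr' ?_
        have e2 : ∀ᶠ w in 𝓝[≠] z, R.denom.eval w ≠ 0 := by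
          have := (tendsto_nhdsWithin_iff.1 h1).2
          filter_upwards [this] with w hw h0
          simp [h0] at hw
        filter_upwards [e2] with w hw
        exact (toMap_coe_of_ne hw).symm
      have h5 : pure (toMap R (z : OnePoint ℂ)) ≤ 𝓝 (∞ : OnePoint ℂ) := by
        rw [toMap_coe_of_eq hz]; exact pure_le_nhds _
      rw [← nhdsNE_sup_pure]
      exact h4.sup (tendsto_pure_left.2 fun s hs => h5 hs)
    · exact continuousAt_toMap_coe hz

/-! ### The postcritical set and its complement -/

lemma isClosed_postcritical : IsClosed (postcritical R) := isClosed_closure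

lemma critValue_mem_postcritical {v : ℂ} (h : v ∈ critValues R) :
    (v : OnePoint ℂ) ∈ postcritical R := by
  obtain ⟨c, hc, hv⟩ := h
  exact subset_closure ⟨c, hc, 1, le_rfl, by simp [hv]⟩

lemma mapsTo_postcritical (hR : R.denom.natDegree < R.num.natDegree) (hinf : toMap R ∞ = ∞) :
    MapsTo (toMap R) (postcritical R) (postcritical R) := by
  refine MapsTo.closure ?_ (continuous_toMap hR hinf)
  rintro w ⟨c, hc, n, hn, rfl⟩
  exact ⟨c, hc, n + 1, by omega, by rw [Function.iterate_succ_apply']⟩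

lemma isOpen_Ω : IsOpen (Ω R) := by
  have h1 : IsOpen {x : ℂ | (x : OnePoint ℂ) ∉ postcritical R} :=
    isClosed_postcritical.isOpen_compl.preimage OnePoint.continuous_coe
  exact h1.inter (isOpen_ne.inter isOpen_ne)

lemma notMem_critValues_of_mem_Ω {x : ℂ} (hx : x ∈ Ω R) : x ∉ critValues R :=
  fun h => hx.1 (critValue_mem_postcritical h)

lemma fibre_subset_Ω (hR : R.denom.natDegree < R.num.natDegree) (hinf : toMap R ∞ = ∞)
    (hone : toMap R ((1 : ℂ) : OnePoint ℂ) = ((1 : ℂ) : OnePoint ℂ))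
    (hzero : toMap R ((0 : ℂ) : OnePoint ℂ) = ((0 : ℂ) : OnePoint ℂ))
    {x : ℂ} (hx : x ∈ Ω R) : fibre R x ⊆ Ω R := by
  intro y hy
  refine ⟨fun h => hx.1 ?_, ?_, ?_⟩
  · have := mapsTo_postcritical hR hinf h
    rwa [show toMap R (y : OnePoint ℂ) = x from hy] at this
  · rintro rfl
    have h2 : ((0 : ℂ) : OnePoint ℂ) = (x : OnePoint ℂ) := hzero.symm.trans hy
    exact hx.2.1 (OnePoint.coe_injective h2).symm
  · rintro rfl
    have h2 : ((1 : ℂ) : OnePoint ℂ) = (x : OnePoint ℂ) := hone.symm.trans hy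
    exact hx.2.2 (OnePoint.coe_injective h2).symm

/-! ### The operator `T` as a finite sum -/

lemma T_eq_sum (hR : R.denom.natDegree < R.num.natDegree) (g : ℂ → ℂ) (x : ℂ) :
    T R g x = ∑ y ∈ (finite_fibre hR x).toFinset, g y / fD R y ^ 2 :=
  finsum_mem_eq_finite_toFinset_sum _ (finite_fibre hR x)

/-! ### Orbits avoiding infinity -/

/-- The points of the plane whose forward orbit never meets a pole. -/
def regularPts (R : RatFunc ℂ) : Set ℂ := {z | ∀ n, R.denom.eval ((fC R)^[n] z) ≠ 0}

lemma countable_preimage_fC (hR : R.denom.natDegree < R.num.natDegree) {S : Set ℂ}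
    (hS : S.Countable) : (fC R ⁻¹' S).Countable := by
  have : fC R ⁻¹' S ⊆ {z | R.denom.eval z = 0} ∪ ⋃ x ∈ S, fibre R x := by
    intro z hz
    by_cases h : R.denom.eval z = 0
    · exact Or.inl h
    · exact Or.inr (mem_biUnion hz (mem_fibre_fC h))
  exact ((denom_eval_set_finite (R := R)).countable.union
    (hS.biUnion fun x _ => (finite_fibre hR x).countable)).mono this

lemma countable_compl_regularPts (hR : R.denom.natDegree < R.num.natDegree) :
    (regularPts R)ᶜ.Countable := by
  have : (regularPts R)ᶜ = ⋃ n, (fC R)^[n] ⁻¹' {z | R.denom.eval z = 0} := by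
    ext z; simp [regularPts]
  rw [this]
  refine countable_iUnion fun n => ?_
  induction n with
  | zero => simpa using (denom_eval_set_finite (R := R)).countable
  | succ n ih =>
    rw [Function.iterate_succ, preimage_comp]
    exact countable_preimage_fC hR ih

lemma ae_regularPts (hR : R.denom.natDegree < R.num.natDegree) : ∀ᵐ z : ℂ, z ∈ regularPts R :=
  (countable_compl_regularPts hR).measure_zero _

lemma iterate_toMap_coe {z : ℂ} (hz : z ∈ regularPts R) (n : ℕ) :
    (toMap R)^[n] (z : OnePoint ℂ) = (((fC R)^[n] z : ℂ) : OnePoint ℂ) := by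
  induction n with
  | zero => rfl
  | succ n ih =>
    rw [Function.iterate_succ_apply', Function.iterate_succ_apply', ih, toMap_coe_of_ne (hz n)]

lemma fC_mem_regularPts {z : ℂ} (hz : z ∈ regularPts R) : fC R z ∈ regularPts R :=
  fun n => hz (n + 1)

end

/-! ### Change of variables -/

section

variable {R : RatFunc ℂ}

lemma det_smul_one (c : ℂ) : (c • (1 : ℂ →L[ℝ] ℂ)).det = ‖c‖ ^ 2 := by
  rw [ContinuousLinearMap.det, ← LinearMap.det_toMatrix Complex.basisOneI, Matrix.det_fin_two]
  simp [LinearMap.toMatrix_apply, ← Complex.normSq_eq_norm_sq, Complex.normSq_apply]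

lemma lintegral_image_holomorphic {f f' : ℂ → ℂ} {s : Set ℂ} (hs : MeasurableSet s)
    (hf : ∀ x ∈ s, HasDerivAt f (f' x) x) (hi : InjOn f s) (g : ℂ → ENNReal) :
    ∫⁻ x in f '' s, g x = ∫⁻ x in s, ENNReal.ofReal (‖f' x‖ ^ 2) * g (f x) := by
  rw [lintegral_image_eq_lintegral_abs_det_fderiv_mul volume hs
    (fun x hx => (hf x hx).complexToReal_fderiv.hasFDerivWithinAt) hi]
  simp_rw [det_smul_one, abs_sq]

lemma integral_image_holomorphic {f f' : ℂ → ℂ} {s : Set ℂ} (hs : MeasurableSet s)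
    (hf : ∀ x ∈ s, HasDerivAt f (f' x) x) (hi : InjOn f s) {F : Type*} [NormedAddCommGroup F]
    [NormedSpace ℝ F] (g : ℂ → F) :
    ∫ x in f '' s, g x = ∫ x in s, (‖f' x‖ ^ 2) • g (f x) := by
  rw [integral_image_eq_integral_abs_det_fderiv_smul volume hs
    (fun x hx => (hf x hx).complexToReal_fderiv.hasFDerivWithinAt) hi]
  simp_rw [det_smul_one, abs_sq]

lemma integrableOn_image_holomorphic {f f' : ℂ → ℂ} {s : Set ℂ} (hs : MeasurableSet s)
    (hf : ∀ x ∈ s, HasDerivAt f (f' x) x) (hi : InjOn f s) {F : Type*} [NormedAddCommGroup F]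
    [NormedSpace ℝ F] (g : ℂ → F) :
    IntegrableOn g (f '' s) ↔ IntegrableOn (fun x => (‖f' x‖ ^ 2) • g (f x)) s := by
  rw [integrableOn_image_iff_integrableOn_abs_det_fderiv_smul volume hs
    (fun x hx => (hf x hx).complexToReal_fderiv.hasFDerivWithinAt) hi]
  simp_rw [det_smul_one, abs_sq]

/-- The points where `f` is finite and a local homeomorphism. -/
def unramified (R : RatFunc ℂ) : Set ℂ := {z | R.denom.eval z ≠ 0 ∧ fD R z ≠ 0}

lemma finite_compl_unramified (hR : R.denom.natDegree < R.num.natDegree) :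
    (unramified R)ᶜ.Finite := by
  refine ((denom_eval_set_finite (R := R)).union (finite_setOf_fD_eq_zero hR)).subset ?_
  intro z hz
  by_cases h : R.denom.eval z = 0
  · exact Or.inl h
  · refine Or.inr ⟨h, ?_⟩
    by_contra h2
    exact hz ⟨h, h2⟩

lemma ae_unramified (hR : R.denom.natDegree < R.num.natDegree) :
    ∀ᵐ z : ℂ, z ∈ unramified R :=
  (finite_compl_unramified hR).countable.measure_zero _

/-- Up to the finitely many poles and critical points, the plane is a countable disjoint union of
measurable sets on which `f` is injective. -/
lemma exists_injective_partition (hR : R.denom.natDegree < R.num.natDegree) :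
    ∃ E : ℕ → Set ℂ, (∀ k, MeasurableSet (E k)) ∧ Pairwise (Function.onFun Disjoint E) ∧
      (∀ k, InjOn (fC R) (E k)) ∧ ⋃ k, E k = unramified R := by
  have hU : ∀ z ∈ unramified R, ∃ U : Set ℂ, IsOpen U ∧ z ∈ U ∧ InjOn (fC R) U := by
    rintro z ⟨h1, h2⟩
    have h := (hasStrictDerivAt_fC h1).hasStrictFDerivAt_equiv h2
    exact ⟨_, (HasStrictFDerivAt.toOpenPartialHomeomorph _ h).open_source,
      h.mem_toOpenPartialHomeomorph_source,
      (HasStrictFDerivAt.toOpenPartialHomeomorph _ h).injOn⟩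
  choose! U hUo hUz hUi using hU
  obtain ⟨t, hts, htc, htU⟩ := TopologicalSpace.countable_cover_nhdsWithin (f := U)
    (s := unramified R) fun z hz => mem_nhdsWithin_of_mem_nhds ((hUo z hz).mem_nhds (hUz z hz))
  have hne : t.Nonempty := by
    by_contra hempty
    rw [not_nonempty_iff_eq_empty] at hempty
    have h0 : unramified R = ∅ := by simpa [hempty, subset_empty_iff] using htU
    have hfin := finite_compl_unramified hR
    rw [h0, compl_empty] at hfin
    exact infinite_univ hfin
  obtain ⟨e, rfl⟩ := htc.exists_eq_range hne
  have he : ∀ k, e k ∈ unramified R := fun k => hts ⟨k, rfl⟩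
  have hmN : MeasurableSet (unramified R) := by
    have := (finite_compl_unramified hR).measurableSet.compl
    rwa [compl_compl] at this
  refine ⟨disjointed fun k => U (e k) ∩ unramified R,
    MeasurableSet.disjointed fun k => (hUo _ (he k)).measurableSet.inter hmN,
    disjoint_disjointed _, fun k => ?_, ?_⟩
  · exact (hUi _ (he k)).mono ((disjointed_subset _ k).trans inter_subset_left)
  · rw [iUnion_disjointed, ← iUnion_inter]
    refine inter_eq_right.2 fun z hz => ?_
    have := htU hz
    simpa using this

lemma measurable_fC : Measurable (fC R) :=
  R.num.continuous.measurable.div R.denom.continuous.measurable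

lemma measurable_fD : Measurable (fD R) := measurable_deriv _

lemma measurable_iterate_fC (n : ℕ) : Measurable (fC R)^[n] := measurable_fC.iterate n

/-- Preimages of null sets under a rational map are null sets. -/
lemma quasiMeasurePreserving_fC (hR : R.denom.natDegree < R.num.natDegree) :
    Measure.QuasiMeasurePreserving (fC R) volume volume := by
  refine ⟨measurable_fC, Measure.AbsolutelyContinuous.mk fun A hA h0 => ?_⟩
  rw [Measure.map_apply measurable_fC hA]
  obtain ⟨E, hEm, hEd, hEi, hEu⟩ := exists_injective_partition hR
  have hsub : fC R ⁻¹' A ⊆ (unramified R)ᶜ ∪ ⋃ k, (fC R ⁻¹' A ∩ E k) := by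
    intro z hz
    by_cases h : z ∈ unramified R
    · right
      rw [← inter_iUnion, hEu]
      exact ⟨hz, h⟩
    · exact Or.inl h
  refine measure_mono_null hsub (measure_union_null
    ((finite_compl_unramified hR).countable.measure_zero _) (measure_iUnion_null fun k => ?_))
  have hm : MeasurableSet (fC R ⁻¹' A ∩ E k) := (measurable_fC hA).inter (hEm k)
  have hEN : ∀ z ∈ E k, z ∈ unramified R := fun z hz => hEu ▸ mem_iUnion.2 ⟨k, hz⟩
  -- `∫ |f'|²` over `f⁻¹(A) ∩ E_k` is the area of a subset of `A`, and `f'` has no zeros there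
  have h1 := lintegral_image_holomorphic hm
    (fun x hx => hasDerivAt_fC (hEN x hx.2).1) ((hEi k).mono inter_subset_right) (fun _ => 1)
  have h2 : volume (fC R '' (fC R ⁻¹' A ∩ E k)) = 0 :=
    measure_mono_null (by rintro _ ⟨z, hz, rfl⟩; exact hz.1) h0
  simp only [mul_one, setLIntegral_const, h2, mul_zero] at h1
  have h3 := (setLIntegral_eq_zero_iff hm
    ((measurable_fD.norm.pow_const 2).ennreal_ofReal)).1 h1.symm
  have h4 : ∀ᵐ z : ℂ, z ∉ fC R ⁻¹' A ∩ E k := by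
    filter_upwards [h3] with z hz hzA
    have := hz hzA
    rw [ENNReal.ofReal_eq_zero] at this
    have hpos : 0 < ‖fD R z‖ ^ 2 := by
      have := (hEN z hzA.2).2
      positivity
    linarith
  exact measure_eq_zero_iff_ae_notMem.2 h4

lemma quasiMeasurePreserving_iterate (hR : R.denom.natDegree < R.num.natDegree) (n : ℕ) :
    Measure.QuasiMeasurePreserving (fC R)^[n] volume volume :=
  (quasiMeasurePreserving_fC hR).iterate n

/-! ### The transfer operator on integrable functions -/

/-- Functions of the base pass through the transfer operator. -/
lemma T_comp_mul (hR : R.denom.natDegree < R.num.natDegree) (u g : ℂ → ℂ) (x : ℂ) :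
    T R (fun y => u (fC R y) * g y) x = u x * T R g x := by
  rw [T_eq_sum hR, T_eq_sum hR, Finset.mul_sum]
  refine Finset.sum_congr rfl fun y hy => ?_
  have hy' : y ∈ fibre R x := by simpa using hy
  rw [fC_of_mem_fibre hy']
  ring

lemma iterate_T_comp_mul (hR : R.denom.natDegree < R.num.natDegree) (n : ℕ) (u g : ℂ → ℂ) :
    (T R)^[n] (fun y => u ((fC R)^[n] y) * g y) = fun x => u x * (T R)^[n] g x := by
  induction n generalizing g with
  | zero => rfl
  | succ n ih =>
    rw [Function.iterate_succ_apply, Function.iterate_succ_apply, ← ih]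
    congr 1
    ext x
    exact T_comp_mul hR (fun z => u ((fC R)^[n] z)) g x

open Classical in
/-- The transfer operator is a sum of changes of variables over the pieces of a partition into sets
of injectivity. Critical points lie in no piece, and contribute `0` to `T` because division by `0`
gives `0`. -/
lemma hasSum_T (hR : R.denom.natDegree < R.num.natDegree) {E : ℕ → Set ℂ}
    (hEd : Pairwise (Function.onFun Disjoint E)) (hEi : ∀ k, InjOn (fC R) (E k))
    (hEu : ⋃ k, E k = unramified R) (g : ℂ → ℂ) (x : ℂ) :
    HasSum (fun k => (fC R '' E k).indicator (fun x => g (Function.invFunOn (fC R) (E k) x) /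
      fD R (Function.invFunOn (fC R) (E k) x) ^ 2) x) (T R g x) := by
  have hEN : ∀ k, ∀ z ∈ E k, z ∈ unramified R := fun k z hz => hEu ▸ mem_iUnion.2 ⟨k, hz⟩
  rw [T_eq_sum hR]
  -- each point of the fibre is counted in exactly one piece, unless it is critical
  have h1 : ∀ y ∈ (finite_fibre hR x).toFinset,
      HasSum (fun k => if y ∈ E k then g y / fD R y ^ 2 else 0) (g y / fD R y ^ 2) := by
    intro y hy
    have hy' : y ∈ fibre R x := by simpa using hy
    by_cases hN : y ∈ unramified R
    · obtain ⟨k, hk⟩ := mem_iUnion.1 (hEu ▸ hN : y ∈ ⋃ k, E k)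
      have := hasSum_single (f := fun k => if y ∈ E k then g y / fD R y ^ 2 else 0) k
        (fun j hj => if_neg fun hyj => (hEd hj).le_bot ⟨hyj, hk⟩)
      simpa [hk] using this
    · have h0 : fD R y = 0 := by
        by_contra h
        exact hN ⟨denom_ne_zero_of_mem_fibre hy', h⟩
      simp [h0, hasSum_zero]
  convert hasSum_sum h1 using 2 with k
  by_cases hx : x ∈ fC R '' E k
  · rw [indicator_of_mem hx]
    obtain ⟨y, hy, rfl⟩ := hx
    have hinv : Function.invFunOn (fC R) (E k) (fC R y) = y :=
      (hEi k).leftInvOn_invFunOn hy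
    rw [hinv, Finset.sum_eq_single y]
    · simp [hy]
    · intro z hz hzy
      refine if_neg fun hzk => hzy ?_
      have hz' : z ∈ fibre R (fC R y) := by simpa using hz
      exact hEi k hzk hy (fC_of_mem_fibre hz')
    · intro hn
      exact absurd (by simpa using mem_fibre_fC (hEN k y hy).1) hn
  · rw [indicator_of_notMem hx]
    refine (Finset.sum_eq_zero fun y hy => if_neg fun hyk => hx ⟨y, hyk, ?_⟩).symm
    exact fC_of_mem_fibre (by simpa using hy)

lemma norm_sq_smul_div (c a : ℂ) (h : c ≠ 0) : ‖(‖c‖ ^ 2 : ℝ) • (a / c ^ 2)‖ = ‖a‖ := by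
  have : ‖c‖ ≠ 0 := norm_ne_zero_iff.2 h
  rw [norm_smul, norm_div, norm_pow, norm_pow, norm_norm]
  field_simp

/-- The transfer operator is an `L¹` contraction, and its integral is computed by the change of
variables formula. -/
lemma integrable_T_and_integral_T (hR : R.denom.natDegree < R.num.natDegree) {g : ℂ → ℂ}
    (hg : Integrable g) :
    Integrable (T R g) ∧ ∫⁻ x, ‖T R g x‖ₑ ≤ ∫⁻ x, ‖g x‖ₑ ∧
      ∫ x, T R g x = ∫ y, ((‖fD R y‖ : ℂ) ^ 2 / fD R y ^ 2) * g y := by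
  obtain ⟨E, hEm, hEd, hEi, hEu⟩ := exists_injective_partition hR
  have hEN : ∀ k, ∀ z ∈ E k, z ∈ unramified R := fun k z hz => hEu ▸ mem_iUnion.2 ⟨k, hz⟩
  have hd : ∀ k, ∀ x ∈ E k, HasDerivAt (fC R) (fD R x) x := fun k x hx =>
    hasDerivAt_fC (hEN k x hx).1
  -- on `f(E_k)` the function `t k` is the term of the sum `T g` that comes from the preimage in
  -- `E_k`
  set t : ℕ → ℂ → ℂ := fun k x => g (Function.invFunOn (fC R) (E k) x) /
      fD R (Function.invFunOn (fC R) (E k) x) ^ 2 with ht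
  have htf : ∀ k, ∀ y ∈ E k, t k (fC R y) = g y / fD R y ^ 2 := by
    intro k y hy
    simp only [ht, (hEi k).leftInvOn_invFunOn hy]
  have hsum : ∀ x, HasSum (fun k => (fC R '' E k).indicator (t k) x) (T R g x) :=
    hasSum_T hR hEd hEi hEu g
  have hfm : ∀ k, MeasurableSet (fC R '' E k) := fun k =>
    measurable_image_of_fderivWithin (hEm k)
      (fun x hx => (hd k x hx).complexToReal_fderiv.hasFDerivWithinAt) (hEi k)
  have hNull : volume (unramified R)ᶜ = 0 :=
    (finite_compl_unramified hR).countable.measure_zero _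
  have hui : (⋃ k, E k) =ᵐ[volume] univ := by
    rw [hEu]
    exact eventuallyEq_univ.2 (ae_unramified hR)
  have hgE : ∀ k, IntegrableOn (fun y => (‖fD R y‖ ^ 2) • t k (fC R y)) (E k) := by
    intro k
    refine Integrable.mono (g := g) hg.integrableOn ?_ ?_
    · have : AEStronglyMeasurable (fun y => (‖fD R y‖ ^ 2 : ℝ) • (g y / fD R y ^ 2))
          (volume.restrict (E k)) :=
        ((measurable_fD.norm.pow_const 2).aestronglyMeasurable).smul
          ((hg.integrableOn.aestronglyMeasurable.aemeasurable.div
            (measurable_fD.pow_const 2).aemeasurable).aestronglyMeasurable)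
      refine this.congr ?_
      filter_upwards [ae_restrict_mem (hEm k)] with y hy
      rw [htf k y hy]
    · filter_upwards [ae_restrict_mem (hEm k)] with y hy
      rw [htf k y hy, norm_sq_smul_div _ _ (hEN k y hy).2]
  have htint : ∀ k, IntegrableOn (t k) (fC R '' E k) := fun k =>
    (integrableOn_image_holomorphic (hEm k) (hd k) (hEi k) _).2 (hgE k)
  have hint : ∀ k, Integrable ((fC R '' E k).indicator (t k)) := fun k =>
    (integrable_indicator_iff (hfm k)).2 (htint k)
  -- by the change of variables formula the `L¹` norm of the `k`-th term is that of `g` on `E_k`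
  have hlk : ∀ k, ∫⁻ x, ‖(fC R '' E k).indicator (t k) x‖ₑ = ∫⁻ y in E k, ‖g y‖ₑ := by
    intro k
    simp_rw [enorm_indicator_eq_indicator_enorm]
    rw [lintegral_indicator (hfm k), lintegral_image_holomorphic (hEm k) (hd k) (hEi k)]
    refine setLIntegral_congr_fun (hEm k) fun y hy => ?_
    rw [htf k y hy, ← norm_sq_smul_div (fD R y) (g y) (hEN k y hy).2 |> enorm_eq_iff_norm_eq.2,
      enorm_smul, ← ofReal_norm (‖fD R y‖ ^ 2), Real.norm_of_nonneg (sq_nonneg _)]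
  have hltot : ∑' k, ∫⁻ x, ‖(fC R '' E k).indicator (t k) x‖ₑ = ∫⁻ y, ‖g y‖ₑ := by
    simp_rw [hlk]
    rw [← lintegral_iUnion hEm hEd, Measure.restrict_congr_set hui, Measure.restrict_univ]
  have hle : ∫⁻ x, ‖T R g x‖ₑ ≤ ∫⁻ x, ‖g x‖ₑ := by
    rw [← hltot, ← lintegral_tsum fun k => (hint k).aestronglyMeasurable.enorm]
    refine lintegral_mono fun x => ?_
    dsimp only
    rw [← (hsum x).tsum_eq]
    exact enorm_tsum_le_tsum_enorm
  have hmeas : AEStronglyMeasurable (T R g) := by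
    refine aestronglyMeasurable_of_tendsto_ae atTop
      (f := fun n x => ∑ k ∈ Finset.range n, (fC R '' E k).indicator (t k) x) (fun n => ?_)
      (Eventually.of_forall fun x => (hsum x).tendsto_sum_nat)
    exact Finset.aestronglyMeasurable_fun_sum _ fun k _ => (hint k).aestronglyMeasurable
  refine ⟨⟨hmeas, hle.trans_lt hg.2⟩, hle, ?_⟩
  have hsn : Summable fun k => ∫ x, ‖(fC R '' E k).indicator (t k) x‖ := by
    have : ∀ k, ∫ x, ‖(fC R '' E k).indicator (t k) x‖ =
        (∫⁻ x, ‖(fC R '' E k).indicator (t k) x‖ₑ).toReal := fun k =>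
      integral_norm_eq_lintegral_enorm (hint k).aestronglyMeasurable
    simp_rw [this]
    exact ENNReal.summable_toReal (by rw [hltot]; exact hg.2.ne)
  have h1 := hasSum_integral_of_summable_integral_norm hint hsn
  simp_rw [(hsum _).tsum_eq] at h1
  -- termwise change of variables, now without the absolute values
  have hgi : Integrable fun y => ((‖fD R y‖ : ℂ) ^ 2 / fD R y ^ 2) * g y := by
    refine hg.mono ?_ ?_
    · exact ((((Complex.measurable_ofReal.comp measurable_fD.norm).pow_const 2).div
        (measurable_fD.pow_const 2)).aestronglyMeasurable).mul hg.aestronglyMeasurable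
    · refine Eventually.of_forall fun y => ?_
      rw [norm_mul]
      refine mul_le_of_le_one_left (norm_nonneg _) ?_
      simp only [norm_div, norm_pow, Complex.norm_real, norm_norm]
      exact div_self_le_one _
  have h2 := hasSum_integral_iUnion (μ := volume) hEm hEd hgi.integrableOn
  rw [Measure.restrict_congr_set hui, Measure.restrict_univ] at h2
  refine h1.unique ?_
  convert h2 using 2 with k
  rw [integral_indicator (hfm k), integral_image_holomorphic (hEm k) (hd k) (hEi k)]
  refine setIntegral_congr_fun (hEm k) fun y hy => ?_
  rw [htf k y hy, Complex.real_smul]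
  push_cast
  ring

lemma integrable_T (hR : R.denom.natDegree < R.num.natDegree) {g : ℂ → ℂ} (hg : Integrable g) :
    Integrable (T R g) := (integrable_T_and_integral_T hR hg).1

lemma integrable_iterate_T (hR : R.denom.natDegree < R.num.natDegree) {g : ℂ → ℂ}
    (hg : Integrable g) (n : ℕ) : Integrable ((T R)^[n] g) := by
  induction n with
  | zero => exact hg
  | succ n ih => rw [Function.iterate_succ_apply']; exact integrable_T hR ih

lemma lintegral_iterate_T_le (hR : R.denom.natDegree < R.num.natDegree) {g : ℂ → ℂ}
    (hg : Integrable g) (n : ℕ) : ∫⁻ x, ‖(T R)^[n] g x‖ₑ ≤ ∫⁻ x, ‖g x‖ₑ := by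
  induction n with
  | zero => exact le_rfl
  | succ n ih =>
    rw [Function.iterate_succ_apply']
    exact (integrable_T_and_integral_T hR (integrable_iterate_T hR hg n)).2.1.trans ih

/-- Over a set `A`, the iterated transfer operator only sees the preimage of `A`. -/
lemma setLIntegral_iterate_T_le (hR : R.denom.natDegree < R.num.natDegree) {g : ℂ → ℂ}
    (hg : Integrable g) (n : ℕ) {A : Set ℂ} (hA : NullMeasurableSet A) :
    ∫⁻ x in A, ‖(T R)^[n] g x‖ₑ ≤ ∫⁻ x in (fC R)^[n] ⁻¹' A, ‖g x‖ₑ := by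
  have hA' : NullMeasurableSet ((fC R)^[n] ⁻¹' A) :=
    hA.preimage (quasiMeasurePreserving_iterate hR n)
  have h := lintegral_iterate_T_le hR (hg.indicator₀ hA') n
  have e : ((fC R)^[n] ⁻¹' A).indicator g =
      fun y => (A.indicator (fun _ => (1 : ℂ))) ((fC R)^[n] y) * g y := by
    ext y
    by_cases hy : (fC R)^[n] y ∈ A <;> simp [indicator, hy]
  have e1 : ∀ x, ‖(A.indicator (fun _ => (1 : ℂ))) x * (T R)^[n] g x‖ₑ =
      A.indicator (fun x => ‖(T R)^[n] g x‖ₑ) x := by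
    intro x
    by_cases hx : x ∈ A <;> simp [hx]
  have e2 : ∫⁻ x, ‖((fC R)^[n] ⁻¹' A).indicator g x‖ₑ =
      ∫⁻ x in (fC R)^[n] ⁻¹' A, ‖g x‖ₑ := by
    simp_rw [enorm_indicator_eq_indicator_enorm]
    rw [lintegral_indicator₀ hA']
  rw [e2, e, iterate_T_comp_mul hR] at h
  simp_rw [e1] at h
  rwa [lintegral_indicator₀ hA] at h

/-! ### The pushforward operator on bounded functions -/

lemma norm_push_le (ν : ℂ → ℂ) (x : ℂ) : ‖push R ν x‖ ≤ ‖ν (fC R x)‖ := by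
  rw [push, norm_mul]
  refine mul_le_of_le_one_right (norm_nonneg _) ?_
  simp only [norm_div, norm_pow, Complex.norm_real, norm_norm]
  exact div_self_le_one _

lemma norm_push {x : ℂ} (hx : x ∈ unramified R) (ν : ℂ → ℂ) :
    ‖push R ν x‖ = ‖ν (fC R x)‖ := by
  have : ‖fD R x‖ ≠ 0 := norm_ne_zero_iff.2 hx.2
  rw [push, norm_mul]
  simp only [norm_div, norm_pow, Complex.norm_real, norm_norm]
  field_simp

lemma aemeasurable_push (hR : R.denom.natDegree < R.num.natDegree) {ν : ℂ → ℂ}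
    (hν : AEMeasurable ν volume) : AEMeasurable (push R ν) volume :=
  (hν.comp_quasiMeasurePreserving (quasiMeasurePreserving_fC hR)).mul
    (((Complex.measurable_ofReal.comp measurable_fD.norm).pow_const 2).div
      (measurable_fD.pow_const 2)).aemeasurable

lemma ae_norm_push_le (hR : R.denom.natDegree < R.num.natDegree) {ν : ℂ → ℂ} {C : ℝ}
    (hν : ∀ᵐ x : ℂ, ‖ν x‖ ≤ C) : ∀ᵐ x : ℂ, ‖push R ν x‖ ≤ C := by
  filter_upwards [(quasiMeasurePreserving_fC hR).ae hν] with x hx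
  exact (norm_push_le ν x).trans hx

lemma push_congr_ae (hR : R.denom.natDegree < R.num.natDegree) {ν ν' : ℂ → ℂ}
    (h : ν =ᵐ[volume] ν') : push R ν =ᵐ[volume] push R ν' := by
  filter_upwards [(quasiMeasurePreserving_fC hR).ae h] with x hx
  simp [push, hx]

/-- The pushforward operator is dual to the transfer operator. -/
lemma integral_push_mul (hR : R.denom.natDegree < R.num.natDegree) {ν g : ℂ → ℂ} {C : ℝ}
    (hν : AEMeasurable ν volume) (hb : ∀ᵐ x : ℂ, ‖ν x‖ ≤ C) (hg : Integrable g) :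
    ∫ x, push R ν x * g x = ∫ x, ν x * T R g x := by
  have h1 : Integrable fun y => ν (fC R y) * g y :=
    hg.bdd_mul (hν.comp_quasiMeasurePreserving (quasiMeasurePreserving_fC hR)).aestronglyMeasurable
      ((quasiMeasurePreserving_fC hR).ae hb)
  have h2 := (integrable_T_and_integral_T hR h1).2.2
  simp_rw [T_comp_mul hR] at h2
  rw [h2]
  refine integral_congr_ae (Eventually.of_forall fun y => ?_)
  simp only [push]
  ring

lemma iterate_push_aemeasurable (hR : R.denom.natDegree < R.num.natDegree) {ν : ℂ → ℂ}
    (hν : AEMeasurable ν volume) (n : ℕ) : AEMeasurable ((push R)^[n] ν) volume := by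
  induction n with
  | zero => exact hν
  | succ n ih => rw [Function.iterate_succ_apply']; exact aemeasurable_push hR ih

lemma iterate_push_ae_norm_le (hR : R.denom.natDegree < R.num.natDegree) {ν : ℂ → ℂ} {C : ℝ}
    (hν : ∀ᵐ x : ℂ, ‖ν x‖ ≤ C) (n : ℕ) : ∀ᵐ x : ℂ, ‖(push R)^[n] ν x‖ ≤ C := by
  induction n with
  | zero => exact hν
  | succ n ih => rw [Function.iterate_succ_apply']; exact ae_norm_push_le hR ih

lemma integral_iterate_push_mul (hR : R.denom.natDegree < R.num.natDegree) {ν g : ℂ → ℂ} {C : ℝ}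
    (hν : AEMeasurable ν volume) (hb : ∀ᵐ x : ℂ, ‖ν x‖ ≤ C) (hg : Integrable g) (n : ℕ) :
    ∫ x, (push R)^[n] ν x * g x = ∫ x, ν x * (T R)^[n] g x := by
  induction n generalizing g with
  | zero => rfl
  | succ n ih =>
    rw [Function.iterate_succ_apply', integral_push_mul hR (iterate_push_aemeasurable hR hν n)
      (iterate_push_ae_norm_le hR hb n) hg, ih (integrable_T hR hg), ← Function.iterate_succ_apply]

lemma iterate_push_congr_ae (hR : R.denom.natDegree < R.num.natDegree) {ν ν' : ℂ → ℂ}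
    (h : ν =ᵐ[volume] ν') (n : ℕ) : (push R)^[n] ν =ᵐ[volume] (push R)^[n] ν' := by
  induction n with
  | zero => exact h
  | succ n ih => simp only [Function.iterate_succ_apply']; exact push_congr_ae hR ih

lemma iterate_push_indicator (A : Set ℂ) (ν : ℂ → ℂ) (n : ℕ) :
    (push R)^[n] (A.indicator ν) = ((fC R)^[n] ⁻¹' A).indicator ((push R)^[n] ν) := by
  induction n with
  | zero => rfl
  | succ n ih =>
    rw [Function.iterate_succ_apply', Function.iterate_succ_apply', ih]
    ext x
    by_cases hx : (fC R)^[n] (fC R x) ∈ A <;> simp [push, indicator, hx]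

end

/-! ### Inverse branches -/

section

variable {R : RatFunc ℂ}

/-- The rational function on the complement of its poles. -/
def finiteMap (R : RatFunc ℂ) (z : {z : ℂ // R.denom.eval z ≠ 0}) : ℂ := fC R z

/-- A rational map fixing infinity is a closed map off its poles: the sphere is compact. -/
lemma isClosedMap_finiteMap (hR : R.denom.natDegree < R.num.natDegree) (hinf : toMap R ∞ = ∞) :
    IsClosedMap (finiteMap R) := by
  intro S hS
  obtain ⟨S', hS', rfl⟩ := isClosed_induced_iff.1 hS
  have h1 : IsClosed ((fun z : ℂ => (z : OnePoint ℂ)) '' S' ∪ {∞}) := by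
    rw [← isOpen_compl_iff]
    have : ((fun z : ℂ => (z : OnePoint ℂ)) '' S' ∪ {∞})ᶜ =
        (fun z : ℂ => (z : OnePoint ℂ)) '' S'ᶜ := by
      ext z
      induction z using OnePoint.rec with
      | infty => simp
      | coe z => simp
    rw [this]
    exact OnePoint.isOpenEmbedding_coe.isOpenMap _ hS'.isOpen_compl
  -- the closure at infinity adds no finite value, since `f(∞) = ∞`
  have h2 := ((continuous_toMap hR hinf).isClosedMap _ h1).preimage OnePoint.continuous_coe
  convert h2 using 1
  ext x
  constructor
  · rintro ⟨z, hz, rfl⟩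
    exact ⟨_, Or.inl ⟨z, hz, rfl⟩, toMap_coe_of_ne z.2⟩
  · rintro ⟨w, hw | hw, hwx⟩
    · obtain ⟨y, hy, rfl⟩ := hw
      exact ⟨⟨y, denom_ne_zero_of_mem_fibre hwx⟩, hy, fC_of_mem_fibre hwx⟩
    · rw [mem_singleton_iff.1 hw, hinf] at hwx
      exact absurd hwx.symm (OnePoint.coe_ne_infty x)

lemma isLocalHomeomorphOn_fC : IsLocalHomeomorphOn (fC R) (unramified R) := fun _ hx =>
  ⟨_, ((hasStrictDerivAt_fC hx.1).hasStrictFDerivAt_equiv hx.2).mem_toOpenPartialHomeomorph_source,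
    by simp⟩

lemma isCoveringMapOn_finiteMap (hR : R.denom.natDegree < R.num.natDegree)
    (hinf : toMap R ∞ = ∞) : IsCoveringMapOn (finiteMap R) (critValues R)ᶜ := by
  refine (isClosedMap_finiteMap hR hinf).isCoveringMapOn_of_isLocalHomeomorphOn (fun x _ => ?_) ?_
  · refine Set.Finite.of_finite_image (f := Subtype.val) ((finite_fibre hR x).subset ?_)
      Subtype.val_injective.injOn
    rintro _ ⟨z, hz, rfl⟩
    exact toMap_coe_eq_coe_iff.2 ⟨z.2, hz⟩
  · refine (isLocalHomeomorphOn_fC (R := R)).comp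
      (isOpen_denom_ne.isOpenEmbedding_subtypeVal.isLocalHomeomorph.isLocalHomeomorphOn) ?_
    intro z hz
    exact ⟨z.2, fD_ne_zero_of_notMem (mem_fibre_fC z.2) hz⟩

/-- Lifting of functions on a disc through `f`. -/
lemma existsUnique_lift (hR : R.denom.natDegree < R.num.natDegree) (hinf : toMap R ∞ = ∞)
    {c : ℂ} {ρ : ℝ} {g : ℂ → ℂ} (hg : ContinuousOn g (Metric.ball c ρ))
    (hgv : ∀ x ∈ Metric.ball c ρ, g x ∉ critValues R) {a y : ℂ} (ha : a ∈ Metric.ball c ρ)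
    (hy : y ∈ fibre R (g a)) :
    (∃ u : ℂ → ℂ, ContinuousOn u (Metric.ball c ρ) ∧ u a = y ∧
      ∀ x ∈ Metric.ball c ρ, u x ∈ fibre R (g x)) ∧
    (∀ u u' : ℂ → ℂ, ContinuousOn u (Metric.ball c ρ) → ContinuousOn u' (Metric.ball c ρ) →
      (∀ x ∈ Metric.ball c ρ, u x ∈ fibre R (g x)) →
      (∀ x ∈ Metric.ball c ρ, u' x ∈ fibre R (g x)) → u a = y → u' a = y →
      EqOn u u' (Metric.ball c ρ)) := by
  classical
  have hconv : Convex ℝ (Metric.ball c ρ) := convex_ball c ρ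
  have : ContractibleSpace (Metric.ball c ρ) := hconv.contractibleSpace ⟨a, ha⟩
  have : LocallyPathConnectedSpace (Metric.ball c ρ) :=
    Metric.isOpen_ball.locallyPathConnectedSpace
  let g' : C(Metric.ball c ρ, ℂ) := ⟨fun x => g x, continuousOn_iff_continuous_domRestrict.1 hg⟩
  -- lift through the covering given by `f` over the complement of the critical values
  obtain ⟨F, ⟨hF0, hF⟩, huniq⟩ :=
    (isCoveringMapOn_finiteMap hR hinf).existsUnique_continuousMap_lifts g'
      (a₀ := ⟨a, ha⟩) (e₀ := ⟨y, denom_ne_zero_of_mem_fibre hy⟩) (fC_of_mem_fibre hy)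
      (fun x => hgv x x.2)
  constructor
  · refine ⟨fun x => if hx : x ∈ Metric.ball c ρ then (F ⟨x, hx⟩ : ℂ) else 0, ?_, ?_, ?_⟩
    · rw [continuousOn_iff_continuous_domRestrict]
      refine (continuous_subtype_val.comp F.continuous).congr fun x => ?_
      simp [domRestrict]
    · simp [ha, hF0]
    · intro x hx
      simp only [hx, dif_pos]
      exact toMap_coe_eq_coe_iff.2 ⟨(F ⟨x, hx⟩).2, congrFun hF ⟨x, hx⟩⟩
  -- any continuous section of the fibres is a lift, and lifts with equal base points are equal
  · intro u u' hu hu' huf hu'f hua hu'a x hx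
    have key : ∀ w : ℂ → ℂ, ContinuousOn w (Metric.ball c ρ) →
        (∀ x ∈ Metric.ball c ρ, w x ∈ fibre R (g x)) → w a = y → w x = F ⟨x, hx⟩ := by
      intro w hw hwf hwa
      have := huniq ⟨fun x => ⟨w x, denom_ne_zero_of_mem_fibre (hwf x x.2)⟩,
        Continuous.subtype_mk (continuousOn_iff_continuous_domRestrict.1 hw) _⟩
        ⟨Subtype.ext hwa, by ext x; exact fC_of_mem_fibre (hwf x x.2)⟩
      rw [← this]
      rfl
    rw [key u hu huf hua, key u' hu' hu'f hu'a]

lemma hasDerivAt_lift {g u : ℂ → ℂ} {x : ℂ} (hg : DifferentiableAt ℂ g x) (hu : ContinuousAt u x)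
    (hfib : ∀ᶠ w in 𝓝 x, u w ∈ fibre R (g w)) (hd : fD R (u x) ≠ 0) :
    HasDerivAt u (deriv g x / fD R (u x)) x := by
  have hx := hfib.self_of_nhds
  have hs := hasStrictDerivAt_fC (denom_ne_zero_of_mem_fibre hx)
  have hF := hs.hasStrictFDerivAt_equiv hd
  have h1 := hs.to_localInverse hd
  have h2 : ∀ᶠ w in 𝓝 x, hs.localInverse _ _ _ hd (g w) = u w := by
    have h3 := hu.eventually hF.eventually_left_inverse
    filter_upwards [h3, hfib] with w hw hw'
    have h4 := fC_of_mem_fibre hw'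
    rw [← h4]
    exact hw
  rw [fC_of_mem_fibre hx] at h1
  have h3 := h1.hasDerivAt.comp x hg.hasDerivAt
  have h4 := h3.congr_of_eventuallyEq (f₁ := u) (h2.mono fun w hw => hw.symm)
  rwa [← div_eq_inv_mul] at h4

/-- Over a disc on which `g` avoids the critical values, the fibres of `f` over `g` are the values
of holomorphic functions, which compute the transfer operator. -/
lemma exists_lifts (hR : R.denom.natDegree < R.num.natDegree) (hinf : toMap R ∞ = ∞)
    {c : ℂ} {ρ : ℝ} (hρ : 0 < ρ) {g : ℂ → ℂ} (hg : DifferentiableOn ℂ g (Metric.ball c ρ))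
    (hgv : ∀ x ∈ Metric.ball c ρ, g x ∉ critValues R) :
    ∃ u : (finite_fibre hR (g c)).toFinset → ℂ → ℂ, (∀ k, u k c = k) ∧
      (∀ k, ∀ x ∈ Metric.ball c ρ, HasDerivAt (u k) (deriv g x / fD R (u k x)) x) ∧
      (∀ k, ∀ x ∈ Metric.ball c ρ, u k x ∈ fibre R (g x)) ∧
      (∀ x ∈ Metric.ball c ρ, Function.Injective fun k => u k x) ∧
      ∀ x ∈ Metric.ball c ρ, ∀ φ : ℂ → ℂ, T R φ (g x) = ∑ k, φ (u k x) / fD R (u k x) ^ 2 := by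
  classical
  have hc : c ∈ Metric.ball c ρ := Metric.mem_ball_self hρ
  have hex := fun k : (finite_fibre hR (g c)).toFinset =>
    (existsUnique_lift hR hinf hg.continuousOn hgv hc (y := k)
      ((Set.Finite.mem_toFinset _).1 k.2)).1
  choose u huc hu0 huf using hex
  have hinj : ∀ x ∈ Metric.ball c ρ, Function.Injective fun k => u k x := by
    intro x hx k l hkl
    have := (existsUnique_lift hR hinf hg.continuousOn hgv hx (huf k x hx)).2 (u k) (u l) (huc k)
      (huc l) (huf k) (huf l) rfl hkl.symm hc
    rw [hu0, hu0] at this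
    exact Subtype.ext this
  refine ⟨u, hu0, ?_, huf, hinj, ?_⟩
  · intro k x hx
    have hnhds := Metric.isOpen_ball.mem_nhds hx
    exact hasDerivAt_lift (hg.differentiableAt hnhds) ((huc k).continuousAt hnhds)
      (by filter_upwards [hnhds] with w hw using huf k w hw)
      (fD_ne_zero_of_notMem (huf k x hx) (hgv x hx))
  · intro x hx φ
    rw [T_eq_sum hR]
    -- all fibres over noncritical values have the same number of points, so the lifts exhaust the
    -- fibre over `g x`
    have himg : (Finset.univ.image fun k => u k x) = (finite_fibre hR (g x)).toFinset := by
      refine Finset.eq_of_subset_of_card_le ?_ ?_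
      · intro y hy
        obtain ⟨k, -, rfl⟩ := Finset.mem_image.1 hy
        simpa using huf k x hx
      · rw [Finset.card_image_of_injective _ (hinj x hx),
          ← ncard_eq_toFinset_card _ (finite_fibre hR (g x)), ncard_fibre hR (hgv x hx),
          Finset.card_univ, Fintype.card_coe, ← ncard_eq_toFinset_card _ (finite_fibre hR (g c)),
          ncard_fibre hR (hgv c hc)]
    rw [← himg, Finset.sum_image fun k _ l _ h => hinj x hx h]

/-- The transfer operator preserves holomorphy off the critical values. -/
lemma differentiableAt_T (hR : R.denom.natDegree < R.num.natDegree) (hinf : toMap R ∞ = ∞)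
    {W : Set ℂ} (hW : IsOpen W) (hWv : ∀ x ∈ W, x ∉ critValues R) {φ : ℂ → ℂ}
    (hφ : ∀ x ∈ W, ∀ y ∈ fibre R x, DifferentiableAt ℂ φ y) {x : ℂ} (hx : x ∈ W) :
    DifferentiableAt ℂ (T R φ) x := by
  obtain ⟨ρ, hρ, hsub⟩ := Metric.isOpen_iff.1 hW x hx
  obtain ⟨u, -, hu, huf, -, hT⟩ := exists_lifts hR hinf (c := x) hρ (g := id)
    differentiableOn_id fun w hw => hWv w (hsub hw)
  have hxb := Metric.mem_ball_self (x := x) hρ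
  have h1 : T R φ =ᶠ[𝓝 x] fun w => ∑ k, φ (u k w) / fD R (u k w) ^ 2 := by
    filter_upwards [Metric.ball_mem_nhds x hρ] with w hw using hT w hw φ
  refine DifferentiableAt.congr_of_eventuallyEq ?_ h1
  refine DifferentiableAt.fun_sum fun k _ => ?_
  have huk := (hu k x hxb).differentiableAt
  have hmem : u k x ∈ fibre R x := huf k x hxb
  refine DifferentiableAt.fun_div (DifferentiableAt.comp x (hφ x hx _ hmem) huk) ?_
    (pow_ne_zero 2 (fD_ne_zero_of_notMem hmem (hWv x hx)))
  refine DifferentiableAt.fun_pow ?_ 2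
  exact DifferentiableAt.comp x (differentiableOn_fD.differentiableAt
    (isOpen_denom_ne.mem_nhds (denom_ne_zero_of_mem_fibre hmem))) huk

end

/-! ### Area mean values -/

section

lemma measurableSet_annulus (a b : ℝ) : MeasurableSet {z : ℂ | a < ‖z‖ ∧ ‖z‖ ≤ b} :=
  (measurableSet_lt measurable_const measurable_norm).inter
    (measurableSet_le measurable_norm measurable_const)

/-- Integration over an annulus by averaging over circles. -/
lemma setIntegral_annulus {E : Type*} [NormedAddCommGroup E] [NormedSpace ℝ E]
    {f : ℂ → E} {a b : ℝ} (ha : 0 ≤ a) (hab : a ≤ b)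
    (hf : ContinuousOn f {z | a ≤ ‖z‖ ∧ ‖z‖ ≤ b}) :
    ∫ z in {z : ℂ | a < ‖z‖ ∧ ‖z‖ ≤ b}, f z =
      ∫ ρ in a..b, (2 * Real.pi * ρ) • Real.circleAverage f 0 ρ := by
  have hcm : ∀ p : ℝ × ℝ, Complex.polarCoord.symm p = circleMap 0 p.1 p.2 := by
    intro p
    simp [Complex.polarCoord_symm_apply, circleMap, Complex.exp_mul_I]
  have hsub : Ioc a b ×ˢ Ioo (-Real.pi) Real.pi ⊆ polarCoord.target := by
    rintro ⟨x, y⟩ ⟨hx, hy⟩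
    exact ⟨ha.trans_lt hx.1, hy⟩
  -- polar coordinates, in which the annulus is the rectangle `(a, b] × (-π, π)`
  rw [← integral_indicator (measurableSet_annulus a b), ← Complex.integral_comp_polarCoord_symm,
    setIntegral_eq_of_subset_of_forall_sdiff_eq_zero
      (by simp only [polarCoord_target]; measurability) hsub]
  · have h1 : ∫ p in Ioc a b ×ˢ Ioo (-Real.pi) Real.pi,
        p.1 • ({z : ℂ | a < ‖z‖ ∧ ‖z‖ ≤ b}.indicator f) (Complex.polarCoord.symm p) =
        ∫ p in Ioc a b ×ˢ Ioo (-Real.pi) Real.pi, p.1 • f (circleMap 0 p.1 p.2) := by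
      refine setIntegral_congr_fun (measurableSet_Ioc.prod measurableSet_Ioo) ?_
      rintro ⟨x, y⟩ ⟨hx, hy⟩
      have hx0 : 0 < x := ha.trans_lt hx.1
      dsimp only
      rw [hcm, indicator_of_mem]
      simpa [abs_of_pos hx0] using hx
    rw [h1, Measure.volume_eq_prod, setIntegral_prod, intervalIntegral.integral_of_le hab]
    · refine setIntegral_congr_fun measurableSet_Ioc fun x hx => ?_
      dsimp only
      rw [Real.circleAverage_eq_integral_add (-Real.pi), smul_smul,
        intervalIntegral.integral_comp_add_right (fun θ => f (circleMap 0 x θ)),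
        integral_smul, zero_add, show 2 * Real.pi + -Real.pi = Real.pi by ring,
        intervalIntegral.integral_of_le (by linarith [Real.pi_pos]), integral_Ioc_eq_integral_Ioo]
      congr 1
      field_simp
    · have hK : IsCompact (Icc a b ×ˢ Icc (-Real.pi) Real.pi) := isCompact_Icc.prod isCompact_Icc
      have hc : ContinuousOn (fun p : ℝ × ℝ => p.1 • f (circleMap 0 p.1 p.2))
          (Icc a b ×ˢ Icc (-Real.pi) Real.pi) := by
        refine continuousOn_fst.smul (hf.comp (by fun_prop) ?_)
        rintro ⟨x, y⟩ ⟨hx, hy⟩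
        simpa [abs_of_nonneg (ha.trans hx.1)] using hx
      exact (hc.integrableOn_compact hK).mono_set
        (prod_mono Ioc_subset_Icc_self Ioo_subset_Icc_self)
  · rintro ⟨x, y⟩ ⟨hx, hx'⟩
    have hx0 : 0 < x := hx.1
    dsimp only
    rw [hcm, indicator_of_notMem, smul_zero]
    intro h
    refine hx' ⟨?_, hx.2⟩
    simpa [abs_of_pos hx0] using h

/-- The area form of the mean value inequality. -/
lemma norm_le_integral_ball {h : ℂ → ℂ} {c : ℂ} {ρ : ℝ} (hρ : 0 < ρ)
    (hd : DiffContOnCl ℂ h (Metric.ball c ρ)) :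
    Real.pi * ρ ^ 2 * ‖h c‖ ≤ ∫ x in Metric.closedBall c ρ, ‖h x‖ := by
  have hd0 : DiffContOnCl ℂ (fun z => h (c + z)) (Metric.ball 0 ρ) := by
    refine hd.comp (g := fun z => c + z) (DifferentiableOn.diffContOnCl (by fun_prop)) ?_
    intro z hz
    simpa using hz
  have hcl := closure_ball (0 : ℂ) hρ.ne'
  have hcont : ContinuousOn (fun z => h (c + z)) (Metric.closedBall 0 ρ) := by
    rw [← hcl]
    exact hd0.continuousOn
  have h1 := setIntegral_annulus (f := fun z => h (c + z)) le_rfl hρ.le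
    (hcont.mono fun z hz => by simpa using hz.2)
  have h2 : ∫ r in (0 : ℝ)..ρ, (2 * Real.pi * r) • Real.circleAverage (fun z => h (c + z)) 0 r =
      ∫ r in (0 : ℝ)..ρ, ((2 * Real.pi * r : ℝ) : ℂ) * h c := by
    refine intervalIntegral.integral_congr fun r hr => ?_
    rw [uIcc_of_le hρ.le] at hr
    have h3 := DiffContOnCl.circleAverage (f := fun z => h (c + z)) (c := 0) (R := r)
      (hd0.mono (Metric.ball_subset_ball (by rw [abs_of_nonneg hr.1]; exact hr.2)))
    simp only [h3, add_zero, Complex.real_smul]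
  have h4 : ∫ r in (0 : ℝ)..ρ, ((2 * Real.pi * r : ℝ) : ℂ) * h c =
      ((Real.pi * ρ ^ 2 : ℝ) : ℂ) * h c := by
    rw [intervalIntegral.integral_mul_const, intervalIntegral.integral_ofReal,
      intervalIntegral.integral_const_mul, integral_id]
    congr 2
    ring
  rw [h2, h4] at h1
  have h5 := norm_integral_le_integral_norm (μ := volume.restrict {z : ℂ | 0 < ‖z‖ ∧ ‖z‖ ≤ ρ})
    (fun z => h (c + z))
  rw [h1, norm_mul, Complex.norm_real, Real.norm_of_nonneg (by positivity)] at h5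
  refine h5.trans ?_
  have h6 : ∫ x in Metric.closedBall c ρ, ‖h x‖ = ∫ z in Metric.closedBall 0 ρ, ‖h (c + z)‖ := by
    have := (measurePreserving_add_left (volume : Measure ℂ) c).setIntegral_preimage_emb
      (MeasurableEquiv.addLeft c).measurableEmbedding (fun x => ‖h x‖) (Metric.closedBall c ρ)
    rw [← this]
    congr 2
    ext z
    simp
  rw [h6]
  refine setIntegral_mono_set (hcont.norm.integrableOn_compact (isCompact_closedBall 0 ρ))
    (Eventually.of_forall fun _ => norm_nonneg _) (Eventually.of_forall fun z hz => ?_)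
  exact mem_closedBall_zero_iff.2 hz.2

/-! ### Distortion of injective holomorphic functions -/

/-- If `F(z) = 1 / z + z q(z²)` is injective on the punctured disc then `|q(0)|` is bounded: the
image of the annulus `r < |z| ≤ 9/10` has area at least `π (r⁻² - (10/9)² + |q(0)|² (81/100 - r²))`
and is contained in the disc of radius `max_{|z| = r} |F|`, which is `r⁻¹ + r |q(0)| + o(r)`. -/
lemma norm_le_of_injOn_odd {q : ℂ → ℂ} (hq : DifferentiableOn ℂ q (Metric.ball 0 1))
    (hne : ∀ z ∈ Metric.ball (0 : ℂ) 1, 1 + z * q z ≠ 0)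
    (hinj : InjOn (fun z => z⁻¹ + z * q (z ^ 2)) (Metric.ball 0 1 \ {0})) : ‖q 0‖ ≤ 3 := by
  set B := ‖q 0‖ with hB
  by_contra hcon
  have hB3 : 3 < B := not_le.1 hcon
  set F : ℂ → ℂ := fun z => z⁻¹ + z * q (z ^ 2) with hF
  set φ : ℂ → ℂ := fun z => z * q (z ^ 2) with hφ
  have hsq : MapsTo (fun z : ℂ => z ^ 2) (Metric.ball 0 1) (Metric.ball 0 1) := by
    intro z hz
    simp only [mem_ball_zero_iff, norm_pow] at hz ⊢
    exact pow_lt_one₀ (norm_nonneg _) hz two_ne_zero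
  have hqs : DifferentiableOn ℂ (fun z => q (z ^ 2)) (Metric.ball 0 1) :=
    hq.comp (by fun_prop) hsq
  have hφd : DifferentiableOn ℂ φ (Metric.ball 0 1) := differentiableOn_id.mul hqs
  set D : ℂ → ℂ := deriv φ with hD
  have hDd : DifferentiableOn ℂ D (Metric.ball 0 1) := hφd.deriv Metric.isOpen_ball
  have hD0 : D 0 = q 0 := by
    have h0 : (0 : ℂ) ∈ Metric.ball (0 : ℂ) 1 := by simp
    have h1 : HasDerivAt (fun z => q (z ^ 2)) (deriv (fun z => q (z ^ 2)) 0) 0 :=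
      (hqs.differentiableAt (Metric.isOpen_ball.mem_nhds h0)).hasDerivAt
    have h2 := (hasDerivAt_id (0 : ℂ)).mul h1
    have h3 : deriv φ 0 = _ := h2.deriv
    rw [hD, h3]
    simp
  -- the function `G = 1 / F`
  set G : ℂ → ℂ := fun z => z / (1 + z ^ 2 * q (z ^ 2)) with hG
  have hGF : ∀ z : ℂ, z ≠ 0 → G z = (F z)⁻¹ := by
    intro z hz
    simp only [hG, hF]
    rw [show z⁻¹ + z * q (z ^ 2) = (1 + z ^ 2 * q (z ^ 2)) / z by field_simp, inv_div]
  have hGd : DifferentiableOn ℂ G (Metric.ball 0 1) := by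
    refine differentiableOn_id.div ?_ fun z hz => hne _ (hsq hz)
    exact (differentiableOn_const 1).add ((differentiableOn_id.pow 2).mul hqs)
  have hG0 : G 0 = 0 := by simp [hG]
  have hGne : ∀ z ∈ Metric.ball (0 : ℂ) 1, z ≠ 0 → G z ≠ 0 := fun z hz hz0 =>
    div_ne_zero hz0 (hne _ (hsq hz))
  -- choice of a small radius
  obtain ⟨δ, hδ, hδq⟩ : ∃ δ > 0, ∀ z : ℂ, ‖z‖ < δ → ‖q z‖ ≤ B + 1 / 1000 := by
    have h0 : (0 : ℂ) ∈ Metric.ball (0 : ℂ) 1 := by simp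
    have hc : ContinuousAt (fun z => ‖q z‖) 0 :=
      (hq.differentiableAt (Metric.isOpen_ball.mem_nhds h0)).continuousAt.norm
    have := hc.eventually (gt_mem_nhds (show ‖q 0‖ < B + 1 / 1000 by linarith))
    obtain ⟨δ, hδ, h⟩ := Metric.eventually_nhds_iff.1 this
    exact ⟨δ, hδ, fun z hz => (h (by simpa using hz)).le⟩
  -- the last bound makes `r |q(0)|` and its square negligible
  obtain ⟨r, hr0, hr1, hrδ, hrB⟩ :
      ∃ r : ℝ, 0 < r ∧ r < 1 / 2 ∧ r < δ ∧ r * (100 * (B + 1)) ≤ 1 := by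
    refine ⟨min (min (1 / 4) (δ / 2)) (1 / (100 * (B + 1))), by positivity, ?_, ?_, ?_⟩
    · exact ((min_le_left _ _).trans (min_le_left _ _)).trans_lt (by norm_num)
    · exact ((min_le_left _ _).trans (min_le_right _ _)).trans_lt (by linarith)
    · calc _ ≤ 1 / (100 * (B + 1)) * (100 * (B + 1)) := by
            gcongr; exact min_le_right _ _
        _ = 1 := by field_simp
  set M : ℝ := r⁻¹ + r * (B + 1 / 1000) with hM
  have hM0 : 0 < M := by positivity
  have hFM : ∀ z : ℂ, ‖z‖ = r → ‖F z‖ ≤ M := by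
    intro z hz
    refine (norm_add_le _ _).trans ?_
    rw [norm_inv, norm_mul, hz]
    have h3 : ‖z ^ 2‖ < δ := by
      rw [norm_pow, hz]
      nlinarith
    have := hδq _ h3
    rw [hM]
    gcongr
  -- the disc of radius `1 / M` is covered by `G` on the disc of radius `r`
  have hcover : Metric.ball (0 : ℂ) M⁻¹ ⊆ G '' Metric.ball 0 r := by
    have hrsub : Metric.closedBall (0 : ℂ) r ⊆ Metric.ball 0 1 :=
      Metric.closedBall_subset_ball (by linarith)
    have hopen : IsOpen (G '' Metric.ball 0 r) := by
      rcases (hGd.analyticOnNhd Metric.isOpen_ball).is_constant_or_isOpen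
        (convex_ball (0 : ℂ) 1).isPreconnected with ⟨w, hw⟩ | h
      · exfalso
        have h1 := hw 0 (by simp)
        have h2 := hw (1 / 2) (by simp; norm_num)
        exact hGne (1 / 2) (by simp; norm_num) (by norm_num) (by rw [h2, ← h1, hG0])
      · exact h _ (Metric.ball_subset_ball (by linarith)) Metric.isOpen_ball
    refine (convex_ball (0 : ℂ) M⁻¹).isPreconnected.subset_of_closure_inter_subset hopen
      ⟨0, by simp [hM0], 0, by simp [hr0], hG0⟩ ?_
    rintro w ⟨hw, hwM⟩
    have h1 : closure (G '' Metric.ball 0 r) ⊆ G '' Metric.closedBall 0 r :=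
      closure_minimal (image_mono Metric.ball_subset_closedBall)
        ((isCompact_closedBall (0 : ℂ) r).image_of_continuousOn
          (hGd.continuousOn.mono hrsub)).isClosed
    obtain ⟨z, hz, rfl⟩ := h1 hw
    refine ⟨z, ?_, rfl⟩
    rw [mem_closedBall_zero_iff] at hz
    rw [mem_ball_zero_iff]
    refine lt_of_le_of_ne hz fun hzr => ?_
    have hz0 : z ≠ 0 := by
      rintro rfl
      simp at hzr
      linarith
    rw [mem_ball_zero_iff, hGF z hz0, norm_inv] at hwM
    have hpos : 0 < ‖F z‖ := by
      have h3 := hGne z (hrsub (by simpa using hz)) hz0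
      rw [hGF z hz0] at h3
      exact norm_pos_iff.2 fun h0 => h3 (by rw [h0, inv_zero])
    have := inv_anti₀ hpos (hFM z hzr)
    linarith
  set A : Set ℂ := {z : ℂ | r < ‖z‖ ∧ ‖z‖ ≤ 9 / 10} with hA
  have hAsub : A ⊆ Metric.ball 0 1 \ {0} := by
    rintro z ⟨h1, h2⟩
    refine ⟨by rw [mem_ball_zero_iff]; linarith, ?_⟩
    rintro rfl
    simp at h1
    linarith
  -- a point of `A` with a value of modulus larger than `M` would share it with a point of the disc
  -- of radius `r`, which is disjoint from `A`
  have himg : F '' A ⊆ Metric.closedBall 0 M := by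
    rintro _ ⟨z, hz, rfl⟩
    rw [mem_closedBall_zero_iff]
    by_contra hlt
    have hz' := hAsub hz
    have hlt' : M < ‖F z‖ := not_le.1 hlt
    have h1 : G z ∈ Metric.ball (0 : ℂ) M⁻¹ := by
      rw [mem_ball_zero_iff, hGF z hz'.2, norm_inv]
      exact inv_strictAnti₀ hM0 hlt'
    obtain ⟨z', hz1, hz2⟩ := hcover h1
    rw [mem_ball_zero_iff] at hz1
    have hz'0 : z' ≠ 0 := by
      rintro rfl
      rw [hG0] at hz2
      exact hGne z hz'.1 hz'.2 hz2.symm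
    rw [hGF z hz'.2, hGF z' hz'0, inv_inj] at hz2
    have h3 : z' = z := hinj ⟨by rw [mem_ball_zero_iff]; linarith, hz'0⟩ hz' hz2
    rw [h3] at hz1
    exact absurd hz.1 (not_lt.2 hz1.le)
  have hFd : ∀ z ∈ A, HasDerivAt F (-(z ^ 2)⁻¹ + D z) z := by
    intro z hz
    have hz' := hAsub hz
    exact (hasDerivAt_inv hz'.2).add
      ((hφd.differentiableAt (Metric.isOpen_ball.mem_nhds hz'.1)).hasDerivAt)
  have hmA : MeasurableSet A := measurableSet_annulus _ _
  -- the area of the image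
  have hcontF : ContinuousOn (fun z => ‖-(z ^ 2)⁻¹ + D z‖ ^ 2)
      {z : ℂ | r ≤ ‖z‖ ∧ ‖z‖ ≤ 9 / 10} := by
    have h1 : {z : ℂ | r ≤ ‖z‖ ∧ ‖z‖ ≤ 9 / 10} ⊆ Metric.ball 0 1 := by
      rintro z ⟨-, h⟩
      rw [mem_ball_zero_iff]; linarith
    refine ((ContinuousOn.add (ContinuousOn.neg (ContinuousOn.inv₀ (by fun_prop) ?_))
      (hDd.continuousOn.mono h1)).norm).pow 2
    rintro z ⟨h, -⟩
    refine pow_ne_zero 2 ?_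
    rintro rfl
    simp at h
    linarith
  have hcomp : IsCompact {z : ℂ | r ≤ ‖z‖ ∧ ‖z‖ ≤ 9 / 10} := by
    refine (isCompact_closedBall (0 : ℂ) (9 / 10)).of_isClosed_subset ?_ fun z hz => by
      simpa using hz.2
    exact (isClosed_le continuous_const continuous_norm).inter
      (isClosed_le continuous_norm continuous_const)
  have hAcl : A ⊆ {z : ℂ | r ≤ ‖z‖ ∧ ‖z‖ ≤ 9 / 10} := fun z hz => ⟨hz.1.le, hz.2⟩
  have hintF : IntegrableOn (fun z => ‖-(z ^ 2)⁻¹ + D z‖ ^ 2) A :=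
    (hcontF.integrableOn_compact hcomp).mono_set hAcl
  have harea : ∫ z in A, ‖-(z ^ 2)⁻¹ + D z‖ ^ 2 ≤ Real.pi * M ^ 2 := by
    have h1 := lintegral_image_holomorphic hmA hFd (hinj.mono hAsub) (fun _ => 1)
    simp only [mul_one, setLIntegral_const, one_mul] at h1
    rw [integral_eq_lintegral_of_nonneg_ae (Eventually.of_forall fun _ => sq_nonneg _)
      hintF.aestronglyMeasurable, ← h1]
    have h2 := measure_mono (μ := volume) himg
    rw [Complex.volume_closedBall] at h2
    refine ENNReal.toReal_le_of_le_ofReal (by positivity) (h2.trans (le_of_eq ?_))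
    rw [← ENNReal.ofReal_coe_nnreal, ← ENNReal.ofReal_pow hM0.le,
      ← ENNReal.ofReal_mul (by positivity)]
    simp [mul_comm]
  -- the lower bound
  set f : ℂ → ℝ := fun z => (‖z‖ ^ 4)⁻¹ + B ^ 2 + 2 * ((starRingEnd ℂ) (q 0) * (D z - q 0)).re
    - 2 * (D z * z ^ 2).re * (‖z‖ ^ 4)⁻¹ with hf
  -- `f` bounds `|F'|²` from below and is, on each circle, the real part of a holomorphic function,
  -- so the mean value property gives its circle averages `ρ⁻⁴ + B²`
  have hfle : ∀ z ∈ A, f z ≤ ‖-(z ^ 2)⁻¹ + D z‖ ^ 2 := by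
    intro z hz
    have hz0 : z ≠ 0 := (hAsub hz).2
    have hn0 : ‖z‖ ≠ 0 := norm_ne_zero_iff.2 hz0
    have e1 : (z ^ 2)⁻¹ = (starRingEnd ℂ) (z ^ 2) * (((‖z‖ ^ 4)⁻¹ : ℝ) : ℂ) := by
      have : (starRingEnd ℂ) z * z = ((‖z‖ ^ 2 : ℝ) : ℂ) := by
        rw [mul_comm, Complex.mul_conj, Complex.normSq_eq_norm_sq]
      rw [map_pow]
      refine inv_eq_of_mul_eq_one_left ?_
      calc (starRingEnd ℂ) z ^ 2 * (((‖z‖ ^ 4)⁻¹ : ℝ) : ℂ) * z ^ 2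
          = ((starRingEnd ℂ) z * z) ^ 2 * (((‖z‖ ^ 4)⁻¹ : ℝ) : ℂ) := by ring
        _ = 1 := by
          rw [this]
          norm_cast
          field_simp
    have e2 : ‖-(z ^ 2)⁻¹ + D z‖ ^ 2 = (‖z‖ ^ 4)⁻¹ + ‖D z‖ ^ 2
        - 2 * (D z * z ^ 2).re * (‖z‖ ^ 4)⁻¹ := by
      have h1 := (Complex.normSq_eq_norm_sq (D z + -(z ^ 2)⁻¹)).symm.trans
        (Complex.normSq_add _ _)
      rw [add_comm, h1]
      have h2 : Complex.normSq (-(z ^ 2)⁻¹) = (‖z‖ ^ 4)⁻¹ := by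
        rw [Complex.normSq_neg, Complex.normSq_eq_norm_sq, norm_inv, norm_pow]
        ring
      rw [h2, Complex.normSq_eq_norm_sq, e1, map_neg, map_mul, Complex.conj_conj,
        Complex.conj_ofReal]
      have h3 : D z * -(z ^ 2 * (((‖z‖ ^ 4)⁻¹ : ℝ) : ℂ)) =
          -((((‖z‖ ^ 4)⁻¹ : ℝ) : ℂ) * (D z * z ^ 2)) := by ring
      rw [h3, Complex.neg_re, Complex.re_ofReal_mul]
      ring
    have e3 : B ^ 2 + 2 * ((starRingEnd ℂ) (q 0) * (D z - q 0)).re ≤ ‖D z‖ ^ 2 := by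
      have h1 : ‖D z‖ ^ 2 = Complex.normSq ((D z - q 0) + q 0) := by
        rw [sub_add_cancel, Complex.normSq_eq_norm_sq]
      have h2 : B ^ 2 = Complex.normSq (q 0) := (Complex.normSq_eq_norm_sq _).symm
      rw [h1, h2, Complex.normSq_add, mul_comm ((starRingEnd ℂ) (q 0))]
      linarith [Complex.normSq_nonneg (D z - q 0)]
    rw [e2, hf]
    linarith
  have hcontf : ContinuousOn f {z : ℂ | r ≤ ‖z‖ ∧ ‖z‖ ≤ 9 / 10} := by
    have h1 : {z : ℂ | r ≤ ‖z‖ ∧ ‖z‖ ≤ 9 / 10} ⊆ Metric.ball 0 1 := by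
      rintro z ⟨-, h⟩
      rw [mem_ball_zero_iff]; linarith
    have hDc := hDd.continuousOn.mono h1
    have hinv : ContinuousOn (fun z : ℂ => (‖z‖ ^ 4)⁻¹) {z : ℂ | r ≤ ‖z‖ ∧ ‖z‖ ≤ 9 / 10} := by
      refine ContinuousOn.inv₀ (by fun_prop) ?_
      rintro z ⟨h, -⟩
      have : 0 < ‖z‖ := hr0.trans_le h
      positivity
    refine ((hinv.add continuousOn_const).add (continuousOn_const.mul
      (Complex.continuous_re.comp_continuousOn (continuousOn_const.mul
        (hDc.sub continuousOn_const))))).sub ((continuousOn_const.mul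
      (Complex.continuous_re.comp_continuousOn (hDc.mul (by fun_prop)))).mul hinv)
  have hlow : ∫ z in A, f z = Real.pi * ((r ^ 2)⁻¹ - 100 / 81 + B ^ 2 * (81 / 100 - r ^ 2)) := by
    rw [setIntegral_annulus hr0.le (by linarith) hcontf]
    have h1 : ∀ ρ ∈ uIcc r (9 / 10), (2 * Real.pi * ρ) • Real.circleAverage f 0 ρ =
        (2 * Real.pi * ρ) * ((ρ ^ 4)⁻¹ + B ^ 2) := by
      intro ρ hρ
      rw [uIcc_of_le (by linarith)] at hρ
      have hρ0 : 0 < ρ := hr0.trans_le hρ.1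
      rw [smul_eq_mul]
      congr 1
      set fρ : ℂ → ℂ := fun z => (((ρ ^ 4)⁻¹ + B ^ 2 : ℝ) : ℂ) +
        2 * ((starRingEnd ℂ) (q 0) * (D z - q 0)) - 2 * (D z * z ^ 2) * (((ρ ^ 4)⁻¹ : ℝ) : ℂ)
        with hfρ
      have hfd : DiffContOnCl ℂ fρ (Metric.ball 0 |ρ|) := by
        have hsub : closure (Metric.ball (0 : ℂ) |ρ|) ⊆ Metric.ball 0 1 := by
          refine Metric.closure_ball_subset_closedBall.trans (Metric.closedBall_subset_ball ?_)
          rw [abs_of_pos hρ0]; linarith [hρ.2]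
        refine DifferentiableOn.diffContOnCl ?_
        have hD2 := hDd.mono hsub
        exact ((differentiableOn_const _).add ((differentiableOn_const _).mul
          ((differentiableOn_const _).mul (hD2.sub (differentiableOn_const _))))).sub
          (((differentiableOn_const _).mul (hD2.mul (differentiableOn_id.pow 2))).mul
            (differentiableOn_const _))
      have h2 := DiffContOnCl.circleAverage hfd
      have h3 : Real.circleAverage f 0 ρ = Real.circleAverage (Complex.reCLM ∘ fρ) 0 ρ := by
        refine Real.circleAverage_congr_sphere fun z hz => ?_
        have hz' : ‖z‖ = ρ := by simpa [abs_of_pos hρ0] using hz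
        simp only [hf, hfρ, Function.comp_apply, Complex.reCLM_apply, hz', Complex.sub_re,
          Complex.add_re, Complex.ofReal_re]
        rw [mul_comm (2 * (D z * z ^ 2)) _, Complex.re_ofReal_mul]
        have e4 : ∀ w : ℂ, (2 * w).re = 2 * w.re := fun w => by simp
        rw [e4, e4]
        ring
      have hci : CircleIntegrable fρ 0 ρ := by
        refine ContinuousOn.circleIntegrable' ?_
        refine hfd.continuousOn.mono ?_
        rw [closure_ball _ (abs_pos.2 hρ0.ne').ne']
        exact Metric.sphere_subset_closedBall
      have h4 : fρ 0 = (((ρ ^ 4)⁻¹ + B ^ 2 : ℝ) : ℂ) := by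
        simp only [hfρ, hD0]
        ring
      rw [h3, ContinuousLinearMap.circleAverage_comp_comm _ hci, h2, h4, Complex.reCLM_apply,
        Complex.ofReal_re]
    rw [intervalIntegral.integral_congr h1]
    have h2 : ∀ ρ ∈ uIcc r (9 / 10), HasDerivAt (fun ρ : ℝ => Real.pi * (B ^ 2 * ρ ^ 2 - (ρ ^ 2)⁻¹))
        ((2 * Real.pi * ρ) * ((ρ ^ 4)⁻¹ + B ^ 2)) ρ := by
      intro ρ hρ
      rw [uIcc_of_le (by linarith)] at hρ
      have hρ0 : ρ ≠ 0 := (hr0.trans_le hρ.1).ne'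
      have h3 := (((hasDerivAt_pow 2 ρ).const_mul (B ^ 2)).sub
        ((hasDerivAt_pow 2 ρ).fun_inv (pow_ne_zero 2 hρ0))).const_mul Real.pi
      refine h3.congr_deriv ?_
      simp only [Nat.cast_ofNat, Nat.add_one_sub_one, pow_one]
      field_simp
      ring
    have h4 : IntervalIntegrable (fun ρ : ℝ => (2 * Real.pi * ρ) * ((ρ ^ 4)⁻¹ + B ^ 2)) volume
        r (9 / 10) := by
      refine ContinuousOn.intervalIntegrable ?_
      rw [uIcc_of_le (by linarith)]
      refine ContinuousOn.mul (by fun_prop) (ContinuousOn.add (ContinuousOn.inv₀ (by fun_prop) ?_)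
        continuousOn_const)
      intro ρ hρ
      exact pow_ne_zero 4 (hr0.trans_le hρ.1).ne'
    rw [intervalIntegral.integral_eq_sub_of_hasDerivAt h2 h4]
    ring
  have hfin : ∫ z in A, f z ≤ ∫ z in A, ‖-(z ^ 2)⁻¹ + D z‖ ^ 2 :=
    setIntegral_mono_on ((hcontf.integrableOn_compact hcomp).mono_set hAcl) hintF hmA hfle
  rw [hlow] at hfin
  have h7 := (mul_le_mul_iff_right₀ Real.pi_pos).1 (hfin.trans harea)
  -- comparing areas, the terms `r⁻²` cancel, and `B² 81 / 100 ≤ 100 / 81 + 2 B` up to small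
  -- errors, which is false for `B > 3`
  have h8 : M ^ 2 = (r ^ 2)⁻¹ + 2 * (B + 1 / 1000) + (r * (B + 1 / 1000)) ^ 2 := by
    have hrr : r⁻¹ * r = 1 := inv_mul_cancel₀ hr0.ne'
    rw [hM, ← inv_pow]
    linear_combination 2 * (B + 1 / 1000) * hrr
  rw [h8] at h7
  have h9 : (r * (B + 1 / 1000)) ^ 2 ≤ 1 / 10000 := by
    have : r * (B + 1 / 1000) ≤ 1 / 100 := by nlinarith
    have h0 : 0 ≤ r * (B + 1 / 1000) := by positivity
    nlinarith
  have h10 : B ^ 2 * r ^ 2 ≤ 1 / 10000 := by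
    have : r * B ≤ 1 / 100 := by nlinarith
    have h0 : 0 ≤ r * B := by positivity
    nlinarith
  nlinarith

end

section

lemma differentiableAt_of_sq {s k : ℂ → ℂ} {x : ℂ} (hs : ContinuousAt s x)
    (hk : DifferentiableAt ℂ k x) (h : ∀ᶠ y in 𝓝 x, s y ^ 2 = k y) (h0 : s x ≠ 0) :
    HasDerivAt s (deriv k x / (2 * s x)) x := by
  rw [hasDerivAt_iff_tendsto_slope]
  have h1 := hasDerivAt_iff_tendsto_slope.1 hk.hasDerivAt
  have h2 : Tendsto (fun y => s y + s x) (𝓝[≠] x) (𝓝 (2 * s x)) := by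
    rw [two_mul]
    exact (hs.tendsto.mono_left nhdsWithin_le_nhds).add_const _
  refine (h1.div h2 (mul_ne_zero two_ne_zero h0)).congr' ?_
  have h3 : ∀ᶠ y in 𝓝[≠] x, s y + s x ≠ 0 :=
    h2.eventually_ne (mul_ne_zero two_ne_zero h0)
  filter_upwards [h3, nhdsWithin_le_nhds h, self_mem_nhdsWithin] with y hy hyk hyx
  rw [Pi.div_apply, slope_def_field, slope_def_field, ← hyk, ← h.self_of_nhds, sq_sub_sq]
  field_simp

/-- A weak form of Bieberbach's bound on the second coefficient. -/
lemma norm_deriv_two_le_of_injOn {g : ℂ → ℂ} (hg : DifferentiableOn ℂ g (Metric.ball 0 1))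
    (hinj : InjOn g (Metric.ball 0 1)) (h0 : g 0 = 0) (h1 : deriv g 0 = 1) :
    ‖deriv (deriv g) 0‖ ≤ 12 := by
  have hball : Metric.ball (0 : ℂ) 1 ∈ 𝓝 (0 : ℂ) := Metric.ball_mem_nhds _ one_pos
  have hmem0 : (0 : ℂ) ∈ Metric.ball (0 : ℂ) 1 := mem_of_mem_nhds hball
  -- write `g(z) = z k(z)`
  set k : ℂ → ℂ := dslope g 0 with hk
  have hkd : DifferentiableOn ℂ k (Metric.ball 0 1) := (Complex.differentiableOn_dslope hball).2 hg
  have hk0 : k 0 = 1 := by rw [hk, dslope_same, h1]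
  have hgk : ∀ z, g z = z * k z := by
    intro z
    have := sub_smul_dslope g 0 z
    rw [h0, sub_zero, sub_zero, smul_eq_mul] at this
    exact this.symm
  have hkne : ∀ z ∈ Metric.ball (0 : ℂ) 1, k z ≠ 0 := by
    intro z hz hkz
    by_cases hz0 : z = 0
    · rw [hz0, hk0] at hkz
      exact one_ne_zero hkz
    · refine hz0 (hinj hz hmem0 ?_)
      rw [hgk z, hkz, mul_zero, h0]
  have hkid : DifferentiableOn ℂ (fun z => (k z)⁻¹) (Metric.ball 0 1) := hkd.inv hkne
  have hsc : IsSimplyConnected (Metric.ball (0 : ℂ) 1) := by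
    have : ContractibleSpace (Metric.ball (0 : ℂ) 1) :=
      (convex_ball (0 : ℂ) 1).contractibleSpace ⟨0, hmem0⟩
    exact (inferInstance : SimplyConnectedSpace (Metric.ball (0 : ℂ) 1))
  -- with `t` a square root of `1 / k`, the function `t(z²) / z` is the odd square root transform
  -- of `1 / g`
  obtain ⟨t₀, ht₀c, ht₀⟩ := Complex.exists_continuousOn_pow_eq hsc Metric.isOpen_ball
    hkid.continuousOn (n := 2)
    (by rintro ⟨z, hz, hz0⟩; exact inv_ne_zero (hkne z hz) hz0) two_ne_zero
  -- normalize the sign of the square root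
  set t : ℂ → ℂ := fun z => t₀ 0 * t₀ z with ht
  have ht₀0 : t₀ 0 ^ 2 = 1 := by rw [ht₀, hk0, inv_one]
  have ht0 : t 0 = 1 := by rw [ht]; dsimp only; rw [← sq, ht₀0]
  have ht2 : ∀ z, t z ^ 2 = (k z)⁻¹ := by
    intro z
    rw [ht]
    dsimp only
    rw [mul_pow, ht₀0, one_mul, ht₀]
  have htc : ContinuousOn t (Metric.ball 0 1) := continuousOn_const.mul ht₀c
  have htne : ∀ z ∈ Metric.ball (0 : ℂ) 1, t z ≠ 0 := by
    intro z hz h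
    have := ht2 z
    rw [h, zero_pow two_ne_zero] at this
    exact inv_ne_zero (hkne z hz) this.symm
  have htD : ∀ z ∈ Metric.ball (0 : ℂ) 1,
      HasDerivAt t (deriv (fun z => (k z)⁻¹) z / (2 * t z)) z := fun z hz =>
    differentiableAt_of_sq (htc.continuousAt (Metric.isOpen_ball.mem_nhds hz))
      (hkid.differentiableAt (Metric.isOpen_ball.mem_nhds hz)) (Eventually.of_forall ht2)
      (htne z hz)
  have htd : DifferentiableOn ℂ t (Metric.ball 0 1) := fun z hz =>
    (htD z hz).differentiableAt.differentiableWithinAt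
  set q : ℂ → ℂ := dslope t 0 with hq
  have htq : ∀ z, t z = 1 + z * q z := by
    intro z
    have := sub_smul_dslope t 0 z
    rw [ht0, sub_zero, smul_eq_mul] at this
    rw [hq, this]
    ring
  have hkder : HasDerivAt k (deriv k 0) 0 := (hkd.differentiableAt hball).hasDerivAt
  -- the coefficient `q(0)` is `-k'(0) / 2 = -g''(0) / 4`
  have hq0 : q 0 = -deriv k 0 / 2 := by
    have h2 : deriv (fun z => (k z)⁻¹) 0 = -deriv k 0 := by
      rw [(hkder.fun_inv (by rw [hk0]; exact one_ne_zero)).deriv, hk0]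
      simp
    rw [hq, dslope_same, (htD 0 hmem0).deriv, ht0, h2, mul_one]
  have hmain : ‖q 0‖ ≤ 3 := by
    refine norm_le_of_injOn_odd ((Complex.differentiableOn_dslope hball).2 htd)
      (fun z hz => by rw [← htq]; exact htne z hz) ?_
    have hF : ∀ z : ℂ, z ≠ 0 → z⁻¹ + z * q (z ^ 2) = t (z ^ 2) / z := by
      intro z hz
      rw [htq]
      field_simp
    have hsq : ∀ z ∈ Metric.ball (0 : ℂ) 1, z ^ 2 ∈ Metric.ball (0 : ℂ) 1 := by
      intro z hz
      simp only [mem_ball_zero_iff, norm_pow] at hz ⊢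
      exact pow_lt_one₀ (norm_nonneg _) hz two_ne_zero
    -- the square root transform is injective because it is odd and its square is `1 / g(z²)`
    have hF2 : ∀ z : ℂ, z ∈ Metric.ball (0 : ℂ) 1 → z ≠ 0 →
        (t (z ^ 2) / z) ^ 2 = (g (z ^ 2))⁻¹ := by
      intro z hz hz0
      rw [div_pow, ht2, hgk, mul_inv, div_eq_mul_inv, mul_comm]
    rintro z ⟨hz, hz0⟩ w ⟨hw, hw0⟩ hzw
    have hz0' : z ≠ 0 := hz0
    have hw0' : w ≠ 0 := hw0
    dsimp only at hzw
    rw [hF z hz0', hF w hw0'] at hzw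
    have h3 : g (z ^ 2) = g (w ^ 2) := by
      rw [← inv_inj, ← hF2 z hz hz0', ← hF2 w hw hw0', hzw]
    have h4 := hinj (hsq z hz) (hsq w hw) h3
    rcases sq_eq_sq_iff_eq_or_eq_neg.1 h4 with h5 | h5
    · exact h5
    · exfalso
      rw [h5, neg_sq, div_neg, neg_eq_iff_add_eq_zero, ← add_div, ← two_mul] at hzw
      exact div_ne_zero (mul_ne_zero two_ne_zero (htne _ (hsq w hw))) hw0' hzw
  have hg2 : deriv (deriv g) 0 = 2 * deriv k 0 := by
    have h2 : deriv g =ᶠ[𝓝 0] fun z => k z + z * deriv k z := by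
      filter_upwards [hball] with z hz
      have h3 : HasDerivAt k (deriv k z) z :=
        (hkd.differentiableAt (Metric.isOpen_ball.mem_nhds hz)).hasDerivAt
      have h4 := (hasDerivAt_id z).mul h3
      have h5 : g = fun z => z * k z := funext hgk
      rw [h5]
      have h6 : deriv (fun z => z * k z) z = 1 * k z + z * deriv k z := h4.deriv
      rw [h6, one_mul]
    have h7 : HasDerivAt (deriv k) (deriv (deriv k) 0) 0 :=
      ((hkd.deriv Metric.isOpen_ball).differentiableAt hball).hasDerivAt
    have h8 := hkder.add ((hasDerivAt_id (0 : ℂ)).mul h7)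
    rw [h2.deriv_eq]
    have h9 := h8.deriv
    simp only [id] at h9
    refine Eq.trans ?_ (h9.trans ?_)
    · rfl
    · ring
  rw [hg2]
  rw [hq0, norm_div, norm_neg] at hmain
  rw [norm_mul]
  have e2 : ‖(2 : ℂ)‖ = 2 := by simp
  rw [e2] at hmain ⊢
  linarith

/-- The nonlinearity of an injective holomorphic function on a disc is bounded at the centre. -/
lemma koebe_nonlinearity {g : ℂ → ℂ} {c : ℂ} {ρ : ℝ} (hρ : 0 < ρ)
    (hg : DifferentiableOn ℂ g (Metric.ball c ρ)) (hinj : InjOn g (Metric.ball c ρ))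
    (hd : deriv g c ≠ 0) : ρ * ‖deriv (deriv g) c‖ ≤ 12 * ‖deriv g c‖ := by
  have hρ' : (ρ : ℂ) ≠ 0 := by exact_mod_cast hρ.ne'
  have hmaps : ∀ z ∈ Metric.ball (0 : ℂ) 1, c + ρ * z ∈ Metric.ball c ρ := by
    intro z hz
    rw [mem_ball_zero_iff] at hz
    rw [mem_ball_iff_norm, add_sub_cancel_left, norm_mul, Complex.norm_real,
      Real.norm_of_nonneg hρ.le]
    nlinarith
  -- normalize to the unit disc, value `0` and derivative `1` at the centre
  set G : ℂ → ℂ := fun z => (g (c + ρ * z) - g c) / (ρ * deriv g c) with hG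
  have hlin : ∀ z : ℂ, HasDerivAt (fun z : ℂ => c + ρ * z) ρ z := fun z => by
    simpa using ((hasDerivAt_id z).const_mul (ρ : ℂ)).const_add c
  have hGder : ∀ z ∈ Metric.ball (0 : ℂ) 1, HasDerivAt G (deriv g (c + ρ * z) / deriv g c) z := by
    intro z hz
    have h1 : HasDerivAt g (deriv g (c + ρ * z)) (c + ρ * z) :=
      (hg.differentiableAt (Metric.isOpen_ball.mem_nhds (hmaps z hz))).hasDerivAt
    have h2 := ((h1.comp z (hlin z)).sub_const (g c)).div_const (ρ * deriv g c)
    refine h2.congr_deriv ?_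
    field_simp
  have h0 : (0 : ℂ) ∈ Metric.ball (0 : ℂ) 1 := by simp
  have hmain := norm_deriv_two_le_of_injOn (g := G)
    (fun z hz => (hGder z hz).differentiableAt.differentiableWithinAt) ?_ (by simp [hG]) ?_
  · have h2 : deriv (deriv G) 0 = ρ * deriv (deriv g) c / deriv g c := by
      have h3 : deriv G =ᶠ[𝓝 0] fun z => deriv g (c + ρ * z) / deriv g c := by
        filter_upwards [Metric.isOpen_ball.mem_nhds h0] with z hz using (hGder z hz).deriv
      rw [h3.deriv_eq]
      have h4 : HasDerivAt (deriv g) (deriv (deriv g) c) (c + ρ * 0) := by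
        rw [mul_zero, add_zero]
        exact ((hg.deriv Metric.isOpen_ball).differentiableAt
          (Metric.ball_mem_nhds c hρ)).hasDerivAt
      have h5 := (h4.comp (0 : ℂ) (hlin 0)).div_const (deriv g c)
      have h6 := h5.deriv
      rw [mul_comm (ρ : ℂ)]
      exact h6
    rw [h2, norm_div, norm_mul, Complex.norm_real, Real.norm_of_nonneg hρ.le,
      div_le_iff₀ (norm_pos_iff.2 hd)] at hmain
    exact hmain
  · intro z hz w hw hzw
    simp only [hG] at hzw
    have h3 := hinj (hmaps z hz) (hmaps w hw)
      (sub_left_injective ((div_left_inj' (mul_ne_zero hρ' hd)).1 hzw))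
    exact mul_left_cancel₀ hρ' (add_left_cancel h3)
  · rw [(hGder 0 h0).deriv, mul_zero, add_zero, div_self hd]

/-- A weak form of the Koebe quarter theorem: the distance to an omitted value is bounded below
in terms of the derivative. -/
lemma koebe_omitted {g : ℂ → ℂ} {c a : ℂ} {ρ : ℝ} (hρ : 0 < ρ)
    (hg : DifferentiableOn ℂ g (Metric.ball c ρ)) (hinj : InjOn g (Metric.ball c ρ))
    (hd : deriv g c ≠ 0) (ha : ∀ z ∈ Metric.ball c ρ, g z ≠ a) :
    ρ * ‖deriv g c‖ ≤ 12 * ‖g c - a‖ := by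
  have hc := Metric.mem_ball_self (x := c) hρ
  have hne : ∀ z ∈ Metric.ball c ρ, g z - a ≠ 0 := fun z hz => sub_ne_zero.2 (ha z hz)
  set h : ℂ → ℂ := fun z => (g z - a)⁻¹ with hh
  have hgd : ∀ z ∈ Metric.ball c ρ, HasDerivAt g (deriv g z) z := fun z hz =>
    (hg.differentiableAt (Metric.isOpen_ball.mem_nhds hz)).hasDerivAt
  have hder : ∀ z ∈ Metric.ball c ρ, HasDerivAt h (-deriv g z / (g z - a) ^ 2) z := fun z hz =>
    ((hgd z hz).sub_const a).fun_inv (hne z hz)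
  have hdc : deriv h c ≠ 0 := by
    rw [(hder c hc).deriv]
    exact div_ne_zero (neg_ne_zero.2 hd) (pow_ne_zero 2 (hne c hc))
  -- both `g` and `1 / (g - a)` are univalent, and their nonlinearities at `c` differ by
  -- `2 g' / (g - a)`
  have h1 := koebe_nonlinearity hρ hg hinj hd
  have h2 := koebe_nonlinearity (g := h) hρ
    (fun z hz => (hder z hz).differentiableAt.differentiableWithinAt)
    (fun z hz w hw hzw => hinj hz hw (sub_left_injective (inv_injective hzw))) hdc
  have h3 : deriv (deriv h) c = deriv h c *
      (deriv (deriv g) c / deriv g c - 2 * deriv g c / (g c - a)) := by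
    have h4 : deriv h =ᶠ[𝓝 c] fun z => -deriv g z / (g z - a) ^ 2 := by
      filter_upwards [Metric.ball_mem_nhds c hρ] with z hz using (hder z hz).deriv
    have h5 : HasDerivAt (deriv g) (deriv (deriv g) c) c :=
      ((hg.deriv Metric.isOpen_ball).differentiableAt (Metric.ball_mem_nhds c hρ)).hasDerivAt
    have h6 := h5.fun_neg.fun_div (((hgd c hc).sub_const a).fun_pow 2) (pow_ne_zero 2 (hne c hc))
    rw [h4.deriv_eq, h6.deriv, (hder c hc).deriv]
    have := hne c hc
    field_simp
    push_cast
    ring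
  rw [h3, norm_mul, ← mul_assoc, mul_comm ρ, mul_assoc, mul_comm (12 : ℝ)] at h2
  have h7 := (mul_le_mul_iff_right₀ (norm_pos_iff.2 hdc)).1 h2
  have hdp : 0 < ‖deriv g c‖ := norm_pos_iff.2 hd
  have h8 : ρ * ‖deriv (deriv g) c / deriv g c‖ ≤ 12 := by
    rw [norm_div, ← mul_div_assoc, div_le_iff₀ hdp]
    exact h1
  have h9 : ‖2 * deriv g c / (g c - a)‖ ≤ ‖deriv (deriv g) c / deriv g c‖ +
      ‖deriv (deriv g) c / deriv g c - 2 * deriv g c / (g c - a)‖ := by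
    have := norm_sub_le (deriv (deriv g) c / deriv g c)
      (deriv (deriv g) c / deriv g c - 2 * deriv g c / (g c - a))
    rwa [sub_sub_cancel] at this
  have h10 : ρ * ‖2 * deriv g c / (g c - a)‖ ≤ 24 := by
    nlinarith [mul_le_mul_of_nonneg_left h9 hρ.le]
  rw [norm_div, norm_mul, ← mul_div_assoc, div_le_iff₀ (norm_pos_iff.2 (hne c hc))] at h10
  have e2 : ‖(2 : ℂ)‖ = 2 := by simp
  rw [e2] at h10
  linarith

end

/-! ### The kernels `ψ_z` -/

section

lemma measurable_ψ (z : ℂ) : Measurable (ψ z) := by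
  unfold ψ
  fun_prop

lemma ψ_zero (x : ℂ) : ψ 0 x = 0 := by simp [ψ]

lemma ψ_one (x : ℂ) : ψ 1 x = 0 := by simp [ψ]

lemma hasDerivAt_ψ (v : ℂ) {x : ℂ} (h0 : x ≠ 0) (h1 : x ≠ 1) (hv : x ≠ v) :
    HasDerivAt (ψ v) (-ψ v x * (1 / x + 1 / (x - 1) + 1 / (x - v))) x := by
  have e1 := sub_ne_zero.2 h1
  have ev := sub_ne_zero.2 hv
  have h := (((hasDerivAt_id x).mul ((hasDerivAt_id x).sub_const 1)).mul
    ((hasDerivAt_id x).sub_const v)).fun_inv (mul_ne_zero (mul_ne_zero h0 e1) ev) |>.const_mul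
    (v * (v - 1))
  refine (h.congr_deriv ?_)
  simp only [ψ, id, Pi.mul_apply]
  field_simp

lemma ψ_eq_partial_fractions (z : ℂ) {x : ℂ} (h0 : x ≠ 0) (h1 : x ≠ 1) (hz : x ≠ z) :
    ψ z x = 1 / (x - z) + (z - 1) / x - z / (x - 1) := by
  have e1 := sub_ne_zero.2 h1
  have ez := sub_ne_zero.2 hz
  simp only [ψ]
  field_simp
  ring

/-- The kernel `|x|^{-s}`, cut off to the disc `|x| < ρ`. -/
def truncPow (s ρ : ℝ) (x : ℂ) : ℝ := (Iio ρ).indicator (fun t => t ^ (-s)) ‖x‖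

lemma truncPow_nonneg (s ρ : ℝ) (x : ℂ) : 0 ≤ truncPow s ρ x := by
  unfold truncPow
  by_cases h : ‖x‖ < ρ
  · rw [indicator_of_mem (show ‖x‖ ∈ Iio ρ from h)]
    exact Real.rpow_nonneg (norm_nonneg _) _
  · rw [indicator_of_notMem (show ‖x‖ ∉ Iio ρ from h)]

/-- The kernels `|x|^{-s}` with `s < 2` are locally integrable in the plane. -/
lemma integrable_truncPow {s ρ : ℝ} (hs : s < 2) (hρ : 0 < ρ) :
    Integrable (truncPow s ρ) ∧ ∫ x, truncPow s ρ x = 2 * Real.pi * (ρ ^ (2 - s) / (2 - s)) := by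
  have hcongr : EqOn (fun y : ℝ => y ^ (Module.finrank ℝ ℂ - 1) • (Iio ρ).indicator
      (fun t => t ^ (-s)) y) ((Ioo 0 ρ).indicator fun y => y ^ (1 - s)) (Ioi 0) := by
    intro y hy
    have hy0 : (0 : ℝ) < y := hy
    simp only [Complex.finrank_real_complex, Nat.add_one_sub_one, pow_one, smul_eq_mul]
    by_cases h : y < ρ
    · rw [indicator_of_mem (show y ∈ Iio ρ from h),
        indicator_of_mem (show y ∈ Ioo 0 ρ from ⟨hy, h⟩), sub_eq_add_neg, Real.rpow_add hy0,
        Real.rpow_one]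
    · rw [indicator_of_notMem (show y ∉ Iio ρ from h),
        indicator_of_notMem (show y ∉ Ioo 0 ρ from fun h' => h h'.2), mul_zero]
  have hii : IntegrableOn (fun y : ℝ => y ^ (1 - s)) (Ioo 0 ρ) :=
    (intervalIntegral.integrableOn_Ioo_rpow_iff hρ).2 (by linarith)
  constructor
  · refine (integrable_fun_norm_addHaar volume (f := (Iio ρ).indicator fun t => t ^ (-s))).2 ?_
    rw [integrableOn_congr_fun hcongr measurableSet_Ioi]
    exact ((integrable_indicator_iff measurableSet_Ioo).2 hii).integrableOn
  · have := integral_fun_norm_addHaar (volume : Measure ℂ) ((Iio ρ).indicator fun t => t ^ (-s))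
    simp only [truncPow]
    rw [this, setIntegral_congr_fun measurableSet_Ioi hcongr,
      setIntegral_indicator measurableSet_Ioo, inter_eq_right.2 Ioo_subset_Ioi_self,
      ← integral_Ioc_eq_integral_Ioo, ← intervalIntegral.integral_of_le hρ.le,
      integral_rpow (Or.inl (by linarith)), Real.zero_rpow (by linarith), measureReal_def,
      Complex.volume_ball]
    simp only [Complex.finrank_real_complex]
    norm_num
    rw [show 1 - s + 1 = 2 - s by ring]
    ring

lemma truncPow_of_lt {s ρ : ℝ} {x : ℂ} (h : ‖x‖ < ρ) : truncPow s ρ x = ‖x‖ ^ (-s) :=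
  indicator_of_mem (show ‖x‖ ∈ Iio ρ from h) _

/-- A Hölder bound for the difference of two kernels, in terms of kernels with integrable
singularities. -/
lemma norm_ψ_sub_le {L : ℝ} (hL : 1 ≤ L) {z w x : ℂ} (hz : ‖z‖ ≤ L) (hw : ‖w‖ ≤ L)
    (h0 : x ≠ 0) (h1 : x ≠ 1) (hxz : x ≠ z) (hxw : x ≠ w) :
    ‖ψ z x - ψ w x‖ ≤ 256 * L * ‖z - w‖ * (1 + ‖x‖) ^ (-3 : ℝ) +
      ‖z - w‖ * (truncPow 1 (5 * L) x + truncPow 1 (5 * L) (x - 1)) +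
      2 * √‖z - w‖ * (truncPow (3 / 2) (5 * L) (x - z) + truncPow (3 / 2) (5 * L) (x - w)) := by
  have e1 := sub_ne_zero.2 h1
  have ez := sub_ne_zero.2 hxz
  have ew := sub_ne_zero.2 hxw
  have hid : ψ z x - ψ w x = (z - w) * (1 / ((x - z) * (x - w)) + 1 / x - 1 / (x - 1)) := by
    rw [ψ_eq_partial_fractions z h0 h1 hxz, ψ_eq_partial_fractions w h0 h1 hxw]
    field_simp
    ring
  have p0 : 0 < ‖x‖ := norm_pos_iff.2 h0
  have p1 : 0 < ‖x - 1‖ := norm_pos_iff.2 e1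
  have pz : 0 < ‖x - z‖ := norm_pos_iff.2 ez
  have pw : 0 < ‖x - w‖ := norm_pos_iff.2 ew
  have n1 := truncPow_nonneg 1 (5 * L) x
  have n2 := truncPow_nonneg 1 (5 * L) (x - 1)
  have n3 := truncPow_nonneg (3 / 2) (5 * L) (x - z)
  have n4 := truncPow_nonneg (3 / 2) (5 * L) (x - w)
  have hn : 0 ≤ ‖z - w‖ := norm_nonneg _
  have n5 : 0 ≤ (1 + ‖x‖) ^ (-3 : ℝ) := Real.rpow_nonneg (by positivity) _
  rcases lt_or_ge ‖x‖ (2 * L + 2) with hx | hx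
  · have t1 : ‖(1 : ℂ)‖ = 1 := norm_one
    have b1 : ‖x - 1‖ < 5 * L := (norm_sub_le x 1).trans_lt (by rw [t1]; linarith)
    have bz : ‖x - z‖ < 5 * L := (norm_sub_le x z).trans_lt (by linarith)
    have bw : ‖x - w‖ < 5 * L := (norm_sub_le x w).trans_lt (by linarith)
    rw [truncPow_of_lt (show ‖x‖ < 5 * L by linarith), truncPow_of_lt b1, truncPow_of_lt bz,
      truncPow_of_lt bw, Real.rpow_neg_one, Real.rpow_neg_one]
    -- the Hölder estimate for the product of two poles
    have key : ‖(z - w) / ((x - z) * (x - w))‖ ≤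
        2 * √‖z - w‖ * (‖x - z‖ ^ (-(3 / 2) : ℝ) + ‖x - w‖ ^ (-(3 / 2) : ℝ)) := by
      have hpow : ∀ t : ℝ, 0 < t → t ^ (-(3 / 2) : ℝ) = (√t)⁻¹ ^ 3 := by
        intro t ht
        rw [Real.rpow_neg ht.le, inv_pow, Real.sqrt_eq_rpow, ← Real.rpow_natCast,
          ← Real.rpow_mul ht.le]
        norm_num
      rw [hpow _ pz, hpow _ pw, norm_div, norm_mul]
      set a := √‖x - z‖
      set b := √‖x - w‖
      set e := √‖z - w‖
      have ha : 0 < a := Real.sqrt_pos.2 pz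
      have hb : 0 < b := Real.sqrt_pos.2 pw
      have he : 0 ≤ e := Real.sqrt_nonneg _
      have haa : ‖x - z‖ = a ^ 2 := (Real.sq_sqrt pz.le).symm
      have hbb : ‖x - w‖ = b ^ 2 := (Real.sq_sqrt pw.le).symm
      have hee : ‖z - w‖ = e ^ 2 := (Real.sq_sqrt hn).symm
      have hle : e ≤ a + b := by
        refine Real.sqrt_le_iff.2 ⟨by positivity, ?_⟩
        have : ‖z - w‖ ≤ ‖x - z‖ + ‖x - w‖ := by
          have h := norm_sub_le (x - w) (x - z)
          rw [sub_sub_sub_cancel_left] at h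
          linarith
        rw [haa, hbb] at this
        nlinarith
      rw [haa, hbb, hee]
      set s := a⁻¹
      set t := b⁻¹
      have hs : 0 < s := inv_pos.2 ha
      have ht : 0 < t := inv_pos.2 hb
      have has : a * s = 1 := mul_inv_cancel₀ ha.ne'
      have hbt : b * t = 1 := mul_inv_cancel₀ hb.ne'
      have e2 : e ^ 2 / (a ^ 2 * b ^ 2) = e * (e * (s ^ 2 * t ^ 2)) := by
        simp only [s, t]
        field_simp
      have e3 : (a + b) * (s ^ 2 * t ^ 2) = s * t ^ 2 + s ^ 2 * t := by
        linear_combination (s * t ^ 2) * has + (s ^ 2 * t) * hbt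
      have e4 : s * t ^ 2 + s ^ 2 * t ≤ 2 * (s ^ 3 + t ^ 3) := by
        have h5 : 0 ≤ (s + t) * (s - t) ^ 2 := by positivity
        have h6 : 0 ≤ s ^ 3 := by positivity
        have h7 : 0 ≤ t ^ 3 := by positivity
        nlinarith
      rw [e2]
      have e5 : e * (s ^ 2 * t ^ 2) ≤ (a + b) * (s ^ 2 * t ^ 2) := by gcongr
      calc e * (e * (s ^ 2 * t ^ 2)) ≤ e * (2 * (s ^ 3 + t ^ 3)) :=
            mul_le_mul_of_nonneg_left (by linarith) he
        _ = _ := by ring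
    have h5 : ‖ψ z x - ψ w x‖ ≤ ‖(z - w) / ((x - z) * (x - w))‖ +
        ‖z - w‖ * (‖x‖⁻¹ + ‖x - 1‖⁻¹) := by
      rw [hid, mul_sub, mul_add, mul_one_div]
      refine (norm_sub_le _ _).trans ?_
      refine (add_le_add_left (norm_add_le _ _) _).trans (le_of_eq ?_)
      rw [norm_mul, norm_mul, norm_div, norm_div, norm_one, one_div, one_div, norm_inv,
        mul_add, add_assoc]
    have n6 : 0 ≤ 256 * L * ‖z - w‖ * (1 + ‖x‖) ^ (-3 : ℝ) := by positivity
    linarith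
  · have hx1 : 1 ≤ ‖x‖ := by linarith
    have q1 : ‖x‖ / 2 ≤ ‖x - 1‖ := by
      have := norm_sub_norm_le x 1
      rw [norm_one] at this
      linarith
    have qz : ‖x‖ / 2 ≤ ‖x - z‖ := by
      have := norm_sub_norm_le x z
      linarith
    have qw : ‖x‖ / 2 ≤ ‖x - w‖ := by
      have := norm_sub_norm_le x w
      linarith
    have h5 : ψ z x - ψ w x = (z - w) * ((x * (z + w - 1) - z * w) /
        (x * (x - 1) * (x - z) * (x - w))) := by
      rw [hid]
      field_simp
      ring
    have h6 : ‖x * (z + w - 1) - z * w‖ ≤ 4 * L * ‖x‖ := by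
      have a1 : ‖z + w - 1‖ ≤ 2 * L + 1 := by
        refine (norm_sub_le _ _).trans ?_
        rw [norm_one]
        linarith [norm_add_le z w]
      refine (norm_sub_le _ _).trans ?_
      rw [norm_mul, norm_mul]
      have a2 : ‖z‖ * ‖w‖ ≤ L * L := by gcongr
      nlinarith
    have h7 : ‖ψ z x - ψ w x‖ ≤ ‖z - w‖ * (32 * L / ‖x‖ ^ 3) := by
      rw [h5, norm_mul, norm_div, norm_mul, norm_mul, norm_mul]
      refine mul_le_mul_of_nonneg_left ?_ hn
      rw [div_le_div_iff₀ (by positivity) (by positivity)]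
      have h8 : ‖x‖ * (‖x‖ / 2) * (‖x‖ / 2) * (‖x‖ / 2) ≤
          ‖x‖ * ‖x - 1‖ * ‖x - z‖ * ‖x - w‖ := by gcongr
      calc ‖x * (z + w - 1) - z * w‖ * ‖x‖ ^ 3 ≤ (4 * L * ‖x‖) * ‖x‖ ^ 3 := by gcongr
        _ = 32 * L * (‖x‖ * (‖x‖ / 2) * (‖x‖ / 2) * (‖x‖ / 2)) := by ring
        _ ≤ _ := by gcongr
    have h8 : 32 * L / ‖x‖ ^ 3 ≤ 256 * L * (1 + ‖x‖) ^ (-3 : ℝ) := by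
      rw [Real.rpow_neg (by positivity), ← div_eq_mul_inv, show (3 : ℝ) = ((3 : ℕ) : ℝ) by norm_num,
        Real.rpow_natCast, div_le_div_iff₀ (by positivity) (by positivity)]
      have h9 : (1 + ‖x‖) ^ 3 ≤ (2 * ‖x‖) ^ 3 := by gcongr; linarith
      calc 32 * L * (1 + ‖x‖) ^ 3 ≤ 32 * L * (2 * ‖x‖) ^ 3 := by gcongr
        _ = 256 * L * ‖x‖ ^ 3 := by ring
    have h10 : ‖z - w‖ * (32 * L / ‖x‖ ^ 3) ≤
        256 * L * ‖z - w‖ * (1 + ‖x‖) ^ (-3 : ℝ) := by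
      calc ‖z - w‖ * (32 * L / ‖x‖ ^ 3) ≤ ‖z - w‖ * (256 * L * (1 + ‖x‖) ^ (-3 : ℝ)) := by gcongr
        _ = _ := by ring
    have n6 : 0 ≤ ‖z - w‖ * (truncPow 1 (5 * L) x + truncPow 1 (5 * L) (x - 1)) := by positivity
    have n7 : 0 ≤ 2 * √‖z - w‖ * (truncPow (3 / 2) (5 * L) (x - z) +
      truncPow (3 / 2) (5 * L) (x - w)) := by positivity
    linarith

lemma ae_ne (a : ℂ) : ∀ᵐ x : ℂ, x ≠ a :=
  compl_mem_ae_iff.2 (measure_singleton a)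

/-- The map `z ↦ ψ_z` is locally Hölder of exponent `1/2` into `L¹`. -/
lemma exists_integral_ψ_sub_le : ∃ C : ℝ, 0 ≤ C ∧ ∀ L : ℝ, 1 ≤ L → ∀ z w : ℂ, ‖z‖ ≤ L → ‖w‖ ≤ L →
    Integrable (fun x => ψ z x - ψ w x) ∧
    ∫ x, ‖ψ z x - ψ w x‖ ≤ C * (L * ‖z - w‖ + √(L * ‖z - w‖)) := by
  have hI : Integrable fun x : ℂ => (1 + ‖x‖) ^ (-3 : ℝ) :=
    integrable_one_add_norm (by rw [Complex.finrank_real_complex]; norm_num)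
  set I₀ := ∫ x : ℂ, (1 + ‖x‖) ^ (-3 : ℝ) with hI₀
  have hI₀0 : 0 ≤ I₀ := integral_nonneg fun x => Real.rpow_nonneg (by positivity) _
  refine ⟨256 * I₀ + 1000 * Real.pi, by positivity, fun L hL z w hz hw => ?_⟩
  have h5 : 0 < 5 * L := by linarith
  obtain ⟨i1, v1⟩ := integrable_truncPow (s := 1) (by norm_num) h5
  obtain ⟨i2, v2⟩ := integrable_truncPow (s := 3 / 2) (by norm_num) h5
  have j1 := i1.comp_sub_right 1
  have jz := i2.comp_sub_right z
  have jw := i2.comp_sub_right w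
  have s1 : Integrable fun x : ℂ => 256 * L * ‖z - w‖ * (1 + ‖x‖) ^ (-3 : ℝ) := hI.const_mul _
  have s2' : Integrable fun x : ℂ => truncPow 1 (5 * L) x + truncPow 1 (5 * L) (x - 1) := i1.add j1
  have s3' : Integrable fun x : ℂ =>
      truncPow (3 / 2) (5 * L) (x - z) + truncPow (3 / 2) (5 * L) (x - w) := jz.add jw
  have s2 := s2'.const_mul ‖z - w‖
  have s3 := s3'.const_mul (2 * √‖z - w‖)
  have s12 : Integrable fun x : ℂ => 256 * L * ‖z - w‖ * (1 + ‖x‖) ^ (-3 : ℝ) +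
      ‖z - w‖ * (truncPow 1 (5 * L) x + truncPow 1 (5 * L) (x - 1)) := s1.add s2
  have hsum := s12.add s3
  have hae : ∀ᵐ x : ℂ, ‖ψ z x - ψ w x‖ ≤ 256 * L * ‖z - w‖ * (1 + ‖x‖) ^ (-3 : ℝ) +
      ‖z - w‖ * (truncPow 1 (5 * L) x + truncPow 1 (5 * L) (x - 1)) +
      2 * √‖z - w‖ * (truncPow (3 / 2) (5 * L) (x - z) + truncPow (3 / 2) (5 * L) (x - w)) := by
    filter_upwards [ae_ne 0, ae_ne 1, ae_ne z, ae_ne w] with x h0 h1 hxz hxw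
    exact norm_ψ_sub_le hL hz hw h0 h1 hxz hxw
  have hint : Integrable (fun x => ψ z x - ψ w x) :=
    hsum.mono' ((measurable_ψ z).sub (measurable_ψ w)).aestronglyMeasurable hae
  refine ⟨hint, (integral_mono_ae hint.norm hsum hae).trans ?_⟩
  have hval : ∫ x, (256 * L * ‖z - w‖ * (1 + ‖x‖) ^ (-3 : ℝ) +
      ‖z - w‖ * (truncPow 1 (5 * L) x + truncPow 1 (5 * L) (x - 1)) +
      2 * √‖z - w‖ * (truncPow (3 / 2) (5 * L) (x - z) + truncPow (3 / 2) (5 * L) (x - w))) =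
      256 * L * ‖z - w‖ * I₀ + ‖z - w‖ * (2 * (2 * Real.pi * ((5 * L) ^ (2 - 1 : ℝ) / (2 - 1)))) +
      2 * √‖z - w‖ * (2 * (2 * Real.pi * ((5 * L) ^ (2 - 3 / 2 : ℝ) / (2 - 3 / 2)))) := by
    rw [integral_add s12 s3, integral_add s1 s2, integral_const_mul,
      integral_const_mul, integral_const_mul, integral_add i1 j1, integral_add jz jw,
      integral_sub_right_eq_self (truncPow 1 (5 * L)),
      integral_sub_right_eq_self (truncPow (3 / 2) (5 * L)),
      integral_sub_right_eq_self (truncPow (3 / 2) (5 * L)), v1, v2]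
    ring
  refine (le_of_eq hval).trans ?_
  have e1 : (5 * L) ^ (2 - 1 : ℝ) = 5 * L := by norm_num
  have e2 : (5 * L) ^ (2 - 3 / 2 : ℝ) = √5 * √L := by
    rw [show (2 - 3 / 2 : ℝ) = 1 / 2 by norm_num, ← Real.sqrt_eq_rpow, Real.sqrt_mul (by norm_num)]
  have e3 : √5 ≤ 3 := Real.sqrt_le_iff.2 ⟨by norm_num, by norm_num⟩
  rw [e1, e2, Real.sqrt_mul (by linarith)]
  have p : 0 < Real.pi := Real.pi_pos
  set d := ‖z - w‖
  have hd : 0 ≤ d := norm_nonneg _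
  have hsd : 0 ≤ √d := Real.sqrt_nonneg _
  have hsL : 0 ≤ √L := Real.sqrt_nonneg _
  have m1 : 0 ≤ L * d := by positivity
  have m2 : 0 ≤ √L * √d := by positivity
  have m3 : 0 ≤ Real.pi * (L * d) := by positivity
  have m4 : 0 ≤ Real.pi * (√L * √d) := by positivity
  have m5 : 0 ≤ I₀ * (√L * √d) := by positivity
  have m6 : √5 * (Real.pi * (√L * √d)) ≤ 3 * (Real.pi * (√L * √d)) := by gcongr
  have t1 : d * (2 * (2 * Real.pi * (5 * L / (2 - 1)))) = 20 * (Real.pi * (L * d)) := by ring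
  have t2 : 2 * √d * (2 * (2 * Real.pi * (√5 * √L / (2 - 3 / 2)))) =
      16 * (√5 * (Real.pi * (√L * √d))) := by ring
  rw [t1, t2]
  nlinarith

lemma integrable_ψ (z : ℂ) : Integrable (ψ z) := by
  obtain ⟨C, -, hC⟩ := exists_integral_ψ_sub_le
  have := (hC (1 + ‖z‖) (by linarith [norm_nonneg z]) z 0 (by linarith) (by simp; positivity)).1
  simpa [ψ_zero] using this

/-- The `L¹` norm of `ψ_z` is bounded by the spherical metric. -/
lemma exists_integral_norm_ψ_le : ∃ C : ℝ, 0 ≤ C ∧ ∀ z : ℂ, ∫ x, ‖ψ z x‖ ≤ C * (1 + ‖z‖ ^ 2) := by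
  obtain ⟨C, hC0, hC⟩ := exists_integral_ψ_sub_le
  refine ⟨4 * C, by positivity, fun z => ?_⟩
  have := (hC (1 + ‖z‖) (by linarith [norm_nonneg z]) z 0 (by linarith) (by simp; positivity)).2
  simp only [ψ_zero, sub_zero] at this
  refine this.trans ?_
  have h1 : √((1 + ‖z‖) * ‖z‖) ≤ 1 + ‖z‖ := by
    refine Real.sqrt_le_iff.2 ⟨by positivity, ?_⟩
    nlinarith [norm_nonneg z]
  have h2 : (1 + ‖z‖) * ‖z‖ + √((1 + ‖z‖) * ‖z‖) ≤ 4 * (1 + ‖z‖ ^ 2) := by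
    nlinarith [norm_nonneg z, sq_nonneg (‖z‖ - 1)]
  calc _ ≤ C * (4 * (1 + ‖z‖ ^ 2)) := by gcongr
    _ = _ := by ring

/-- The map `z ↦ ψ_z` is continuous into `L¹`; hence so are its integrals against bounded
functions. -/
lemma continuous_integral_mul_ψ {μ : ℂ → ℂ} {B : ℝ} (hμ : AEStronglyMeasurable μ volume)
    (hb : ∀ᵐ x : ℂ, ‖μ x‖ ≤ B) : Continuous fun z => ∫ x, μ x * ψ z x := by
  obtain ⟨C, hC0, hC⟩ := exists_integral_ψ_sub_le
  rw [continuous_iff_continuousAt]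
  intro w
  have hB : 0 ≤ B := by
    obtain ⟨x, hx⟩ := hb.exists
    exact (norm_nonneg _).trans hx
  have hmul : ∀ z, Integrable fun x => μ x * ψ z x := fun z => (integrable_ψ z).bdd_mul hμ hb
  set L := 2 + ‖w‖
  have hlim : Tendsto (fun z => B * (C * (L * ‖z - w‖ + √(L * ‖z - w‖)))) (𝓝 w) (𝓝 0) := by
    have : Continuous fun z => B * (C * (L * ‖z - w‖ + √(L * ‖z - w‖))) := by fun_prop
    have h := this.tendsto w
    simpa using h
  rw [ContinuousAt, tendsto_iff_norm_sub_tendsto_zero]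
  refine squeeze_zero' (Eventually.of_forall fun _ => norm_nonneg _) ?_ hlim
  filter_upwards [Metric.ball_mem_nhds w one_pos] with z hz
  have hzL : ‖z‖ ≤ L := by
    have := norm_sub_norm_le z w
    rw [mem_ball_iff_norm] at hz
    simp only [L]
    linarith
  obtain ⟨hi, hle⟩ := hC L (by simp only [L]; linarith [norm_nonneg w]) z w hzL
    (by simp only [L]; linarith)
  rw [← integral_sub (hmul z) (hmul w)]
  refine (norm_integral_le_integral_norm _).trans ?_
  calc ∫ x, ‖μ x * ψ z x - μ x * ψ w x‖ ≤ ∫ x, B * ‖ψ z x - ψ w x‖ := by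
        refine integral_mono_ae ((hmul z).sub (hmul w)).norm (hi.norm.const_mul B) ?_
        filter_upwards [hb] with x hx
        rw [← mul_sub, norm_mul]
        gcongr
    _ = B * ∫ x, ‖ψ z x - ψ w x‖ := integral_const_mul _ _
    _ ≤ _ := by gcongr

end

/-! ### Inverse branches over the complement of the postcritical set -/

section

variable {R : RatFunc ℂ}

/-- Over a disc in `Ω` the iterate `f^i` has a full set of univalent inverse branches, and the
`i`-th power of `T` is the sum over these branches. -/
lemma exists_inverse_branches (hR : R.denom.natDegree < R.num.natDegree) (hinf : toMap R ∞ = ∞)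
    (hone : toMap R ((1 : ℂ) : OnePoint ℂ) = ((1 : ℂ) : OnePoint ℂ))
    (hzero : toMap R ((0 : ℂ) : OnePoint ℂ) = ((0 : ℂ) : OnePoint ℂ)) {c : ℂ} {ρ : ℝ} (hρ : 0 < ρ)
    (hΩ : Metric.ball c ρ ⊆ Ω R) (i : ℕ) :
    ∃ (ι : Type) (_ : Fintype ι) (g : ι → ℂ → ℂ),
      (∀ k, ∀ x ∈ Metric.ball c ρ, DifferentiableAt ℂ (g k) x ∧ g k x ∈ Ω R ∧
        (fC R)^[i] (g k x) = x ∧ deriv (g k) x ≠ 0) ∧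
      (∀ x ∈ Metric.ball c ρ, Function.Injective fun k => g k x) ∧
      ∀ x ∈ Metric.ball c ρ, ∀ φ : ℂ → ℂ,
        (T R)^[i] φ x = ∑ k, φ (g k x) * deriv (g k) x ^ 2 := by
  induction i with
  | zero =>
    refine ⟨Unit, inferInstance, fun _ x => x, fun _ x hx => ⟨differentiableAt_id, hΩ hx, rfl, ?_⟩,
      fun x _ => Function.injective_of_subsingleton _, fun x _ φ => ?_⟩
    · simp
    · simp
  | succ i ih =>
    obtain ⟨ι, _, g, hg, hinj, hT⟩ := ih
    -- the branches of `f^{-(i+1)}` are the lifts through `f` of the branches of `f^{-i}`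
    have hex : ∀ k, _ := fun k => exists_lifts hR hinf hρ (g := g k)
      (fun x hx => (hg k x hx).1.differentiableWithinAt)
      (fun x hx => notMem_critValues_of_mem_Ω (hg k x hx).2.1)
    choose u hu0 hu1 hu2 hu3 hu4 using hex
    have hfib : ∀ k j, ∀ x ∈ Metric.ball c ρ, fC R (u k j x) = g k x := fun k j x hx =>
      fC_of_mem_fibre (hu2 k j x hx)
    refine ⟨Σ k, ↥(finite_fibre hR (g k c)).toFinset, inferInstance, fun p => u p.1 p.2,
      fun p x hx => ?_, fun x hx => ?_, fun x hx φ => ?_⟩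
    · obtain ⟨k, j⟩ := p
      obtain ⟨h1, h2, h3, h4⟩ := hg k x hx
      refine ⟨(hu1 k j x hx).differentiableAt,
        fibre_subset_Ω hR hinf hone hzero h2 (hu2 k j x hx), ?_, ?_⟩
      · rw [Function.iterate_succ_apply, hfib k j x hx, h3]
      · rw [(hu1 k j x hx).deriv]
        exact div_ne_zero h4
          (fD_ne_zero_of_notMem (hu2 k j x hx) (notMem_critValues_of_mem_Ω h2))
    · rintro ⟨k, j⟩ ⟨l, m⟩ h
      simp only at h
      have hkl : k = l := by
        apply hinj x hx
        simp only
        rw [← hfib k j x hx, h, hfib l m x hx]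
      subst hkl
      rw [hu3 k x hx h]
    · rw [Function.iterate_succ_apply, hT x hx (T R φ), Fintype.sum_sigma]
      refine Finset.sum_congr rfl fun k _ => ?_
      rw [hu4 k x hx φ, Finset.sum_mul]
      refine Finset.sum_congr rfl fun j _ => ?_
      rw [(hu1 k j x hx).deriv, div_pow]
      ring

/-- A Harnack inequality from a bound on the logarithmic derivative. -/
lemma norm_le_exp_mul_of_norm_deriv_le {h : ℂ → ℂ} {c : ℂ} {ρ M : ℝ}
    (hd : ∀ x ∈ Metric.ball c ρ, DifferentiableAt ℂ h x)
    (hM : ∀ x ∈ Metric.ball c ρ, ‖deriv h x‖ ≤ M * ‖h x‖) (hM0 : 0 ≤ M)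
    {x y : ℂ} (hx : x ∈ Metric.ball c ρ) (hy : y ∈ Metric.ball c ρ) :
    ‖h x‖ ≤ Real.exp (2 * ρ * M) * ‖h y‖ := by
  have hxy : ‖x - y‖ ≤ 2 * ρ := by
    rw [mem_ball_iff_norm] at hx hy
    have := norm_sub_le (x - c) (y - c)
    rw [sub_sub_sub_cancel_right] at this
    linarith
  have hmem : ∀ t ∈ Icc (0 : ℝ) 1, y + (t : ℂ) * (x - y) ∈ Metric.ball c ρ := by
    intro t ht
    have := (convex_ball c ρ).add_smul_sub_mem hy hx ht
    simpa using this
  have hder : ∀ t ∈ Icc (0 : ℝ) 1, HasDerivAt (fun t : ℝ => h (y + (t : ℂ) * (x - y)))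
      (deriv h (y + (t : ℂ) * (x - y)) * (x - y)) t := by
    intro t ht
    have h1 : HasDerivAt (fun t : ℝ => y + (t : ℂ) * (x - y)) (x - y) t := by
      have := ((Complex.ofRealCLM.hasDerivAt (x := t)).mul_const (x - y)).const_add y
      simpa using this
    exact ((hd _ (hmem t ht)).hasDerivAt).scomp_of_eq t h1 rfl |>.congr_deriv (by
      simp [mul_comm])
  have := norm_le_gronwallBound_of_norm_deriv_right_le (δ := ‖h y‖) (K := 2 * ρ * M) (ε := 0)
    (f := fun t : ℝ => h (y + (t : ℂ) * (x - y)))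
    (fun t ht => (hder t ht).continuousAt.continuousWithinAt)
    (fun t ht => (hder t (Ico_subset_Icc_self ht)).hasDerivWithinAt) (by simp)
    (fun t ht => by
      rw [norm_mul, add_zero]
      have h1 := hM _ (hmem t (Ico_subset_Icc_self ht))
      calc _ ≤ (M * ‖h (y + (t : ℂ) * (x - y))‖) * (2 * ρ) := by gcongr
        _ = _ := by ring) 1 (by simp)
  rw [gronwallBound_ε0] at this
  simpa [mul_comm] using this

/-- The transported test function `ψ_v(g) g'²` has uniformly bounded distortion if `g` is univalent
and omits the poles of `ψ_v`. -/
lemma norm_deriv_ψ_comp_le {g : ℂ → ℂ} {c : ℂ} {ρ : ℝ} (hρ : 0 < ρ) (v : ℂ)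
    (hg : DifferentiableOn ℂ g (Metric.ball c ρ)) (hinj : InjOn g (Metric.ball c ρ))
    (hd : deriv g c ≠ 0) (h0 : ∀ z ∈ Metric.ball c ρ, g z ≠ 0)
    (h1 : ∀ z ∈ Metric.ball c ρ, g z ≠ 1) (hv : ∀ z ∈ Metric.ball c ρ, g z ≠ v) :
    DifferentiableAt ℂ (fun x => ψ v (g x) * deriv g x ^ 2) c ∧
      ‖deriv (fun x => ψ v (g x) * deriv g x ^ 2) c‖ ≤
        60 / ρ * ‖ψ v (g c) * deriv g c ^ 2‖ := by
  have hc : c ∈ Metric.ball c ρ := Metric.mem_ball_self hρ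
  have hnhds := Metric.isOpen_ball.mem_nhds hc
  have hg1 : HasDerivAt g (deriv g c) c := (hg.differentiableAt hnhds).hasDerivAt
  have hg2 : HasDerivAt (deriv g) (deriv (deriv g) c) c :=
    ((hg.deriv Metric.isOpen_ball).differentiableAt hnhds).hasDerivAt
  have hD := ((hasDerivAt_ψ v (h0 c hc) (h1 c hc) (hv c hc)).comp c hg1).mul (hg2.pow 2)
  have hD' : HasDerivAt (fun x => ψ v (g x) * deriv g x ^ 2)
      (ψ v (g c) * deriv g c ^ 2 * (2 * (deriv (deriv g) c / deriv g c) -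
        (deriv g c / (g c - 0) + deriv g c / (g c - 1) + deriv g c / (g c - v)))) c := by
    refine hD.congr_deriv ?_
    have := h0 c hc
    have := sub_ne_zero.2 (h1 c hc)
    have := sub_ne_zero.2 (hv c hc)
    simp only [Function.comp, sub_zero, Pi.pow_apply]
    field_simp
    ring
  refine ⟨hD'.differentiableAt, ?_⟩
  rw [hD'.deriv, norm_mul, mul_comm]
  refine mul_le_mul_of_nonneg_right ?_ (norm_nonneg _)
  have b1 : ‖deriv (deriv g) c / deriv g c‖ ≤ 12 / ρ := by
    have := koebe_nonlinearity hρ hg hinj hd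
    rw [norm_div, div_le_div_iff₀ (norm_pos_iff.2 hd) hρ]
    linarith
  have b2 : ∀ a, (∀ z ∈ Metric.ball c ρ, g z ≠ a) → ‖deriv g c / (g c - a)‖ ≤ 12 / ρ := by
    intro a ha
    have := koebe_omitted hρ hg hinj hd ha
    rw [norm_div, div_le_div_iff₀ (norm_pos_iff.2 (sub_ne_zero.2 (ha c hc))) hρ]
    linarith
  calc _ ≤ ‖2 * (deriv (deriv g) c / deriv g c)‖ + (‖deriv g c / (g c - 0)‖ +
        ‖deriv g c / (g c - 1)‖ + ‖deriv g c / (g c - v)‖) :=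
        (norm_sub_le _ _).trans (by gcongr; exact norm_add₃_le)
    _ ≤ 2 * (12 / ρ) + (12 / ρ + 12 / ρ + 12 / ρ) := by
        rw [norm_mul, Complex.norm_ofNat]
        gcongr
        · exact b2 0 h0
        · exact b2 1 h1
        · exact b2 v hv
    _ = 60 / ρ := by ring

/-! ### Points that never return to a disc -/

/-- A disc well inside `Ω` has positive chordal distance from the postcritical set. -/
lemma exists_chordal_lower_bound {c : ℂ} {ρ : ℝ} (hρ : 0 < ρ)
    (hΩ : Metric.ball c (2 * ρ) ⊆ Ω R) : ∃ ε > 0, ∀ x ∈ Metric.ball c ρ, ∀ w ∈ postcritical R,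
      ε ≤ chordal (x : OnePoint ℂ) w := by
  set A := 1 + ‖c‖ + ρ
  have hA : 0 < A := by positivity
  refine ⟨2 / (A * (A / ρ + 1)), by positivity, fun x hx w hw => ?_⟩
  have hx1 : 1 + ‖x‖ ≤ A := by
    have := norm_sub_norm_le x c
    rw [mem_ball_iff_norm] at hx
    simp only [A]
    linarith
  have hsq : ∀ t : ℝ, 0 ≤ t → √(1 + t ^ 2) ≤ 1 + t := fun t ht =>
    Real.sqrt_le_iff.2 ⟨by positivity, by nlinarith⟩
  have hpos : ∀ t : ℝ, 0 < √(1 + t ^ 2) := fun t => Real.sqrt_pos.2 (by positivity)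
  have hxA : √(1 + ‖x‖ ^ 2) ≤ A := (hsq _ (norm_nonneg _)).trans hx1
  induction w using OnePoint.rec with
  | infty =>
    change _ ≤ 2 / √(1 + ‖x‖ ^ 2)
    refine div_le_div_of_nonneg_left (by norm_num) (hpos _) (hxA.trans ?_)
    have : 0 ≤ A / ρ := by positivity
    nlinarith
  | coe w =>
    change _ ≤ 2 * ‖x - w‖ / (√(1 + ‖x‖ ^ 2) * √(1 + ‖w‖ ^ 2))
    have hdist : ρ ≤ ‖x - w‖ := by
      by_contra! hlt
      refine (hΩ (a := w) ?_).1 hw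
      rw [mem_ball_iff_norm] at hx ⊢
      have := norm_sub_le (x - c) (x - w)
      rw [sub_sub_sub_cancel_left] at this
      linarith
    have hw1 : √(1 + ‖w‖ ^ 2) ≤ ‖x - w‖ * (A / ρ + 1) := by
      refine (hsq _ (norm_nonneg _)).trans ?_
      have h1 : ‖w‖ ≤ ‖x‖ + ‖x - w‖ := by
        have := norm_sub_le x (x - w)
        rwa [sub_sub_cancel] at this
      have h2 : A ≤ ‖x - w‖ * (A / ρ) := by
        calc A = ρ * (A / ρ) := by field_simp
          _ ≤ _ := by gcongr
      linarith
    rw [div_le_div_iff₀ (by positivity) (by have := hpos ‖x‖; have := hpos ‖w‖; positivity)]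
    calc 2 * (√(1 + ‖x‖ ^ 2) * √(1 + ‖w‖ ^ 2)) ≤ 2 * (A * (‖x - w‖ * (A / ρ + 1))) := by gcongr
      _ = _ := by ring

/-- The points of `D` that never return to `D`. -/
def nonreturning (R : RatFunc ℂ) (D : Set ℂ) : Set ℂ :=
  D \ ⋃ n : ℕ, (fC R)^[n + 1] ⁻¹' D

lemma measurableSet_nonreturning {D : Set ℂ} (hD : MeasurableSet D) :
    MeasurableSet (nonreturning R D) :=
  hD.diff (MeasurableSet.iUnion fun _ => measurable_iterate_fC _ hD)

lemma pairwise_disjoint_preimage_nonreturning (D : Set ℂ) :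
    Pairwise (Function.onFun Disjoint fun i : ℕ => (fC R)^[i] ⁻¹' nonreturning R D) := by
  refine (pairwise_disjoint_on _).2 fun i j hij => Set.disjoint_left.2 fun z hi hj => ?_
  refine hi.2 (mem_iUnion.2 ⟨j - i - 1, ?_⟩)
  rw [mem_preimage, ← Function.iterate_add_apply, show j - i - 1 + 1 + i = j by omega]
  exact hj.1

/-- The orbits of almost all points tend to the postcritical set, so they leave the disc for good,
and their last visit to it is a nonreturning point. If the nonreturning points formed a null set,
so would their preimages, and these cover almost all of the disc. -/
lemma volume_nonreturning_pos (hR : R.denom.natDegree < R.num.natDegree)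
    (hJ : juliaSet R = Set.univ) (hattr : AeAttractedToPostcritical R) {c : ℂ} {ρ : ℝ} (hρ : 0 < ρ)
    (hΩ : Metric.ball c (2 * ρ) ⊆ Ω R) : 0 < volume (nonreturning R (Metric.ball c ρ)) := by
  rw [pos_iff_ne_zero]
  intro h0
  obtain ⟨ε, hε, hch⟩ := exists_chordal_lower_bound hρ hΩ
  have hnull : ∀ n : ℕ, ∀ᵐ z, z ∉ (fC R)^[n] ⁻¹' nonreturning R (Metric.ball c ρ) := fun n =>
    compl_mem_ae_iff.2 ((quasiMeasurePreserving_iterate hR n).preimage_null h0)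
  have hout : ∀ᵐ z, z ∉ Metric.ball c ρ := by
    filter_upwards [ae_all_iff.2 hnull, hattr, ae_regularPts hR] with z h1 h2 h3 hz
    have h4 := h2 (by rw [hJ]; trivial) ε hε
    obtain ⟨N, hN⟩ := eventually_atTop.1 h4
    -- consider the last time at which the orbit visits the disc
    have hbdd : ∀ n : ℕ, (fC R)^[n] z ∈ Metric.ball c ρ → n ≤ N := by
      intro n hn
      by_contra! hlt
      obtain ⟨w, hw, hlt'⟩ := hN n hlt.le
      rw [iterate_toMap_coe h3] at hlt'
      exact absurd (hch _ hn w hw) (not_le.2 hlt')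
    classical
    set m := Nat.findGreatest (fun n : ℕ => (fC R)^[n] z ∈ Metric.ball c ρ) N
    have hm : (fC R)^[m] z ∈ Metric.ball c ρ :=
      Nat.findGreatest_spec (P := fun n : ℕ => (fC R)^[n] z ∈ Metric.ball c ρ) (Nat.zero_le N) hz
    refine h1 m ⟨hm, fun h => ?_⟩
    obtain ⟨n, hn⟩ := mem_iUnion.1 h
    rw [mem_preimage, ← Function.iterate_add_apply] at hn
    exact Nat.findGreatest_is_greatest (by omega : m < n + 1 + m) (hbdd _ hn) hn
  exact (Metric.measure_ball_pos volume c hρ).ne' (by simpa using compl_mem_ae_iff.1 hout)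

/-! ### Convergence of the resolvent series -/

lemma ne_of_mem_Ω {v x : ℂ} (hv : v ∈ critValues R) (hx : x ∈ Ω R) : x ≠ v := by
  rintro rfl
  exact hx.1 (critValue_mem_postcritical hv)

/-- A summable locally uniform bound for the terms of the resolvent series. By the Harnack
inequality the value of a summand `ψ_v(g) g'²` is comparable to its mean over the set `B` of
nonreturning points, so `T^i ψ_v` is bounded by a multiple of the integral of `|ψ_v|` over
`f^{-i}(B)`. These sets are disjoint. -/
lemma exists_summable_bound (hR : R.denom.natDegree < R.num.natDegree) (hinf : toMap R ∞ = ∞)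
    (hone : toMap R ((1 : ℂ) : OnePoint ℂ) = ((1 : ℂ) : OnePoint ℂ))
    (hzero : toMap R ((0 : ℂ) : OnePoint ℂ) = ((0 : ℂ) : OnePoint ℂ))
    (hJ : juliaSet R = Set.univ) (hattr : AeAttractedToPostcritical R)
    {v : ℂ} (hv : v ∈ critValues R) {c : ℂ} {ρ : ℝ} (hρ : 0 < ρ)
    (hΩ : Metric.ball c (2 * ρ) ⊆ Ω R) :
    ∃ u : ℕ → ℝ, Summable u ∧ ∀ i, ∀ x ∈ Metric.ball c ρ, ‖(T R)^[i] (ψ v) x‖ ≤ u i := by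
  set B := nonreturning R (Metric.ball c ρ)
  have hBm : MeasurableSet B := measurableSet_nonreturning measurableSet_ball
  have hBD : B ⊆ Metric.ball c ρ := sdiff_subset
  have hBfin : volume B ≠ ⊤ := ((measure_mono hBD).trans_lt measure_ball_lt_top).ne
  have hBpos : 0 < volume.real B :=
    ENNReal.toReal_pos (volume_nonreturning_pos hR hJ hattr hρ hΩ).ne' hBfin
  have hψ := (integrable_ψ v).norm
  have hpre : ∀ i, MeasurableSet ((fC R)^[i] ⁻¹' B) := fun i => measurable_iterate_fC i hBm
  set H := Real.exp (2 * ρ * (60 / ρ))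
  refine ⟨fun i => H / volume.real B * ∫ x in (fC R)^[i] ⁻¹' B, ‖ψ v x‖, ?_, fun i x hx => ?_⟩
  · exact (hasSum_integral_iUnion hpre (pairwise_disjoint_preimage_nonreturning _)
      hψ.integrableOn).summable.mul_left _
  obtain ⟨ι, _, g, hg, hinj, hT⟩ :=
    exists_inverse_branches hR hinf hone hzero (mul_pos two_pos hρ) hΩ i
  have hsub : Metric.ball c ρ ⊆ Metric.ball c (2 * ρ) := Metric.ball_subset_ball (by linarith)
  have hsub' : ∀ y ∈ Metric.ball c ρ, Metric.ball y ρ ⊆ Metric.ball c (2 * ρ) := fun y hy =>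
    Metric.ball_subset_ball' (by rw [Metric.mem_ball] at hy; linarith)
  have hleft : ∀ k, InjOn (g k) (Metric.ball c (2 * ρ)) := by
    intro k y hy z hz h
    rw [← (hg k y hy).2.2.1, h, (hg k z hz).2.2.1]
  set h : ι → ℂ → ℂ := fun k y => ψ v (g k y) * deriv (g k) y ^ 2
  -- each branch is univalent on discs of radius `ρ` about the points of `D` and omits the poles of
  -- `ψ_v`, so its summand has logarithmic derivative at most `60 / ρ`
  have hder : ∀ k, ∀ y ∈ Metric.ball c ρ, DifferentiableAt ℂ (h k) y ∧
      ‖deriv (h k) y‖ ≤ 60 / ρ * ‖h k y‖ := fun k y hy =>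
    norm_deriv_ψ_comp_le hρ v
      (fun z hz => (hg k z (hsub' y hy hz)).1.differentiableWithinAt)
      ((hleft k).mono (hsub' y hy)) (hg k y (hsub hy)).2.2.2
      (fun z hz => (hg k z (hsub' y hy hz)).2.1.2.1)
      (fun z hz => (hg k z (hsub' y hy hz)).2.1.2.2)
      (fun z hz => ne_of_mem_Ω hv (hg k z (hsub' y hy hz)).2.1)
  have hharnack : ∀ k, ∀ y ∈ Metric.ball c ρ, ‖h k x‖ ≤ H * ‖h k y‖ := fun k y hy =>
    norm_le_exp_mul_of_norm_deriv_le (fun z hz => (hder k z hz).1) (fun z hz => (hder k z hz).2)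
      (by positivity) hx hy
  have hinjB : ∀ k, InjOn (g k) B := fun k => (hleft k).mono (hBD.trans hsub)
  have hderB : ∀ k, ∀ y ∈ B, HasDerivAt (g k) (deriv (g k) y) y := fun k y hy =>
    (hg k y (hsub (hBD hy))).1.hasDerivAt
  have himage : ∀ k, MeasurableSet (g k '' B) := fun k =>
    measurable_image_of_fderivWithin hBm
      (fun y hy => ((hderB k y hy).complexToReal_fderiv).hasFDerivWithinAt) (hinjB k)
  have hpreim : ∀ k, ∀ y ∈ B, (fC R)^[i] (g k y) = y := fun k y hy =>
    (hg k y (hsub (hBD hy))).2.2.1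
  -- the images of `B` under different branches are disjoint parts of `f^{-i}(B)`
  have hdisj : Pairwise (Function.onFun Disjoint fun k => g k '' B) := by
    intro k l hkl
    refine Set.disjoint_left.2 ?_
    rintro _ ⟨y, hy, rfl⟩ ⟨z, hz, hzy⟩
    have hyz : z = y := by rw [← hpreim l z hz, hzy, hpreim k y hy]
    subst hyz
    exact hkl (hinj z (hsub (hBD hy)) hzy).symm
  have himg : ∀ k, ∫ y in g k '' B, ‖ψ v y‖ = ∫ y in B, ‖h k y‖ := by
    intro k
    rw [integral_image_holomorphic hBm (hderB k) (hinjB k)]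
    refine setIntegral_congr_fun hBm fun y _ => ?_
    simp only [h, norm_mul, norm_pow, smul_eq_mul]
    ring
  have hint : ∀ k, IntegrableOn (fun y => ‖h k y‖) B := by
    intro k
    have := (integrableOn_image_holomorphic hBm (hderB k) (hinjB k) fun y => ‖ψ v y‖).1
      hψ.integrableOn
    refine this.congr_fun (fun y _ => ?_) hBm
    simp only [h, norm_mul, norm_pow, smul_eq_mul]
    ring
  -- average the Harnack inequality over the nonreturning set
  have hterm : ∀ k, ‖h k x‖ * volume.real B ≤ H * ∫ y in g k '' B, ‖ψ v y‖ := by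
    intro k
    rw [himg k, ← integral_const_mul]
    calc ‖h k x‖ * volume.real B = ∫ y in B, ‖h k x‖ := by
          rw [setIntegral_const, smul_eq_mul, mul_comm]
      _ ≤ _ := setIntegral_mono_on (integrableOn_const hBfin) ((hint k).const_mul H) hBm
          fun y hy => hharnack k y (hBD hy)
  beta_reduce
  rw [hT x (hsub hx), div_mul_eq_mul_div, le_div_iff₀ hBpos]
  calc ‖∑ k, ψ v (g k x) * deriv (g k) x ^ 2‖ * volume.real B
      ≤ (∑ k, ‖h k x‖) * volume.real B := by gcongr; exact norm_sum_le _ _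
    _ = ∑ k, ‖h k x‖ * volume.real B := Finset.sum_mul _ _ _
    _ ≤ ∑ k, H * ∫ y in g k '' B, ‖ψ v y‖ := Finset.sum_le_sum fun k _ => hterm k
    _ = H * ∫ y in ⋃ k, g k '' B, ‖ψ v y‖ := by
        rw [← Finset.mul_sum, integral_iUnion_fintype himage hdisj fun k => hψ.integrableOn]
    _ ≤ H * ∫ y in (fC R)^[i] ⁻¹' B, ‖ψ v y‖ := by
        gcongr ?_ * ?_
        refine setIntegral_mono_set hψ.integrableOn (Eventually.of_forall fun _ => norm_nonneg _)
          (LE.le.eventuallyLE (iUnion_subset fun k => ?_))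
        rintro _ ⟨y, hy, rfl⟩
        rw [mem_preimage, hpreim k y hy]
        exact hy

lemma differentiableAt_iterate_T_ψ (hR : R.denom.natDegree < R.num.natDegree)
    (hinf : toMap R ∞ = ∞)
    (hone : toMap R ((1 : ℂ) : OnePoint ℂ) = ((1 : ℂ) : OnePoint ℂ))
    (hzero : toMap R ((0 : ℂ) : OnePoint ℂ) = ((0 : ℂ) : OnePoint ℂ))
    {v : ℂ} (hv : v ∈ critValues R) (i : ℕ) :
    ∀ x ∈ Ω R, DifferentiableAt ℂ ((T R)^[i] (ψ v)) x := by
  induction i with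
  | zero =>
    intro x hx
    exact (hasDerivAt_ψ v hx.2.1 hx.2.2 (ne_of_mem_Ω hv hx)).differentiableAt
  | succ i ih =>
    intro x hx
    rw [Function.iterate_succ_apply']
    exact differentiableAt_T hR hinf isOpen_Ω (fun x hx => notMem_critValues_of_mem_Ω hx)
      (fun x hx y hy => ih y (fibre_subset_Ω hR hinf hone hzero hx hy)) hx

lemma exists_ball_subset_Ω {x : ℂ} (hx : x ∈ Ω R) :
    ∃ ρ > 0, Metric.ball x (2 * ρ) ⊆ Ω R := by
  obtain ⟨ε, hε, h⟩ := Metric.isOpen_iff.1 isOpen_Ω x hx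
  exact ⟨ε / 2, by positivity, by rwa [mul_div_cancel₀ _ two_ne_zero]⟩

/-- The resolvent series converges on `Ω` to a holomorphic solution of `r - T r = ψ`. -/
lemma resolvent_on_Ω (hR : R.denom.natDegree < R.num.natDegree) (hinf : toMap R ∞ = ∞)
    (hone : toMap R ((1 : ℂ) : OnePoint ℂ) = ((1 : ℂ) : OnePoint ℂ))
    (hzero : toMap R ((0 : ℂ) : OnePoint ℂ) = ((0 : ℂ) : OnePoint ℂ))
    (hJ : juliaSet R = Set.univ) (hattr : AeAttractedToPostcritical R)
    {v : ℂ} (hv : v ∈ critValues R) :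
    (∀ x ∈ Ω R, Summable fun i : ℕ => ((T R)^[i] (ψ v)) x) ∧
      (∀ x ∈ Ω R, r R v x - T R (r R v) x = ψ v x) ∧ DifferentiableOn ℂ (r R v) (Ω R) := by
  have hsum : ∀ x ∈ Ω R, Summable fun i : ℕ => ((T R)^[i] (ψ v)) x := by
    intro x hx
    obtain ⟨ρ, hρ, hb⟩ := exists_ball_subset_Ω hx
    obtain ⟨u, hu, hle⟩ := exists_summable_bound hR hinf hone hzero hJ hattr hv hρ hb
    exact hu.of_norm_bounded fun i => hle i x (Metric.mem_ball_self hρ)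
  refine ⟨hsum, fun x hx => ?_, fun x hx => ?_⟩
  · have h1 : T R (r R v) x = ∑' i : ℕ, (T R)^[i + 1] (ψ v) x := by
      rw [T_eq_sum hR]
      have hfib : ∀ y ∈ (finite_fibre hR x).toFinset, y ∈ Ω R := fun y hy =>
        fibre_subset_Ω hR hinf hone hzero hx ((finite_fibre hR x).mem_toFinset.1 hy)
      have h2 : ∀ y ∈ (finite_fibre hR x).toFinset, r R v y / fD R y ^ 2 =
          ∑' i : ℕ, (T R)^[i] (ψ v) y / fD R y ^ 2 := fun y hy => tsum_div_const.symm
      rw [Finset.sum_congr rfl h2, ← Summable.tsum_finsetSum fun y hy =>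
        (hsum y (hfib y hy)).div_const _]
      refine tsum_congr fun i => ?_
      rw [Function.iterate_succ_apply', T_eq_sum hR]
    rw [h1, r, (hsum x hx).tsum_eq_zero_add, add_sub_cancel_right, Function.iterate_zero, id]
  · obtain ⟨ρ, hρ, hb⟩ := exists_ball_subset_Ω hx
    obtain ⟨u, hu, hle⟩ := exists_summable_bound hR hinf hone hzero hJ hattr hv hρ hb
    have hsub : Metric.ball x ρ ⊆ Ω R := (Metric.ball_subset_ball (by linarith)).trans hb
    have := Complex.differentiableOn_tsum_of_summable_norm hu (fun i y hy =>
      (differentiableAt_iterate_T_ψ hR hinf hone hzero hv i y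
        (hsub hy)).differentiableWithinAt) Metric.isOpen_ball hle
    exact (this.differentiableAt (Metric.ball_mem_nhds x hρ)).differentiableWithinAt

end

/-! ### Spreading a line field from a wandering set -/

section

variable {R : RatFunc ℂ}

/-- A planar set that every regular orbit visits at most once. -/
def IsWandering (R : RatFunc ℂ) (A : Set ℂ) : Prop :=
  ∀ z ∈ regularPts R, ∀ i j : ℕ, (fC R)^[i] z ∈ A → (fC R)^[j] z ∈ A → i = j

lemma IsWandering.mono {A B : Set ℂ} (hB : IsWandering R B) (h : A ⊆ B) : IsWandering R A :=
  fun z hz i j hi hj => hB z hz i j (h hi) (h hj)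

open Classical in
/-- The function `(f^i)^* ν` on `f^{-i}(A)`, `i ≥ 0`, and `0` elsewhere. -/
def spread (R : RatFunc ℂ) (A : Set ℂ) (ν : ℂ → ℂ) (z : ℂ) : ℂ :=
  if h : ∃ i : ℕ, (fC R)^[i] z ∈ A then ((push R)^[Nat.find h] ν) z else 0

lemma spread_of_mem {A : Set ℂ} (hA : IsWandering R A) {z : ℂ} (hz : z ∈ regularPts R) {i : ℕ}
    (hi : (fC R)^[i] z ∈ A) (ν : ℂ → ℂ) : spread R A ν z = (push R)^[i] ν z := by
  classical
  have h : ∃ i : ℕ, (fC R)^[i] z ∈ A := ⟨i, hi⟩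
  rw [spread, dif_pos h, hA z hz _ _ (Nat.find_spec h) hi]

lemma spread_of_notMem {A : Set ℂ} {z : ℂ} (h : ∀ i, (fC R)^[i] z ∉ A) (ν : ℂ → ℂ) :
    spread R A ν z = 0 := by
  rw [spread, dif_neg (by simpa using h)]

lemma hasSum_spread {A : Set ℂ} (hA : IsWandering R A) {z : ℂ} (hz : z ∈ regularPts R)
    (ν : ℂ → ℂ) : HasSum (fun i : ℕ => (push R)^[i] (A.indicator ν) z) (spread R A ν z) := by
  by_cases h : ∃ i : ℕ, (fC R)^[i] z ∈ A
  · obtain ⟨i, hi⟩ := h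
    rw [spread_of_mem hA hz hi]
    have hi' : (push R)^[i] ν z = (push R)^[i] (A.indicator ν) z := by
      rw [iterate_push_indicator, indicator_of_mem (show z ∈ (fC R)^[i] ⁻¹' A from hi)]
    rw [hi']
    refine hasSum_single i fun j hj => ?_
    rw [iterate_push_indicator, indicator_of_notMem]
    exact fun h' => hj (hA z hz j i h' hi)
  · push Not at h
    rw [spread_of_notMem h]
    convert! hasSum_zero using 2 with i
    rw [iterate_push_indicator, indicator_of_notMem (show z ∉ _ from h i)]

/-- The spread function is invariant off the set it was spread from. -/
lemma push_spread {A : Set ℂ} (hA : IsWandering R A) {z : ℂ} (hz : z ∈ regularPts R)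
    (ν : ℂ → ℂ) : push R (spread R A ν) z = spread R A ν z - A.indicator ν z := by
  have hfz := fC_mem_regularPts hz
  by_cases hzA : z ∈ A
  · have h1 : ∀ i, (fC R)^[i] (fC R z) ∉ A := fun i hi =>
      absurd (hA z hz (i + 1) 0 hi hzA) (by omega)
    rw [push, spread_of_notMem h1, spread_of_mem hA hz (i := 0) hzA, indicator_of_mem hzA]
    simp
  · rw [indicator_of_notMem hzA, sub_zero]
    by_cases h : ∃ i : ℕ, (fC R)^[i] (fC R z) ∈ A
    · obtain ⟨i, hi⟩ := h
      rw [push, spread_of_mem hA hfz hi, spread_of_mem hA hz (i := i + 1) hi,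
        Function.iterate_succ_apply', push]
    · push Not at h
      rw [push, spread_of_notMem h, zero_mul, spread_of_notMem]
      rintro (_ | i)
      · exact hzA
      · exact h i

lemma nullMeasurableSet_preimage_iterate (hR : R.denom.natDegree < R.num.natDegree) {A : Set ℂ}
    (hA : NullMeasurableSet A) (i : ℕ) : NullMeasurableSet ((fC R)^[i] ⁻¹' A) :=
  hA.preimage (quasiMeasurePreserving_iterate hR i)

lemma ae_iterate (hR : R.denom.natDegree < R.num.natDegree) {p : ℂ → Prop}
    (h : ∀ᵐ z : ℂ, p z) : ∀ᵐ z : ℂ, ∀ i : ℕ, p ((fC R)^[i] z) :=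
  ae_all_iff.2 fun i => (quasiMeasurePreserving_iterate hR i).ae h

lemma aemeasurable_spread (hR : R.denom.natDegree < R.num.natDegree) {A : Set ℂ}
    (hA : IsWandering R A) {ν : ℂ → ℂ} (hν : AEMeasurable (A.indicator ν) volume) :
    AEMeasurable (spread R A ν) volume := by
  refine aemeasurable_of_tendsto_metrizable_ae atTop
    (f := fun n z => ∑ i ∈ Finset.range n, (push R)^[i] (A.indicator ν) z) (fun n => ?_) ?_
  · exact Finset.aemeasurable_fun_sum _ fun i _ => iterate_push_aemeasurable hR hν i
  · filter_upwards [ae_regularPts hR] with z hz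
    exact (hasSum_spread hA hz ν).tendsto_sum_nat

lemma ae_norm_spread_le (hR : R.denom.natDegree < R.num.natDegree) {A : Set ℂ}
    (hA : IsWandering R A) {ν : ℂ → ℂ} {C : ℝ} (hb : ∀ᵐ x : ℂ, ‖A.indicator ν x‖ ≤ C) :
    ∀ᵐ x : ℂ, ‖spread R A ν x‖ ≤ C := by
  obtain ⟨x₀, hx₀⟩ := hb.exists
  have hC : 0 ≤ C := (norm_nonneg _).trans hx₀
  filter_upwards [ae_regularPts hR, ae_all_iff.2 fun n => iterate_push_ae_norm_le hR hb n]
    with z hz hle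
  by_cases h : ∃ i : ℕ, (fC R)^[i] z ∈ A
  · obtain ⟨i, hi⟩ := h
    have := hle i
    rwa [iterate_push_indicator, indicator_of_mem (show z ∈ _ from hi), ← spread_of_mem hA hz hi]
      at this
  · push Not at h
    rw [spread_of_notMem h, norm_zero]
    exact hC

lemma pairwise_aedisjoint_preimage (hR : R.denom.natDegree < R.num.natDegree) {A : Set ℂ}
    (hA : IsWandering R A) :
    Pairwise (Function.onFun (AEDisjoint volume) fun i : ℕ => (fC R)^[i] ⁻¹' A) := by
  intro i j hij
  refine measure_mono_null ?_ ((countable_compl_regularPts hR).measure_zero volume)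
  rintro z ⟨hi, hj⟩ hz
  exact hij (hA z hz i j hi hj)

lemma summable_integral_preimage (hR : R.denom.natDegree < R.num.natDegree) {A : Set ℂ}
    (hA : IsWandering R A) (hAm : NullMeasurableSet A) {g : ℂ → ℂ} (hg : Integrable g) :
    Summable fun i : ℕ => ∫ x in (fC R)^[i] ⁻¹' A, ‖g x‖ :=
  (hasSum_integral_iUnion_ae (nullMeasurableSet_preimage_iterate hR hAm)
    (pairwise_aedisjoint_preimage hR hA) hg.norm.integrableOn).summable

/-- Duality between spreading and the resolvent series. -/
lemma hasSum_integral_spread (hR : R.denom.natDegree < R.num.natDegree) {A : Set ℂ}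
    (hA : IsWandering R A) (hAm : NullMeasurableSet A) {ν : ℂ → ℂ} {C : ℝ}
    (hν : AEMeasurable (A.indicator ν) volume) (hb : ∀ᵐ x : ℂ, ‖A.indicator ν x‖ ≤ C)
    {g : ℂ → ℂ} (hg : Integrable g) :
    HasSum (fun i : ℕ => ∫ x in A, ν x * (T R)^[i] g x) (∫ x, spread R A ν x * g x) := by
  have hint : ∀ i : ℕ, Integrable fun x => (push R)^[i] (A.indicator ν) x * g x := fun i =>
    hg.bdd_mul (iterate_push_aemeasurable hR hν i).aestronglyMeasurable
      (iterate_push_ae_norm_le hR hb i)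
  -- the `i`-th term lives on the `i`-th preimage of `A`, and these preimages are disjoint
  have hsum : Summable fun i : ℕ => ∫ x, ‖(push R)^[i] (A.indicator ν) x * g x‖ := by
    refine Summable.of_nonneg_of_le (fun i => integral_nonneg fun _ => norm_nonneg _) (fun i => ?_)
      ((summable_integral_preimage hR hA hAm hg).mul_left C)
    rw [← integral_indicator₀ (nullMeasurableSet_preimage_iterate hR hAm i) (μ := volume)
      (f := fun x => ‖g x‖), ← integral_const_mul]
    refine integral_mono_ae (hint i).norm ((hg.norm.indicator₀
      (nullMeasurableSet_preimage_iterate hR hAm i)).const_mul C) ?_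
    filter_upwards [iterate_push_ae_norm_le hR hb i] with x hx
    by_cases hxA : x ∈ (fC R)^[i] ⁻¹' A
    · rw [indicator_of_mem hxA, norm_mul]
      gcongr
    · rw [iterate_push_indicator, indicator_of_notMem hxA, indicator_of_notMem hxA]
      simp
  have h := hasSum_integral_of_summable_integral_norm hint hsum
  have e1 : ∀ i : ℕ, ∫ x, (push R)^[i] (A.indicator ν) x * g x = ∫ x in A, ν x * (T R)^[i] g x := by
    intro i
    rw [integral_iterate_push_mul hR hν hb hg, ← integral_indicator₀ hAm]
    refine integral_congr_ae (Eventually.of_forall fun x => ?_)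
    by_cases hx : x ∈ A <;> simp [hx]
  have e2 : ∫ x, ∑' i : ℕ, (push R)^[i] (A.indicator ν) x * g x = ∫ x, spread R A ν x * g x := by
    refine integral_congr_ae ?_
    filter_upwards [ae_regularPts hR] with z hz
    rw [tsum_mul_right, (hasSum_spread hA hz ν).tsum_eq]
  rw [e2] at h
  exact (funext e1 : (fun i : ℕ => ∫ x, (push R)^[i] (A.indicator ν) x * g x) = _) ▸ h

lemma spread_congr_set {A B : Set ℂ} {z : ℂ} (h : ∀ i : ℕ, (fC R)^[i] z ∈ A ↔ (fC R)^[i] z ∈ B)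
    (ν : ℂ → ℂ) : spread R A ν z = spread R B ν z := by
  classical
  simp only [spread, h]

lemma spread_inter {A E : Set ℂ} {z : ℂ} (hE : ∀ i : ℕ, (fC R)^[i] z ∈ E ↔ z ∈ E) (ν : ℂ → ℂ) :
    spread R (A ∩ E) ν z = E.indicator (spread R A ν) z := by
  by_cases h : z ∈ E
  · rw [indicator_of_mem h]
    exact spread_congr_set (A := A ∩ E) (B := A)
      (fun i => ⟨fun h' => h'.1, fun h' => ⟨h', (hE i).2 h⟩⟩) ν
  · rw [indicator_of_notMem h, spread_of_notMem]
    exact fun i hi => h ((hE i).1 hi.2)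

lemma ae_iterate_mem_iff (hR : R.denom.natDegree < R.num.natDegree) {E : Set ℂ}
    (hE : ∀ᵐ z : ℂ, fC R z ∈ E ↔ z ∈ E) : ∀ᵐ z : ℂ, ∀ i : ℕ, (fC R)^[i] z ∈ E ↔ z ∈ E := by
  filter_upwards [ae_iterate hR hE] with z h i
  induction i with
  | zero => rfl
  | succ i ih => rw [Function.iterate_succ_apply', h i, ih]

/-! ### The resolvent on wandering subsets of `Ω` -/

/-- Integrability of the resolvent over a wandering set, and the duality formula. -/
lemma integral_mul_resolvent (hR : R.denom.natDegree < R.num.natDegree) {A : Set ℂ}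
    (hA : IsWandering R A) (hAm : NullMeasurableSet A) (hAΩ : ∀ᵐ x : ℂ, x ∈ A → x ∈ Ω R) {v : ℂ}
    (hs : ∀ x ∈ Ω R, Summable fun i : ℕ => ((T R)^[i] (ψ v)) x) :
    IntegrableOn (r R v) A ∧ ∀ {ν : ℂ → ℂ} {C : ℝ}, AEMeasurable (A.indicator ν) volume →
      (∀ᵐ x : ℂ, ‖A.indicator ν x‖ ≤ C) →
      ∫ x in A, ν x * r R v x = ∫ x, spread R A ν x * ψ v x := by
  have hψ := integrable_ψ v
  have hint : ∀ i : ℕ, IntegrableOn ((T R)^[i] (ψ v)) A := fun i =>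
    (integrable_iterate_T hR hψ i).integrableOn
  have hle : ∀ i : ℕ, ∫ x in A, ‖(T R)^[i] (ψ v) x‖ ≤ ∫ x in (fC R)^[i] ⁻¹' A, ‖ψ v x‖ := by
    intro i
    rw [integral_norm_eq_lintegral_enorm (hint i).aestronglyMeasurable,
      integral_norm_eq_lintegral_enorm hψ.integrableOn.aestronglyMeasurable]
    refine ENNReal.toReal_mono ?_ (setLIntegral_iterate_T_le hR hψ i hAm)
    exact (hψ.integrableOn (s := (fC R)^[i] ⁻¹' A)).hasFiniteIntegral.ne
  -- the preimages of the wandering set are disjoint, so the `L¹(A)` norms of the terms are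
  -- summable
  have hsum : Summable fun i : ℕ => ∫ x in A, ‖(T R)^[i] (ψ v) x‖ :=
    Summable.of_nonneg_of_le (fun i => integral_nonneg fun _ => norm_nonneg _) hle
      (summable_integral_preimage hR hA hAm hψ)
  have hΩ : ∀ᵐ x ∂volume.restrict A, x ∈ Ω R := (ae_restrict_iff'₀ hAm).2 hAΩ
  have hr : IntegrableOn (r R v) A := by
    refine ⟨aestronglyMeasurable_of_tendsto_ae atTop
      (f := fun n x => ∑ i ∈ Finset.range n, (T R)^[i] (ψ v) x) (fun n =>
        (integrable_finsetSum _ fun i _ => hint i).aestronglyMeasurable) ?_, ?_⟩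
    · filter_upwards [hΩ] with x hx
      exact (hs x hx).hasSum.tendsto_sum_nat
    · rw [HasFiniteIntegral]
      calc ∫⁻ x in A, ‖r R v x‖ₑ ≤ ∫⁻ x in A, ∑' i : ℕ, ‖(T R)^[i] (ψ v) x‖ₑ :=
            lintegral_mono fun x => enorm_tsum_le_tsum_enorm
        _ = ∑' i : ℕ, ∫⁻ x in A, ‖(T R)^[i] (ψ v) x‖ₑ :=
            lintegral_tsum fun i => (hint i).aestronglyMeasurable.enorm
        _ = ∑' i : ℕ, ENNReal.ofReal (∫ x in A, ‖(T R)^[i] (ψ v) x‖) :=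
            tsum_congr fun i => (ofReal_integral_norm_eq_lintegral_enorm (hint i)).symm
        _ = ENNReal.ofReal (∑' i : ℕ, ∫ x in A, ‖(T R)^[i] (ψ v) x‖) :=
            (ENNReal.ofReal_tsum_of_nonneg (fun i => integral_nonneg fun _ => norm_nonneg _)
              hsum).symm
        _ < ⊤ := ENNReal.ofReal_lt_top
  refine ⟨hr, fun {ν C} hν hb => ?_⟩
  have h1 := hasSum_integral_spread hR hA hAm hν hb hψ
  have hmulint : ∀ {g : ℂ → ℂ}, IntegrableOn g A → IntegrableOn (fun x => ν x * g x) A := by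
    intro g hg
    refine Integrable.bdd_mul (c := C) hg ?_ ?_
    · exact ((aemeasurable_indicator_iff₀ hAm).1 hν).aestronglyMeasurable
    · refine (ae_restrict_iff'₀ hAm).2 ?_
      filter_upwards [hb] with x hx hxA
      rwa [indicator_of_mem hxA] at hx
  have hbr : ∀ᵐ x ∂volume.restrict A, ‖ν x‖ ≤ C := by
    refine (ae_restrict_iff'₀ hAm).2 ?_
    filter_upwards [hb] with x hx hxA
    rwa [indicator_of_mem hxA] at hx
  have h2 := hasSum_integral_of_summable_integral_norm (fun i => hmulint (hint i))
    (Summable.of_nonneg_of_le (fun i => integral_nonneg fun _ => norm_nonneg _) (fun i => by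
      rw [← integral_const_mul]
      refine integral_mono_ae (hmulint (hint i)).norm ((hint i).norm.const_mul C) ?_
      filter_upwards [hbr] with x hx
      rw [norm_mul]
      gcongr) (hsum.mul_left C))
  rw [h1.unique h2]
  refine integral_congr_ae (Eventually.of_forall fun x => ?_)
  exact tsum_mul_left.symm

end

/-! ### Fundamental sets in the plane -/

section

variable {R : RatFunc ℂ}

lemma mem_fin {A : Set (OnePoint ℂ)} {z : ℂ} : z ∈ fin A ↔ (z : OnePoint ℂ) ∈ A := Iff.rfl

lemma mem_fin_primed {K : Set (OnePoint ℂ)} {z : ℂ} (hz : z ∈ regularPts R) :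
    z ∈ fin (primed R K) ↔ fC R z ∈ fin K ∧ z ∉ fin K := by
  rw [mem_fin, primed, Set.mem_sdiff, mem_preimage, show toMap R z = _ from toMap_coe_of_ne (hz 0)]
  rfl

lemma iterate_fC_mem_regularPts {z : ℂ} (hz : z ∈ regularPts R) (n : ℕ) :
    (fC R)^[n] z ∈ regularPts R := by
  induction n with
  | zero => exact hz
  | succ n ih => rw [Function.iterate_succ_apply']; exact fC_mem_regularPts ih

lemma iterate_mem_fin_of_le {K : Set (OnePoint ℂ)} (hK : MapsTo (toMap R) K K) {z : ℂ}
    (hz : z ∈ regularPts R) {i j : ℕ} (hij : i ≤ j) (h : (fC R)^[i] z ∈ fin K) :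
    (fC R)^[j] z ∈ fin K := by
  obtain ⟨k, rfl⟩ := Nat.exists_eq_add_of_le hij
  rw [mem_fin, ← iterate_toMap_coe hz] at h ⊢
  rw [Nat.add_comm, Function.iterate_add_apply]
  exact hK.iterate k h

lemma isWandering_primed {K : Set (OnePoint ℂ)} (hK : MapsTo (toMap R) K K) :
    IsWandering R (fin (primed R K)) := by
  have key : ∀ z ∈ regularPts R, ∀ i j : ℕ, i < j → (fC R)^[i] z ∈ fin (primed R K) →
      (fC R)^[j] z ∉ fin (primed R K) := by
    intro z hz i j hij hi hj
    rw [mem_fin_primed (iterate_fC_mem_regularPts hz _)] at hi hj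
    refine hj.2 (iterate_mem_fin_of_le hK hz (i := i + 1) hij ?_)
    rw [Function.iterate_succ_apply']
    exact hi.1
  intro z hz i j hi hj
  rcases lt_trichotomy i j with h | h | h
  · exact absurd hj (key z hz i j h hi)
  · exact h
  · exact absurd hi (key z hz j i h hj)

lemma nullMeasurableSet_congr_ae {A B : Set ℂ} (hB : NullMeasurableSet B)
    (h : ∀ᵐ z : ℂ, z ∈ A ↔ z ∈ B) : NullMeasurableSet A :=
  hB.congr (eventuallyEq_set.2 (h.mono fun _ hz => hz.symm))

lemma nullMeasurableSet_primed (hR : R.denom.natDegree < R.num.natDegree) {K : Set (OnePoint ℂ)}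
    (hK : NullMeasurableSet (fin K)) : NullMeasurableSet (fin (primed R K)) := by
  refine nullMeasurableSet_congr_ae (B := fC R ⁻¹' fin K \ fin K)
    ((hK.preimage (quasiMeasurePreserving_fC hR)).diff hK) ?_
  filter_upwards [ae_regularPts hR] with z hz
  exact mem_fin_primed hz

lemma ae_primed_subset_Ω {K : Set (OnePoint ℂ)} (hJ : juliaSet R = Set.univ)
    (hK : IsFundamental R K) : ∀ᵐ z : ℂ, z ∈ fin (primed R K) → z ∈ Ω R := by
  filter_upwards [ae_ne 0, ae_ne 1] with z h0 h1 hz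
  refine ⟨fun h => hz.2 (hK.postcritical_subset ⟨h, by rw [hJ]; trivial⟩), h0, h1⟩

lemma mem_fin_backward {A : Set (OnePoint ℂ)} {z : ℂ} (hz : z ∈ regularPts R) :
    z ∈ fin (backward R A) ↔ ∃ i : ℕ, (fC R)^[i] z ∈ fin A := by
  simp only [mem_fin, backward, mem_iUnion, mem_preimage, iterate_toMap_coe hz]

/-- Almost every orbit either starts in a fundamental set or passes once through `K'`. -/
lemma ae_mem_or_iterate_mem (hR : R.denom.natDegree < R.num.natDegree) {K : Set (OnePoint ℂ)}
    (hJ : juliaSet R = Set.univ) (hK : IsFundamental R K) :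
    ∀ᵐ z : ℂ, z ∉ fin K ↔ ∃ i : ℕ, (fC R)^[i] z ∈ fin (primed R K) := by
  have h : ∀ᵐ z : ℂ, z ∉ fin (juliaSet R \ (K ∪ backward R (primed R K))) :=
    compl_mem_ae_iff.2 hK.area_rest
  filter_upwards [h, ae_regularPts hR] with z hz hr
  constructor
  · intro hzK
    by_contra hb
    refine hz ⟨by rw [hJ]; trivial, fun h' => ?_⟩
    rcases h' with h' | h'
    · exact hzK h'
    · exact hb ((mem_fin_backward hr).1 h')
  · rintro ⟨i, hi⟩ hzK
    rw [mem_fin_primed (iterate_fC_mem_regularPts hr _)] at hi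
    exact hi.2 (iterate_mem_fin_of_le hK.mapsTo hr (Nat.zero_le i) hzK)

/-! ### Decreasing sequences of fundamental sets -/

/-- The planar set `K_n' \ K_∞'`. -/
def shell (R : RatFunc ℂ) (K : ℕ → Set (OnePoint ℂ)) (n : ℕ) : Set ℂ :=
  fin (primed R (K n) \ primed R (Kinf K))

variable {K : ℕ → Set (OnePoint ℂ)}

lemma mem_fin_Kinf {z : ℂ} : z ∈ fin (Kinf K) ↔ ∀ n, z ∈ fin (K n) := by
  simp [mem_fin, Kinf]

lemma mapsTo_Kinf (hK : ∀ n, MapsTo (toMap R) (K n) (K n)) :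
    MapsTo (toMap R) (Kinf K) (Kinf K) :=
  fun _ hz => mem_iInter.2 fun n => hK n (mem_iInter.1 hz n)

lemma nullMeasurableSet_Kinf (hK : ∀ n, IsFundamental R (K n)) :
    NullMeasurableSet (fin (Kinf K)) := by
  have : fin (Kinf K) = ⋂ n, fin (K n) := by
    ext z; simp [mem_fin_Kinf]
  rw [this]
  exact NullMeasurableSet.iInter fun n => (hK n).measurable

lemma mem_shell {z : ℂ} (hz : z ∈ regularPts R) (n : ℕ) :
    z ∈ shell R K n ↔ fC R z ∈ fin (K n) ∧ fC R z ∉ fin (Kinf K) ∧ z ∉ fin (K n) := by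
  have h1 : z ∈ shell R K n ↔ z ∈ fin (primed R (K n)) ∧ z ∉ fin (primed R (Kinf K)) := Iff.rfl
  rw [h1, mem_fin_primed hz, mem_fin_primed hz]
  have : z ∈ fin (Kinf K) → z ∈ fin (K n) := fun h => mem_fin_Kinf.1 h n
  tauto

lemma shell_subset (n : ℕ) : shell R K n ⊆ fin (primed R (K n)) := fun _ h => h.1

lemma isWandering_shell (hK : ∀ n, IsFundamental R (K n)) (n : ℕ) :
    IsWandering R (shell R K n) :=
  (isWandering_primed (hK n).mapsTo).mono (shell_subset n)

lemma nullMeasurableSet_shell (hR : R.denom.natDegree < R.num.natDegree)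
    (hK : ∀ n, IsFundamental R (K n)) (n : ℕ) : NullMeasurableSet (shell R K n) :=
  (nullMeasurableSet_primed hR (hK n).measurable).diff
    (nullMeasurableSet_primed hR (nullMeasurableSet_Kinf hK))

lemma eventually_notMem_diff_Kinf (hanti : Antitone K) (z : ℂ) :
    ∀ᶠ n in atTop, z ∈ fin (K n) → z ∈ fin (Kinf K) := by
  by_cases h : z ∈ fin (Kinf K)
  · exact Eventually.of_forall fun _ _ => h
  · rw [mem_fin_Kinf] at h
    push Not at h
    obtain ⟨N, hN⟩ := h
    filter_upwards [eventually_ge_atTop N] with n hn hz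
    exact absurd (hanti hn hz) hN

lemma eventually_notMem_shell (hanti : Antitone K) {z : ℂ} (hz : z ∈ regularPts R) :
    ∀ᶠ n in atTop, z ∉ shell R K n := by
  filter_upwards [eventually_notMem_diff_Kinf hanti (fC R z)] with n hn h
  rw [mem_shell hz] at h
  exact h.2.1 (hn h.1)

/-- An orbit that is absorbed by `K_∞` eventually misses the shells. -/
lemma eventually_iterate_notMem_shell (hK : ∀ n, IsFundamental R (K n)) (hanti : Antitone K)
    {z : ℂ} (hz : z ∈ regularPts R) (hb : z ∈ fin (backward R (Kinf K))) :
    ∀ᶠ n in atTop, ∀ i : ℕ, (fC R)^[i] z ∉ shell R K n := by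
  obtain ⟨m, hm⟩ := (mem_fin_backward hz).1 hb
  have h1 : ∀ᶠ n in atTop, ∀ i ∈ Finset.range m, (fC R)^[i] z ∉ shell R K n :=
    (Filter.eventually_all_finset _).2 fun i _ =>
      eventually_notMem_shell hanti (iterate_fC_mem_regularPts hz i)
  filter_upwards [h1] with n hn i
  by_cases him : i < m
  · exact hn i (Finset.mem_range.2 him)
  · intro h
    rw [mem_shell (iterate_fC_mem_regularPts hz i)] at h
    exact h.2.2 (mem_fin_Kinf.1 (iterate_mem_fin_of_le (mapsTo_Kinf fun n => (hK n).mapsTo) hz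
      (not_lt.1 him) hm) n)

lemma σn_eq_spread {z : ℂ} (hz : z ∈ regularPts R) (v : ℂ) (n : ℕ) :
    σn R K v n z = spread R (shell R K n) (σ R v) z := by
  classical
  have h : ∀ i : ℕ, (toMap R)^[i] (z : OnePoint ℂ) ∈ primed R (K n) \ primed R (Kinf K) ↔
      (fC R)^[i] z ∈ shell R K n := fun i => by
    rw [iterate_toMap_coe hz]
    rfl
  simp only [σn, spread, h]

lemma norm_σ_le (v x : ℂ) : ‖σ R v x‖ ≤ 1 := by
  rw [σ, norm_div, Complex.norm_real, norm_norm]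
  exact div_self_le_one _

lemma σ_mul_r (v x : ℂ) : σ R v x * r R v x = ‖r R v x‖ := by
  by_cases h : r R v x = 0
  · simp [h]
  · rw [σ, div_mul_cancel₀ _ h]

lemma norm_indicator_σ_le (v : ℂ) (A : Set ℂ) (x : ℂ) : ‖A.indicator (σ R v) x‖ ≤ 1 :=
  (norm_indicator_le_norm_self _ _).trans (norm_σ_le v x)

lemma aemeasurable_indicator_σ {A : Set ℂ} (hA : NullMeasurableSet A) {v : ℂ}
    (hr : IntegrableOn (r R v) A) : AEMeasurable (A.indicator (σ R v)) volume := by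
  refine (aemeasurable_indicator_iff₀ hA).2 ?_
  have h := hr.aestronglyMeasurable.aemeasurable
  exact (Complex.measurable_ofReal.comp_aemeasurable h.norm).div h

end

/-! ### Integrable functions with finitely many singularities -/

section

variable {R : RatFunc ℂ}

/-- The hypothesis of Mathlib's removable singularity theorem, from the usual one. -/
lemma isLittleO_of_tendsto_sub_mul {G : ℂ → ℂ} {s : ℂ}
    (h : Tendsto (fun x => (x - s) * G x) (𝓝[≠] s) (𝓝 0)) :
    (fun z => G z - G s) =o[𝓝[≠] s] fun z => (z - s)⁻¹ := by
  refine (Asymptotics.isLittleO_iff_tendsto' ?_).2 ?_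
  · filter_upwards [self_mem_nhdsWithin] with z hz h0
    exact absurd h0 (inv_ne_zero (sub_ne_zero.2 hz))
  · have h1 : Tendsto (fun x : ℂ => (x - s) * G s) (𝓝[≠] s) (𝓝 0) := by
      have : Tendsto (fun x : ℂ => (x - s) * G s) (𝓝 s) (𝓝 ((s - s) * G s)) :=
        Continuous.tendsto (by fun_prop) s
      rw [sub_self, zero_mul] at this
      exact this.mono_left nhdsWithin_le_nhds
    have h2 := h.sub h1
    rw [sub_zero] at h2
    refine h2.congr fun x => ?_
    rw [div_inv_eq_mul]
    ring

/-- Liouville's theorem with removable singularities. -/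
lemma eq_zero_of_removable_of_tendsto (S : Finset ℂ) : ∀ {G : ℂ → ℂ},
    (∀ x ∉ S, DifferentiableAt ℂ G x) →
    (∀ s ∈ S, Tendsto (fun x => (x - s) * G x) (𝓝[≠] s) (𝓝 0)) →
    Tendsto G (cocompact ℂ) (𝓝 0) → ∀ x ∉ S, G x = 0 := by
  induction S using Finset.induction_on with
  | empty =>
    intro G hd _ hlim x _
    exact Differentiable.apply_eq_of_tendsto_cocompact (fun x => hd x (by simp)) x hlim
  | insert a S ha ih =>
    intro G hd hs hlim x hx
    set G' := Function.update G a (limUnder (𝓝[≠] a) G)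
    have hne : ∀ {y}, y ≠ a → G' y = G y := fun h => Function.update_of_ne h _ _
    have hev : ∀ {y}, y ≠ a → G' =ᶠ[𝓝 y] G := fun {y} h =>
      (isOpen_ne.mem_nhds h : {a}ᶜ ∈ 𝓝 y) |> fun h' => by
        filter_upwards [h'] with z hz using hne hz
    have hx' : x ≠ a := fun h => hx (h ▸ Finset.mem_insert_self _ _)
    rw [← hne hx']
    refine ih (G := G') (fun y hy => ?_) (fun s hsS => ?_) ?_ x
      (fun h => hx (Finset.mem_insert_of_mem h))
    · by_cases hya : y = a
      · subst hya
        have hU : ((S : Set ℂ))ᶜ ∈ 𝓝 y := S.finite_toSet.isClosed.isOpen_compl.mem_nhds hy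
        refine (Complex.differentiableOn_update_limUnder_of_isLittleO hU (fun z hz => ?_)
          (isLittleO_of_tendsto_sub_mul
            (hs y (Finset.mem_insert_self _ _)))).differentiableAt hU
        refine (hd z fun h => ?_).differentiableWithinAt
        rcases Finset.mem_insert.1 h with h | h
        · exact hz.2 h
        · exact hz.1 h
      · refine (hd y fun h => ?_).congr_of_eventuallyEq (hev hya)
        rcases Finset.mem_insert.1 h with h | h
        · exact hya h
        · exact hy h
    · have hsa : s ≠ a := fun h => ha (h ▸ hsS)
      refine (hs s (Finset.mem_insert_of_mem hsS)).congr' ?_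
      filter_upwards [nhdsWithin_le_nhds (hev hsa)] with z hz
      rw [hz]
    · refine hlim.congr' ?_
      filter_upwards [(isCompact_singleton (x := a)).compl_mem_cocompact] with z hz
      exact (hne hz).symm

lemma eventually_ball_disjoint_of_finset (S : Finset ℂ) (s : ℂ) :
    ∀ᶠ x in 𝓝[≠] s, ∀ y ∈ Metric.closedBall x (‖x - s‖ / 2), y ∉ S := by
  have hU : ((S.erase s : Finset ℂ) : Set ℂ)ᶜ ∈ 𝓝 s :=
    (S.erase s).finite_toSet.isClosed.isOpen_compl.mem_nhds (by simp)
  obtain ⟨ε, hε, hb⟩ := Metric.mem_nhds_iff.1 hU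
  filter_upwards [nhdsWithin_le_nhds (Metric.ball_mem_nhds s (half_pos hε)),
    self_mem_nhdsWithin] with x hx hne y hy hyS
  rw [mem_ball_iff_norm] at hx
  rw [mem_closedBall_iff_norm] at hy
  have hxs : 0 < ‖x - s‖ := norm_pos_iff.2 (sub_ne_zero.2 hne)
  have hys : y ≠ s := by
    rintro rfl
    rw [norm_sub_rev] at hy
    linarith
  refine hb ?_ (Finset.mem_coe.2 (Finset.mem_erase.2 ⟨hys, hyS⟩))
  rw [mem_ball_iff_norm]
  calc ‖y - s‖ = ‖(y - x) + (x - s)‖ := by ring_nf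
    _ ≤ ‖y - x‖ + ‖x - s‖ := norm_add_le _ _
    _ < ε := by linarith

/-- The area mean value inequality on a disc that avoids the singularities, in scale-invariant
form. -/
lemma sq_mul_norm_le_integral {D : ℂ → ℂ} {S : Finset ℂ} (hd : ∀ x ∉ S, DifferentiableAt ℂ D x)
    {x : ℂ} {ρ : ℝ} (hρ : 0 < ρ) (h : ∀ y ∈ Metric.closedBall x (ρ / 2), y ∉ S) :
    ρ ^ 2 * ‖D x‖ ≤ 4 / Real.pi * ∫ y in Metric.closedBall x (ρ / 2), ‖D y‖ := by
  have h1 := norm_le_integral_ball (half_pos hρ) (h := D) (c := x)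
    (DifferentiableOn.diffContOnCl (by
      rw [closure_ball x (half_pos hρ).ne']
      exact fun y hy => (hd y (h y hy)).differentiableWithinAt))
  have hpi := Real.pi_pos
  rw [div_mul_eq_mul_div, le_div_iff₀ hpi]
  calc ρ ^ 2 * ‖D x‖ * Real.pi = 4 * (Real.pi * (ρ / 2) ^ 2 * ‖D x‖) := by ring
    _ ≤ _ := by gcongr

/-- An integrable holomorphic function grows slower than a double pole. -/
lemma tendsto_sq_mul_of_integrable {D : ℂ → ℂ} (hD : Integrable D) (S : Finset ℂ)
    (hd : ∀ x ∉ S, DifferentiableAt ℂ D x) (s : ℂ) :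
    Tendsto (fun x => (x - s) * ((x - s) * D x)) (𝓝[≠] s) (𝓝 0) := by
  have h0 : Tendsto (fun x : ℂ => volume (Metric.closedBall x (‖x - s‖ / 2))) (𝓝[≠] s) (𝓝 0) := by
    simp_rw [Complex.volume_closedBall]
    have : Tendsto (fun x : ℂ => ENNReal.ofReal (‖x - s‖ / 2) ^ 2 * NNReal.pi) (𝓝 s)
        (𝓝 (ENNReal.ofReal (‖s - s‖ / 2) ^ 2 * NNReal.pi)) := by
      refine ENNReal.Tendsto.mul_const (ENNReal.Tendsto.pow ?_) (Or.inr ENNReal.coe_ne_top)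
      exact ENNReal.tendsto_ofReal (Continuous.tendsto (by fun_prop) s)
    simp only [sub_self, norm_zero, zero_div, ENNReal.ofReal_zero] at this
    rw [zero_pow two_ne_zero, zero_mul] at this
    exact this.mono_left nhdsWithin_le_nhds
  have h1 := (hD.norm.tendsto_setIntegral_nhds_zero h0).const_mul (4 / Real.pi)
  rw [mul_zero] at h1
  refine squeeze_zero_norm' ?_ h1
  filter_upwards [eventually_ball_disjoint_of_finset S s, self_mem_nhdsWithin] with x hx hne
  rw [norm_mul, norm_mul, ← mul_assoc, ← sq]
  exact sq_mul_norm_le_integral hd (norm_pos_iff.2 (sub_ne_zero.2 hne)) hx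

/-- An integrable function that is holomorphic near infinity is `o(|x|^{-2})` there. -/
lemma tendsto_sq_mul_cocompact_of_integrable {D : ℂ → ℂ} (hD : Integrable D) (S : Finset ℂ)
    (hd : ∀ x ∉ S, DifferentiableAt ℂ D x) :
    Tendsto (fun x => ‖x‖ ^ 2 * ‖D x‖) (cocompact ℂ) (𝓝 0) := by
  rw [← Metric.cobounded_eq_cocompact]
  have : (Bornology.cobounded ℂ).IsCountablyGenerated := by
    rw [← comap_norm_atTop]
    infer_instance
  have h0 : Tendsto (fun x : ℂ => ∫ y in Metric.closedBall x (‖x‖ / 2), ‖D y‖)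
      (Bornology.cobounded ℂ) (𝓝 0) := by
    have := tendsto_integral_filter_of_dominated_convergence (μ := (volume : Measure ℂ))
      (l := Bornology.cobounded ℂ) (f := fun _ => (0 : ℝ))
      (F := fun x y => (Metric.closedBall x (‖x‖ / 2)).indicator (fun y => ‖D y‖) y)
      (fun y => ‖D y‖) (Eventually.of_forall fun x =>
        (hD.norm.indicator Metric.isClosed_closedBall.measurableSet).aestronglyMeasurable)
      (Eventually.of_forall fun x => Eventually.of_forall fun y => by
        refine (norm_indicator_le_norm_self _ _).trans (by simp)) hD.norm
      (Eventually.of_forall fun y => by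
        refine tendsto_const_nhds.congr' ?_
        filter_upwards [(tendsto_norm_cobounded_atTop (E := ℂ)).eventually_gt_atTop (2 * ‖y‖)]
          with x hx
        rw [indicator_of_notMem]
        rw [mem_closedBall_iff_norm, norm_sub_rev]
        have := norm_sub_norm_le x y
        intro h
        linarith)
    simp only [integral_zero] at this
    refine this.congr fun x => ?_
    rw [integral_indicator Metric.isClosed_closedBall.measurableSet]
  have h1 := h0.const_mul (4 / Real.pi)
  rw [mul_zero] at h1
  refine squeeze_zero' (Eventually.of_forall fun x => by positivity) ?_ h1
  obtain ⟨M, hM⟩ := S.finite_toSet.isBounded.exists_norm_le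
  filter_upwards [(tendsto_norm_cobounded_atTop (E := ℂ)).eventually_gt_atTop (2 * M),
    (tendsto_norm_cobounded_atTop (E := ℂ)).eventually_gt_atTop 0] with x hx hx0
  refine sq_mul_norm_le_integral hd hx0 fun y hy hyS => ?_
  have h2 := hM y hyS
  rw [mem_closedBall_iff_norm, norm_sub_rev] at hy
  have := norm_sub_norm_le x y
  linarith

/-- An integrable function that is holomorphic off a finite set is a combination of kernels. -/
lemma exists_eq_sum_ψ {Q : ℂ → ℂ} (hQ : Integrable Q) (S : Finset ℂ)
    (hd : ∀ x ∉ S, DifferentiableAt ℂ Q x) (h0S : (0 : ℂ) ∈ S) (h1S : (1 : ℂ) ∈ S) :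
    ∃ c : ℂ → ℂ, (∀ s, Tendsto (fun x => (x - s) * Q x) (𝓝[≠] s) (𝓝 (c s))) ∧
      ∀ x ∉ S, Q x = ∑ s ∈ S, c s * ψ s x := by
  classical
  have hfin : ∀ s : ℂ, ∀ᶠ x in 𝓝[≠] s, x ∉ S := fun s => by
    filter_upwards [eventually_ball_disjoint_of_finset S s] with x hx
    exact hx x (Metric.mem_closedBall_self (by positivity))
  have hlim : ∀ s, ∃ c, Tendsto (fun x => (x - s) * Q x) (𝓝[≠] s) (𝓝 c) := fun s =>
    ⟨_, Complex.tendsto_limUnder_of_differentiable_on_punctured_nhds_of_isLittleO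
      (by
        filter_upwards [hfin s] with x hx
        exact (differentiableAt_id.sub_const s).mul (hd x hx))
      (isLittleO_of_tendsto_sub_mul (tendsto_sq_mul_of_integrable hQ S hd s))⟩
  choose c hc using hlim
  refine ⟨c, hc, ?_⟩
  -- an integrable function has no double poles, so subtracting the residues leaves only simple
  -- poles at `0` and `1`
  set D : ℂ → ℂ := fun x => Q x - ∑ s ∈ S, c s * ψ s x with hDdef
  have hDi : Integrable D :=
    hQ.sub (integrable_finsetSum _ fun s _ => (integrable_ψ s).const_mul (c s))
  have hψd : ∀ x ∉ S, ∀ s ∈ S, DifferentiableAt ℂ (ψ s) x := fun x hx s hs =>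
    (hasDerivAt_ψ s (x := x) (fun h => hx (h ▸ h0S)) (fun h => hx (h ▸ h1S))
      (fun h => hx (h ▸ hs))).differentiableAt
  have hDd : ∀ x ∉ S, DifferentiableAt ℂ D x := fun x hx =>
    (hd x hx).sub (DifferentiableAt.fun_sum fun s hs => (hψd x hx s hs).const_mul _)
  -- the function `x (x - 1) D` extends to an entire function that vanishes at infinity
  have hG := eq_zero_of_removable_of_tendsto S (G := fun x => x * (x - 1) * D x)
    (fun x hx => (differentiableAt_id.mul (differentiableAt_id.sub_const 1)).mul (hDd x hx)) ?_ ?_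
  · intro x hx
    have h := hG x hx
    have hx0 : x ≠ 0 := fun h => hx (h ▸ h0S)
    have hx1 : x - 1 ≠ 0 := sub_ne_zero.2 fun h => hx (h ▸ h1S)
    exact sub_eq_zero.1 ((mul_eq_zero.1 h).resolve_left (mul_ne_zero hx0 hx1))
  · intro s hs
    have hcont : ∀ {g : ℂ → ℂ}, Continuous g → Tendsto g (𝓝[≠] s) (𝓝 (g s)) := fun hg =>
      (hg.tendsto s).mono_left nhdsWithin_le_nhds
    have hsq := tendsto_sq_mul_of_integrable hDi S hDd s
    by_cases h0 : s = 0
    · subst h0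
      have := hsq.mul (hcont (g := fun x => x - 1) (by fun_prop))
      rw [zero_mul] at this
      refine this.congr fun x => ?_
      ring
    by_cases h1 : s = 1
    · subst h1
      have := hsq.mul (hcont (g := fun x => x) (by fun_prop))
      rw [zero_mul] at this
      refine this.congr fun x => ?_
      ring
    have hpole : Tendsto (fun x => (x - s) * ψ s x) (𝓝[≠] s) (𝓝 1) := by
      have h2 : ContinuousAt (fun x : ℂ => s * (s - 1) / (x * (x - 1))) s := by
        refine ContinuousAt.div (by fun_prop) (by fun_prop) (mul_ne_zero h0 (sub_ne_zero.2 h1))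
      have h3 := h2.tendsto.mono_left (nhdsWithin_le_nhds (s := {s}ᶜ))
      rw [div_self (mul_ne_zero h0 (sub_ne_zero.2 h1))] at h3
      refine h3.congr' ?_
      filter_upwards [self_mem_nhdsWithin] with x hx
      have hx' := sub_ne_zero.2 hx
      rw [ψ, mul_div_assoc']
      rw [mul_comm (x - s), mul_div_mul_right _ _ hx']
    have hrest : ∀ t ∈ S.erase s, Tendsto (fun x => (x - s) * (c t * ψ t x)) (𝓝[≠] s) (𝓝 0) := by
      intro t ht
      have hts := (Finset.mem_erase.1 ht).1
      have h2 : ContinuousAt (fun x => (x - s) * (c t * ψ t x)) s := by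
        have := (hasDerivAt_ψ t h0 h1 hts.symm).continuousAt
        fun_prop
      have h3 := h2.tendsto.mono_left (nhdsWithin_le_nhds (s := {s}ᶜ))
      simpa using h3
    have hDs : Tendsto (fun x => (x - s) * D x) (𝓝[≠] s) (𝓝 0) := by
      have := ((hc s).sub (hpole.const_mul (c s))).sub (tendsto_finsetSum _ hrest)
      simp only [mul_one, sub_self, Finset.sum_const_zero] at this
      refine this.congr fun x => ?_
      simp only [hDdef]
      rw [← Finset.add_sum_erase S _ hs, ← Finset.mul_sum]
      ring
    have := (hcont (g := fun x => x * (x - 1)) (by fun_prop)).mul hDs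
    rw [mul_zero] at this
    refine this.congr fun x => ?_
    ring
  · have h1 := (tendsto_sq_mul_cocompact_of_integrable hDi S hDd).const_mul 2
    rw [mul_zero] at h1
    refine squeeze_zero_norm' ?_ h1
    rw [← Metric.cobounded_eq_cocompact]
    filter_upwards [(tendsto_norm_cobounded_atTop (E := ℂ)).eventually_gt_atTop 1] with x hx
    have h2 : ‖x - 1‖ ≤ 2 * ‖x‖ := (norm_sub_le _ _).trans (by rw [norm_one]; linarith)
    rw [norm_mul, norm_mul]
    calc ‖x‖ * ‖x - 1‖ * ‖D x‖ ≤ ‖x‖ * (2 * ‖x‖) * ‖D x‖ := by gcongr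
      _ = _ := by ring

/-! ### The transfer operator on the kernels -/

/-- The finite set of possible poles of `T ψ_z`. -/
def poles (hR : R.denom.natDegree < R.num.natDegree) (hinf : toMap R ∞ = ∞) : Finset ℂ :=
  insert 0 (insert 1 (finite_critValues hR hinf).toFinset)

/-- The pole of `T ψ_z` at `f(z)` is simple with residue `1 / f'(z)`. -/
lemma tendsto_sub_mul_T_ψ (hR : R.denom.natDegree < R.num.natDegree) (hinf : toMap R ∞ = ∞)
    (hone : toMap R ((1 : ℂ) : OnePoint ℂ) = ((1 : ℂ) : OnePoint ℂ))
    (hzero : toMap R ((0 : ℂ) : OnePoint ℂ) = ((0 : ℂ) : OnePoint ℂ))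
    {z : ℂ} (hz : R.denom.eval z ≠ 0) (hfz : fC R z ∉ poles hR hinf) :
    Tendsto (fun x => (x - fC R z) * T R (ψ z) x) (𝓝[≠] (fC R z)) (𝓝 (1 / fD R z)) := by
  set w := fC R z with hw
  simp only [poles, Finset.mem_insert, not_or, Finite.mem_toFinset] at hfz
  obtain ⟨hw0, hw1, hwv⟩ := hfz
  have hopen : (critValues R)ᶜ ∈ 𝓝 w :=
    (finite_critValues hR hinf).isClosed.isOpen_compl.mem_nhds hwv
  obtain ⟨ρ, hρ, hb⟩ := Metric.mem_nhds_iff.1 hopen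
  obtain ⟨u, hu0, hu1, hu2, hu3, hT⟩ := exists_lifts hR hinf hρ (c := w) (g := id)
    differentiableOn_id (fun x hx => hb hx)
  have hwb : w ∈ Metric.ball w ρ := Metric.mem_ball_self hρ
  have hzmem : z ∈ (finite_fibre hR (id w)).toFinset :=
    (Finite.mem_toFinset _).2 (mem_fibre_fC hz)
  have hev : (fun x => (x - w) * T R (ψ z) x) =ᶠ[𝓝[≠] w] fun x =>
      ∑ k, (x - w) * (ψ z (u k x) / fD R (u k x) ^ 2) := by
    filter_upwards [nhdsWithin_le_nhds (Metric.ball_mem_nhds w hρ)] with x hx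
    rw [← Finset.mul_sum, ← hT x hx, id]
  refine Tendsto.congr' hev.symm ?_
  have hk0 : ∀ k : ↥(finite_fibre hR (id w)).toFinset, (k : ℂ) ≠ 0 ∧ (k : ℂ) ≠ 1 ∧
      R.denom.eval (k : ℂ) ≠ 0 ∧ fD R k ≠ 0 := by
    intro k
    have hk : (k : ℂ) ∈ fibre R w := (Finite.mem_toFinset _).1 k.2
    have hk' : toMap R ((k : ℂ) : OnePoint ℂ) = (w : OnePoint ℂ) := hk
    refine ⟨fun h => hw0 ?_, fun h => hw1 ?_, denom_ne_zero_of_mem_fibre hk,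
      fD_ne_zero_of_notMem hk hwv⟩
    · rw [h, hzero] at hk'
      exact (OnePoint.coe_injective hk').symm
    · rw [h, hone] at hk'
      exact (OnePoint.coe_injective hk').symm
  have hcu : ∀ k, Tendsto (u k) (𝓝[≠] w) (𝓝 (k : ℂ)) := fun k => by
    have := ((hu1 k w hwb).continuousAt.tendsto).mono_left (nhdsWithin_le_nhds (s := {w}ᶜ))
    rwa [hu0 k] at this
  have hcD : ∀ k, Tendsto (fun x => fD R (u k x) ^ 2) (𝓝[≠] w) (𝓝 (fD R k ^ 2)) := fun k =>
    ((((differentiableOn_fD (R := R)).differentiableAt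
      (isOpen_denom_ne.mem_nhds (hk0 k).2.2.1)).continuousAt.tendsto).comp (hcu k)).pow 2
  have hxw : Tendsto (fun x => x - w) (𝓝[≠] w) (𝓝 0) := by
    have : Tendsto (fun x => x - w) (𝓝 w) (𝓝 (w - w)) := Continuous.tendsto (by fun_prop) w
    rw [sub_self] at this
    exact this.mono_left nhdsWithin_le_nhds
  -- only the branch of `f⁻¹` through `z` contributes to the pole
  have hterm : ∀ k : ↥(finite_fibre hR (id w)).toFinset,
      Tendsto (fun x => (x - w) * (ψ z (u k x) / fD R (u k x) ^ 2)) (𝓝[≠] w)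
        (𝓝 (if k = ⟨z, hzmem⟩ then 1 / fD R z else 0)) := by
    intro k
    by_cases hkz : k = ⟨z, hzmem⟩
    · rw [if_pos hkz]
      subst hkz
      set k : ↥(finite_fibre hR (id w)).toFinset := ⟨z, hzmem⟩
      obtain ⟨z0, z1, -, zD⟩ := hk0 k
      have zD' : fD R z ≠ 0 := zD
      have hder := hu1 k w hwb
      rw [deriv_id, hu0 k] at hder
      have hslope := hasDerivAt_iff_tendsto_slope.1 hder
      have h1 : Tendsto (fun x => (x - w) / (u k x - z)) (𝓝[≠] w) (𝓝 (fD R z)) := by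
        have := hslope.inv₀ (div_ne_zero one_ne_zero zD)
        simp only [one_div, inv_inv] at this
        refine this.congr fun x => ?_
        rw [slope_def_field, inv_div, hu0 k]
      have h2 : Tendsto (fun x => z * (z - 1) / (u k x * (u k x - 1))) (𝓝[≠] w) (𝓝 1) := by
        have hne : z * (z - 1) ≠ 0 := mul_ne_zero z0 (sub_ne_zero.2 z1)
        have := (tendsto_const_nhds (x := z * (z - 1))).div
          ((hcu k).mul ((hcu k).sub_const 1)) hne
        rwa [show (k : ℂ) = z from rfl, div_self hne] at this
      have h3 := (h1.mul h2).div (hcD k) (pow_ne_zero 2 zD)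
      have e : fD R z * 1 / fD R (k : ℂ) ^ 2 = 1 / fD R z := by
        rw [show (k : ℂ) = z from rfl]
        field_simp
      rw [e] at h3
      refine h3.congr fun x => ?_
      simp only [ψ, Pi.div_apply, div_eq_mul_inv, mul_inv]
      ring
    · rw [if_neg hkz]
      have hkz' : (k : ℂ) ≠ z := fun h => hkz (Subtype.ext h)
      obtain ⟨z0, z1, -, zD⟩ := hk0 k
      have h1 := (((hasDerivAt_ψ z z0 z1 hkz').continuousAt.tendsto.comp (hcu k)).div (hcD k)
        (pow_ne_zero 2 zD))
      have := hxw.mul h1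
      rwa [zero_mul] at this
  have := tendsto_finsetSum Finset.univ fun k _ => hterm k
  simpa using this

/-- The transfer operator maps `ψ_z` to `ψ_{f(z)} / f'(z)` up to kernels at critical values. -/
lemma exists_T_ψ_eq (hR : R.denom.natDegree < R.num.natDegree) (hinf : toMap R ∞ = ∞)
    (hone : toMap R ((1 : ℂ) : OnePoint ℂ) = ((1 : ℂ) : OnePoint ℂ))
    (hzero : toMap R ((0 : ℂ) : OnePoint ℂ) = ((0 : ℂ) : OnePoint ℂ))
    {z : ℂ} (hz : R.denom.eval z ≠ 0) (hfz : fC R z ∉ poles hR hinf) :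
    ∃ c : ℂ → ℂ, ∀ᵐ x : ℂ, T R (ψ z) x = ψ (fC R z) x / fD R z +
      ∑ s ∈ (finite_critValues hR hinf).toFinset, c s * ψ s x := by
  classical
  set V := (finite_critValues hR hinf).toFinset
  have hd : ∀ x ∉ insert (fC R z) (poles hR hinf), DifferentiableAt ℂ (T R (ψ z)) x := by
    intro x hx
    have hW : IsOpen ((insert (fC R z) (poles hR hinf) : Finset ℂ) : Set ℂ)ᶜ :=
      (Finset.finite_toSet _).isClosed.isOpen_compl
    refine differentiableAt_T hR hinf hW (fun y hy hyv => hy ?_) (fun y hy t ht => ?_) hx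
    · simp [poles, hyv]
    · have ht' : toMap R (t : OnePoint ℂ) = (y : OnePoint ℂ) := ht
      refine (hasDerivAt_ψ z (fun h => hy ?_) (fun h => hy ?_) (fun h => hy ?_)).differentiableAt
      · rw [h, hzero] at ht'
        simp [poles, ← OnePoint.coe_injective ht']
      · rw [h, hone] at ht'
        simp [poles, ← OnePoint.coe_injective ht']
      · rw [h] at ht
        simp [fC_of_mem_fibre ht]
  obtain ⟨c, hc, heq⟩ := exists_eq_sum_ψ (integrable_T hR (integrable_ψ z)) _ hd
    (by simp [poles]) (by simp [poles])
  have hcz : c (fC R z) = 1 / fD R z :=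
    tendsto_nhds_unique (hc _) (tendsto_sub_mul_T_ψ hR hinf hone hzero hz hfz)
  -- `ψ_0 = ψ_1 = 0`, so the possible poles at `0` and `1` contribute nothing
  have hsum : ∀ x, ∑ s ∈ poles hR hinf, c s * ψ s x = ∑ s ∈ V, c s * ψ s x := by
    intro x
    refine (Finset.sum_subset (fun s hs => ?_) fun s hs hsV => ?_).symm
    · exact Finset.mem_insert_of_mem (Finset.mem_insert_of_mem hs)
    · rcases Finset.mem_insert.1 hs with rfl | hs
      · rw [ψ_zero, mul_zero]
      rcases Finset.mem_insert.1 hs with rfl | hs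
      · rw [ψ_one, mul_zero]
      · exact absurd hs hsV
  refine ⟨c, ?_⟩
  filter_upwards [compl_mem_ae_iff.2 ((insert (fC R z) (poles hR hinf)).finite_toSet.measure_zero
    volume)] with x hx
  rw [heq x hx, Finset.sum_insert hfz, hcz, hsum, one_div_mul_eq_div]

end

/-! ### The stereographic embedding and equicontinuity -/

section

variable {R : RatFunc ℂ}

/-- The horizontal part of the stereographic embedding of the sphere. -/
def stereoFst : OnePoint ℂ → ℂ
  | ∞ => 0
  | (z : ℂ) => 2 * z / ((1 + ‖z‖ ^ 2 : ℝ) : ℂ)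

/-- The (shifted) vertical part of the stereographic embedding of the sphere. -/
def stereoSnd : OnePoint ℂ → ℂ
  | ∞ => 0
  | (z : ℂ) => 2 / ((1 + ‖z‖ ^ 2 : ℝ) : ℂ)

lemma stereoFst_coe (z : ℂ) : stereoFst z = 2 * z / ((1 + ‖z‖ ^ 2 : ℝ) : ℂ) := rfl
lemma stereoSnd_coe (z : ℂ) : stereoSnd z = 2 / ((1 + ‖z‖ ^ 2 : ℝ) : ℂ) := rfl
lemma stereoFst_infty : stereoFst ∞ = 0 := rfl
lemma stereoSnd_infty : stereoSnd ∞ = 0 := rfl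

lemma one_add_sq_ne (z : ℂ) : ((1 + ‖z‖ ^ 2 : ℝ) : ℂ) ≠ 0 :=
  Complex.ofReal_ne_zero.2 (by positivity)

lemma continuous_stereoFst : Continuous stereoFst := by
  refine (OnePoint.continuous_iff _).2 ⟨?_, ?_⟩
  · rw [coclosedCompact_eq_cocompact, ← Metric.cobounded_eq_cocompact, stereoFst_infty]
    have h := (tendsto_inv_atTop_zero.comp (tendsto_norm_cobounded_atTop (E := ℂ))).const_mul 2
    rw [mul_zero] at h
    refine squeeze_zero_norm' ?_ h
    filter_upwards [(tendsto_norm_cobounded_atTop (E := ℂ)).eventually_gt_atTop 0] with x hx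
    rw [stereoFst_coe, norm_div, norm_mul, Complex.norm_real, Complex.norm_ofNat,
      Real.norm_of_nonneg (by positivity), div_le_iff₀ (by positivity)]
    simp only [Function.comp]
    have : ‖x‖⁻¹ * ‖x‖ = 1 := inv_mul_cancel₀ hx.ne'
    have h2 : 0 < ‖x‖⁻¹ := inv_pos.2 hx
    nlinarith
  · simp only [stereoFst_coe]
    exact Continuous.div (by fun_prop) (by fun_prop) one_add_sq_ne

lemma continuous_stereoSnd : Continuous stereoSnd := by
  refine (OnePoint.continuous_iff _).2 ⟨?_, ?_⟩
  · rw [coclosedCompact_eq_cocompact, ← Metric.cobounded_eq_cocompact, stereoSnd_infty]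
    have h := (tendsto_inv_atTop_zero.comp (tendsto_norm_cobounded_atTop (E := ℂ))).const_mul 2
    rw [mul_zero] at h
    refine squeeze_zero_norm' ?_ h
    filter_upwards [(tendsto_norm_cobounded_atTop (E := ℂ)).eventually_gt_atTop 0] with x hx
    rw [stereoSnd_coe, norm_div, Complex.norm_real, Complex.norm_ofNat,
      Real.norm_of_nonneg (by positivity), div_le_iff₀ (by positivity)]
    simp only [Function.comp]
    have : ‖x‖⁻¹ * ‖x‖ = 1 := inv_mul_cancel₀ hx.ne'
    have h2 : 0 < ‖x‖⁻¹ := inv_pos.2 hx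
    nlinarith [sq_nonneg (‖x‖ - 1)]
  · simp only [stereoSnd_coe]
    exact Continuous.div (by fun_prop) (by fun_prop) one_add_sq_ne

/-- The chordal distance is the Euclidean distance of the stereographic images. -/
lemma chordal_sq (a b : OnePoint ℂ) : chordal a b ^ 2 =
    ‖stereoFst a - stereoFst b‖ ^ 2 + ‖stereoSnd a - stereoSnd b‖ ^ 2 := by
  have hsq : ∀ w : ℂ, √(1 + ‖w‖ ^ 2) ^ 2 = 1 + ‖w‖ ^ 2 := fun w => Real.sq_sqrt (by positivity)
  have hn : ∀ w : ℂ, ‖((1 + ‖w‖ ^ 2 : ℝ) : ℂ)‖ = 1 + ‖w‖ ^ 2 := fun w => by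
    rw [Complex.norm_real, Real.norm_of_nonneg (by positivity)]
  induction a using OnePoint.rec with
  | infty =>
    induction b using OnePoint.rec with
    | infty => simp [chordal, stereoFst_infty, stereoSnd_infty]
    | coe w =>
      have h : chordal ∞ (w : OnePoint ℂ) = 2 / √(1 + ‖w‖ ^ 2) := rfl
      have : (1 + ‖w‖ ^ 2) ≠ 0 := by positivity
      rw [h, stereoFst_infty, stereoSnd_infty, stereoFst_coe, stereoSnd_coe, zero_sub, zero_sub,
        norm_neg, norm_neg, norm_div, norm_div, norm_mul, hn, Complex.norm_ofNat, div_pow, hsq]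
      field_simp
      ring
  | coe z =>
    induction b using OnePoint.rec with
    | infty =>
      have h : chordal (z : OnePoint ℂ) ∞ = 2 / √(1 + ‖z‖ ^ 2) := rfl
      have : (1 + ‖z‖ ^ 2) ≠ 0 := by positivity
      rw [h, stereoFst_infty, stereoSnd_infty, stereoFst_coe, stereoSnd_coe, sub_zero, sub_zero,
        norm_div, norm_div, norm_mul, hn, Complex.norm_ofNat, div_pow, hsq]
      field_simp
      ring
    | coe w =>
      have h : chordal (z : OnePoint ℂ) (w : OnePoint ℂ) =
        2 * ‖z - w‖ / (√(1 + ‖z‖ ^ 2) * √(1 + ‖w‖ ^ 2)) := rfl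
      rw [h, stereoFst_coe, stereoSnd_coe, stereoFst_coe, stereoSnd_coe, div_pow, mul_pow, mul_pow,
        hsq, hsq]
      have e1 : ‖z - w‖ ^ 2 = ‖z‖ ^ 2 + ‖w‖ ^ 2 - 2 * (z.re * w.re + z.im * w.im) := by
        simp only [← Complex.normSq_eq_norm_sq, Complex.normSq_apply, Complex.sub_re,
          Complex.sub_im]
        ring
      have hN : (1 + ‖z‖ ^ 2) ≠ 0 := by positivity
      have hM : (1 + ‖w‖ ^ 2) ≠ 0 := by positivity
      set N := 1 + ‖z‖ ^ 2 with hNd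
      set M := 1 + ‖w‖ ^ 2 with hMd
      have e2 : ‖2 * z / (N : ℂ) - 2 * w / (M : ℂ)‖ ^ 2 =
          4 * (‖z‖ ^ 2 / N ^ 2 + ‖w‖ ^ 2 / M ^ 2 -
            2 * (z.re * w.re + z.im * w.im) / (N * M)) := by
        have : (2 * z / (N : ℂ) - 2 * w / (M : ℂ)) =
            (((2 / N : ℝ) : ℂ) * z - ((2 / M : ℝ) : ℂ) * w) := by
          push_cast
          ring
        rw [this]
        simp only [← Complex.normSq_eq_norm_sq, Complex.normSq_apply, Complex.sub_re,
          Complex.sub_im, Complex.re_ofReal_mul, Complex.im_ofReal_mul]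
        field_simp
        ring
      have e3 : ‖(2 : ℂ) / (N : ℂ) - 2 / (M : ℂ)‖ ^ 2 = (2 / N - 2 / M) ^ 2 := by
        have : ((2 : ℂ) / (N : ℂ) - 2 / (M : ℂ)) = ((2 / N - 2 / M : ℝ) : ℂ) := by push_cast; ring
        rw [this, Complex.norm_real, Real.norm_eq_abs, sq_abs]
      have hz2 : ‖z‖ ^ 2 = N - 1 := by rw [hNd]; ring
      have hw2 : ‖w‖ ^ 2 = M - 1 := by rw [hMd]; ring
      rw [e2, e3, e1, hz2, hw2]
      field_simp
      ring

lemma chordal_le (a b : OnePoint ℂ) :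
    chordal a b ≤ ‖stereoFst a - stereoFst b‖ + ‖stereoSnd a - stereoSnd b‖ := by
  refine (abs_le_of_sq_le_sq' ?_ (by positivity)).2
  rw [chordal_sq]
  nlinarith [norm_nonneg (stereoFst a - stereoFst b), norm_nonneg (stereoSnd a - stereoSnd b)]

/-- The spherical speed of a curve bounds the speed of its stereographic image. -/
lemma exists_hasDerivAt_stereo {w : ℝ → ℂ} {w' : ℂ} {t : ℝ} (h : HasDerivAt w w' t) :
    (∃ d, HasDerivAt (fun t => stereoFst (w t)) d t ∧ ‖d‖ ≤ 6 * (‖w'‖ / (1 + ‖w t‖ ^ 2))) ∧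
      ∃ d, HasDerivAt (fun t => stereoSnd (w t)) d t ∧ ‖d‖ ≤ 6 * (‖w'‖ / (1 + ‖w t‖ ^ 2)) := by
  have hN : HasDerivAt (fun t => ((1 + ‖w t‖ ^ 2 : ℝ) : ℂ)) ((2 * inner ℝ (w t) w' : ℝ) : ℂ) t :=
    (h.norm_sq.const_add 1).ofReal_comp
  have hne := one_add_sq_ne (w t)
  set N : ℝ := 1 + ‖w t‖ ^ 2 with hNdef
  have hNpos : 0 < N := by positivity
  have hin : ‖((2 * inner ℝ (w t) w' : ℝ) : ℂ)‖ ≤ 2 * (‖w t‖ * ‖w'‖) := by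
    rw [Complex.norm_real, norm_mul, Real.norm_ofNat]
    gcongr
    exact norm_inner_le_norm _ _
  have hnN : ‖(N : ℂ)‖ = N := by rw [Complex.norm_real, Real.norm_of_nonneg hNpos.le]
  have hw2 : ‖w t‖ ^ 2 ≤ N := by rw [hNdef]; linarith
  have hw1 : ‖w t‖ ≤ N := by rw [hNdef]; nlinarith [sq_nonneg (‖w t‖ - 1)]
  have h0 := norm_nonneg (w t)
  have h0' := norm_nonneg w'
  constructor
  · refine ⟨_, (h.const_mul 2).fun_div hN hne, ?_⟩
    rw [norm_div, norm_pow, hnN, mul_div_assoc', div_le_div_iff₀ (by positivity) hNpos]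
    have h1 : ‖2 * w' * (N : ℂ) - 2 * w t * ((2 * inner ℝ (w t) w' : ℝ) : ℂ)‖ ≤
        2 * ‖w'‖ * N + 2 * ‖w t‖ * (2 * (‖w t‖ * ‖w'‖)) := by
      refine (norm_sub_le _ _).trans ?_
      rw [norm_mul, norm_mul, norm_mul, norm_mul, hnN, Complex.norm_ofNat]
      gcongr
    calc _ ≤ (2 * ‖w'‖ * N + 2 * ‖w t‖ * (2 * (‖w t‖ * ‖w'‖))) * N := by gcongr
      _ = (2 * ‖w'‖ * N + 4 * ‖w'‖ * ‖w t‖ ^ 2) * N := by ring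
      _ ≤ (2 * ‖w'‖ * N + 4 * ‖w'‖ * N) * N := by gcongr
      _ = _ := by ring
  · refine ⟨_, (hasDerivAt_const t (2 : ℂ)).fun_div hN hne, ?_⟩
    rw [norm_div, norm_pow, hnN, mul_div_assoc', div_le_div_iff₀ (by positivity) hNpos]
    have h1 : ‖0 * (N : ℂ) - 2 * ((2 * inner ℝ (w t) w' : ℝ) : ℂ)‖ ≤ 4 * (‖w t‖ * ‖w'‖) := by
      rw [zero_mul, zero_sub, norm_neg, norm_mul, Complex.norm_ofNat]
      linarith
    calc _ ≤ (4 * (‖w t‖ * ‖w'‖)) * N := by gcongr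
      _ ≤ (4 * (N * ‖w'‖)) * N := by gcongr
      _ ≤ _ := by nlinarith [mul_nonneg (mul_nonneg hNpos.le h0') hNpos.le]

/-- The mean value inequality with a countable set of exceptions. -/
lemma norm_sub_le_of_hasDerivAt_off_countable {g : ℝ → ℂ} {s : Set ℝ} {L : ℝ} (hs : s.Countable)
    (hc : ContinuousOn g (Icc 0 1))
    (hd : ∀ t ∈ Ioo (0 : ℝ) 1 \ s, ∃ d, HasDerivAt g d t ∧ ‖d‖ ≤ L) : ‖g 1 - g 0‖ ≤ L := by
  have hd' : ∀ t ∈ Ioo (0 : ℝ) 1 \ s, HasDerivAt g (deriv g t) t ∧ ‖deriv g t‖ ≤ L := by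
    intro t ht
    obtain ⟨d, h1, h2⟩ := hd t ht
    rw [h1.deriv]
    exact ⟨h1, h2⟩
  have hae : ∀ᵐ t : ℝ, t ∈ uIoc (0 : ℝ) 1 → ‖deriv g t‖ ≤ L := by
    filter_upwards [compl_mem_ae_iff.2 (hs.measure_zero volume),
      compl_mem_ae_iff.2 (measure_singleton (1 : ℝ))] with t h1 h2 ht
    rw [uIoc_of_le zero_le_one] at ht
    exact (hd' t ⟨⟨ht.1, lt_of_le_of_ne ht.2 h2⟩, h1⟩).2
  have hint : IntervalIntegrable (deriv g) volume 0 1 := by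
    rw [intervalIntegrable_iff]
    refine Measure.integrableOn_of_bounded (M := L) (by simp)
      (measurable_deriv g).aestronglyMeasurable ?_
    exact (ae_restrict_iff' measurableSet_uIoc).2 hae
  have h := integral_eq_of_hasDerivAt_off_countable_of_le g (deriv g) zero_le_one hs hc
    (fun t ht => (hd' t ht).1) hint
  rw [← h]
  simpa using intervalIntegral.norm_integral_le_of_norm_le_const_ae hae

/-! ### Derivatives of iterates -/

/-- The chain rule along an orbit that meets no pole. Near such a point the iterates in the plane
and on the sphere agree. -/
lemma hasDerivAt_iterate_fC {z : ℂ} (hz : z ∈ regularPts R) (n : ℕ) :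
    HasDerivAt (fC R)^[n] (∏ k ∈ Finset.range n, fD R ((fC R)^[k] z)) z ∧
      ∀ᶠ w : ℂ in 𝓝 z, (toMap R)^[n] (w : OnePoint ℂ) = (((fC R)^[n] w : ℂ) : OnePoint ℂ) := by
  induction n with
  | zero => exact ⟨by simpa using hasDerivAt_id z, Eventually.of_forall fun _ => rfl⟩
  | succ n ih =>
    constructor
    · rw [Finset.prod_range_succ, mul_comm, Function.iterate_succ']
      exact (hasDerivAt_fC (hz n)).comp z ih.1
    · filter_upwards [ih.2, ih.1.continuousAt.preimage_mem_nhds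
        (isOpen_denom_ne.mem_nhds (hz n))] with w h1 h2
      rw [Function.iterate_succ_apply', h1, toMap_coe_of_ne h2, Function.iterate_succ_apply']

/-- A uniform bound on the spherical derivatives of the iterates over a disc contradicts
`J = Ĉ`. -/
lemma mem_fatouSet_of_derivative_bound (hR : R.denom.natDegree < R.num.natDegree)
    (hinf : toMap R ∞ = ∞) {c : ℂ} {ρ L : ℝ} (hρ : 0 < ρ)
    (hL : ∀ n, ∀ z ∈ Metric.ball c ρ, z ∈ regularPts R →
      ‖∏ k ∈ Finset.range n, fD R ((fC R)^[k] z)‖ / (1 + ‖(fC R)^[n] z‖ ^ 2) ≤ L) :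
    (c : OnePoint ℂ) ∈ fatouSet R := by
  have hL0 : 0 ≤ L := by
    have hd := (countable_compl_regularPts hR).dense_compl ℝ
    obtain ⟨z, hz, hz'⟩ := hd.exists_mem_open Metric.isOpen_ball ⟨c, Metric.mem_ball_self hρ⟩
    rw [compl_compl] at hz
    exact le_trans (by positivity) (hL 0 z hz' hz)
  have key : ∀ x ∈ Metric.ball c ρ, ∀ y ∈ Metric.ball c ρ, ∀ n,
      chordal ((toMap R)^[n] (x : OnePoint ℂ)) ((toMap R)^[n] (y : OnePoint ℂ)) ≤
        12 * L * ‖x - y‖ := by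
    intro x hx y hy n
    by_cases hxy : x = y
    · subst hxy
      refine (chordal_le _ _).trans ?_
      simp
    -- integrate the spherical speed of the image of the segment, which meets the backward orbits
    -- of the poles in a countable set
    set γ : ℝ → ℂ := fun t => y + (t : ℂ) * (x - y)
    have hγ : ∀ t, HasDerivAt γ (x - y) t := fun t => by
      have := ((Complex.ofRealCLM.hasDerivAt (x := t)).mul_const (x - y)).const_add y
      simpa [γ] using this
    have hγc : Continuous γ := by fun_prop
    have hmem : ∀ t ∈ Ioo (0 : ℝ) 1, γ t ∈ Metric.ball c ρ := by
      intro t ht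
      have := (convex_ball c ρ).add_smul_sub_mem hy hx (Ioo_subset_Icc_self ht)
      simpa [γ] using this
    have hγi : Function.Injective γ := by
      intro s t hst
      have h1 : (s : ℂ) * (x - y) = (t : ℂ) * (x - y) := add_left_cancel hst
      exact Complex.ofReal_injective (mul_right_cancel₀ (sub_ne_zero.2 hxy) h1)
    have hs : (γ ⁻¹' (regularPts R)ᶜ).Countable :=
      (countable_compl_regularPts hR).preimage hγi
    have hcont : Continuous fun t => (toMap R)^[n] (γ t : OnePoint ℂ) :=
      ((continuous_toMap hR hinf).iterate n).comp (OnePoint.continuous_coe.comp hγc)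
    have hspeed : ∀ t ∈ Ioo (0 : ℝ) 1 \ γ ⁻¹' (regularPts R)ᶜ,
        (∃ d, HasDerivAt (fun t => stereoFst ((toMap R)^[n] (γ t : OnePoint ℂ))) d t ∧
          ‖d‖ ≤ 6 * L * ‖x - y‖) ∧
        ∃ d, HasDerivAt (fun t => stereoSnd ((toMap R)^[n] (γ t : OnePoint ℂ))) d t ∧
          ‖d‖ ≤ 6 * L * ‖x - y‖ := by
      rintro t ⟨ht, hreg⟩
      have hreg' : γ t ∈ regularPts R := not_not.1 hreg
      obtain ⟨h1, h2⟩ := hasDerivAt_iterate_fC hreg' n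
      have h3 : HasDerivAt (fun t => (fC R)^[n] (γ t))
          ((∏ k ∈ Finset.range n, fD R ((fC R)^[k] (γ t))) * (x - y)) t :=
        (h1.scomp_of_eq t (hγ t) rfl).congr_deriv (by simp [mul_comm])
      have hev := hγc.continuousAt.eventually h2
      have hb : 6 * (‖(∏ k ∈ Finset.range n, fD R ((fC R)^[k] (γ t))) * (x - y)‖ /
          (1 + ‖(fC R)^[n] (γ t)‖ ^ 2)) ≤ 6 * L * ‖x - y‖ := by
        have := hL n (γ t) (hmem t ht) hreg'
        rw [norm_mul, mul_div_right_comm, mul_assoc]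
        gcongr
      obtain ⟨⟨d, hd, hdb⟩, ⟨e, he, heb⟩⟩ := exists_hasDerivAt_stereo h3
      refine ⟨⟨d, hd.congr_of_eventuallyEq ?_, hdb.trans hb⟩,
        ⟨e, he.congr_of_eventuallyEq ?_, heb.trans hb⟩⟩
      · filter_upwards [hev] with s hs
        rw [hs]
      · filter_upwards [hev] with s hs
        rw [hs]
    have b1 := norm_sub_le_of_hasDerivAt_off_countable hs
      (continuous_stereoFst.comp hcont).continuousOn (fun t ht => (hspeed t ht).1)
    have b2 := norm_sub_le_of_hasDerivAt_off_countable hs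
      (continuous_stereoSnd.comp hcont).continuousOn (fun t ht => (hspeed t ht).2)
    have g1 : γ 1 = x := by simp [γ]
    have g0 : γ 0 = y := by simp [γ]
    simp only [Function.comp, g1, g0] at b1 b2
    refine (chordal_le _ _).trans ?_
    linarith
  have hopen : ∀ x ∈ Metric.ball c ρ, ((↑) : ℂ → OnePoint ℂ) '' Metric.ball c ρ ∈
      𝓝 (x : OnePoint ℂ) := fun x hx =>
    (OnePoint.isOpenEmbedding_coe.isOpenMap _ Metric.isOpen_ball).mem_nhds ⟨x, hx, rfl⟩
  refine ⟨_, hopen c (Metric.mem_ball_self hρ), ?_⟩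
  rintro _ ⟨x, hx, rfl⟩ ε hε
  have hev : ∀ᶠ y : ℂ in 𝓝 x, ∀ n : ℕ,
      chordal ((toMap R)^[n] (x : OnePoint ℂ)) ((toMap R)^[n] (y : OnePoint ℂ)) < ε := by
    have h1 : Tendsto (fun y => 12 * L * ‖x - y‖) (𝓝 x) (𝓝 0) := by
      have : Tendsto (fun y => 12 * L * ‖x - y‖) (𝓝 x) (𝓝 (12 * L * ‖x - x‖)) :=
        Continuous.tendsto (by fun_prop) x
      simpa using this
    filter_upwards [Metric.isOpen_ball.mem_nhds hx, h1.eventually_lt_const hε] with y hy hlt n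
    exact (key x hx y hy n).trans_lt hlt
  rw [OnePoint.nhds_coe_eq]
  exact Filter.eventually_map.2 hev

end

/-! ### The potential `z ↦ ∫ μ ψ_z` of an invariant line field -/

section

variable {R : RatFunc ℂ}

/-- If an invariant function annihilates the kernels at the critical values, its potential satisfies
the functional equation of a vector field. -/
lemma potential_fC (hR : R.denom.natDegree < R.num.natDegree) (hinf : toMap R ∞ = ∞)
    (hone : toMap R ((1 : ℂ) : OnePoint ℂ) = ((1 : ℂ) : OnePoint ℂ))
    (hzero : toMap R ((0 : ℂ) : OnePoint ℂ) = ((0 : ℂ) : OnePoint ℂ))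
    {μ : ℂ → ℂ} {B : ℝ} (hμ : AEMeasurable μ volume) (hb : ∀ᵐ x : ℂ, ‖μ x‖ ≤ B)
    (hinv : push R μ =ᵐ[volume] μ) (h0 : ∀ v ∈ critValues R, ∫ x, μ x * ψ v x = 0)
    {z : ℂ} (hz : R.denom.eval z ≠ 0) :
    ∫ x, μ x * ψ (fC R z) x = fD R z * ∫ x, μ x * ψ z x := by
  set F : ℂ → ℂ := fun z => ∫ x, μ x * ψ z x
  have hF : Continuous F := continuous_integral_mul_ψ hμ.aestronglyMeasurable hb
  have hmul : ∀ s, Integrable fun x => μ x * ψ s x := fun s =>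
    (integrable_ψ s).bdd_mul hμ.aestronglyMeasurable hb
  -- the equation holds off a countable set
  have hgen : ∀ z, R.denom.eval z ≠ 0 → fC R z ∉ poles hR hinf → F (fC R z) = fD R z * F z := by
    intro z hz hfz
    have hD : fD R z ≠ 0 := by
      refine fD_ne_zero_of_notMem (mem_fibre_fC hz) fun h => hfz ?_
      simp [poles, h]
    obtain ⟨c, hc⟩ := exists_T_ψ_eq hR hinf hone hzero hz hfz
    have h1 : F z = ∫ x, μ x * T R (ψ z) x := by
      rw [← integral_push_mul hR hμ hb (integrable_ψ z)]
      refine integral_congr_ae ?_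
      filter_upwards [hinv] with x hx
      rw [hx]
    have h2 : ∫ x, μ x * T R (ψ z) x = ∫ x, (μ x * ψ (fC R z) x * (fD R z)⁻¹ +
        ∑ s ∈ (finite_critValues hR hinf).toFinset, c s * (μ x * ψ s x)) := by
      refine integral_congr_ae ?_
      filter_upwards [hc] with x hx
      rw [hx, mul_add, Finset.mul_sum, div_eq_mul_inv]
      congr 1
      · ring
      · exact Finset.sum_congr rfl fun s _ => by ring
    rw [h1, h2, integral_add ((hmul _).mul_const _)
      (integrable_finsetSum _ fun s _ => (hmul s).const_mul _), integral_mul_const,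
      integral_finsetSum _ fun s _ => (hmul s).const_mul _, Finset.sum_eq_zero fun s hs => by
        rw [integral_const_mul, h0 s ((Finite.mem_toFinset _).1 hs), mul_zero], add_zero]
    change F (fC R z) = fD R z * (F (fC R z) * (fD R z)⁻¹)
    field_simp
  by_contra hne
  have hU := isOpen_denom_ne.mem_nhds hz
  -- extend the equation by continuity
  have hcont : ContinuousAt (fun z => F (fC R z) - fD R z * F z) z :=
    ((hF.continuousAt).comp (hasDerivAt_fC hz).continuousAt).sub
      ((differentiableOn_fD.differentiableAt hU).continuousAt.mul hF.continuousAt)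
  have hev := (hcont.eventually_ne (sub_ne_zero.2 hne)).and hU
  obtain ⟨V, hV, hVo, hzV⟩ := eventually_nhds_iff.1 hev
  have hcount : (fC R ⁻¹' (poles hR hinf : Set ℂ)).Countable :=
    countable_preimage_fC hR (Finset.countable_toSet _)
  obtain ⟨y, hy, hyV⟩ := (hcount.dense_compl ℝ).exists_mem_open hVo ⟨z, hzV⟩
  exact (hV y hyV).1 (sub_eq_zero.2 (hgen y (hV y hyV).2 hy))

/-- As the Julia set is the whole sphere, a potential satisfying the functional equation
vanishes. -/
lemma potential_eq_zero (hR : R.denom.natDegree < R.num.natDegree) (hinf : toMap R ∞ = ∞)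
    (hone : toMap R ((1 : ℂ) : OnePoint ℂ) = ((1 : ℂ) : OnePoint ℂ))
    (hzero : toMap R ((0 : ℂ) : OnePoint ℂ) = ((0 : ℂ) : OnePoint ℂ))
    (hJ : juliaSet R = Set.univ)
    {μ : ℂ → ℂ} {B : ℝ} (hμ : AEMeasurable μ volume) (hb : ∀ᵐ x : ℂ, ‖μ x‖ ≤ B)
    (hinv : push R μ =ᵐ[volume] μ) (h0 : ∀ v ∈ critValues R, ∫ x, μ x * ψ v x = 0) (z : ℂ) :
    ∫ x, μ x * ψ z x = 0 := by
  set F : ℂ → ℂ := fun z => ∫ x, μ x * ψ z x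
  have hF : Continuous F := continuous_integral_mul_ψ hμ.aestronglyMeasurable hb
  obtain ⟨C, hC0, hC⟩ := exists_integral_norm_ψ_le
  have hB : 0 ≤ B := by
    obtain ⟨x, hx⟩ := hb.exists
    exact (norm_nonneg _).trans hx
  have hgrowth : ∀ z, ‖F z‖ ≤ B * C * (1 + ‖z‖ ^ 2) := by
    intro z
    calc ‖F z‖ ≤ ∫ x, ‖μ x * ψ z x‖ := norm_integral_le_integral_norm _
      _ ≤ ∫ x, B * ‖ψ z x‖ := by
          refine integral_mono_ae ((integrable_ψ z).bdd_mul hμ.aestronglyMeasurable hb).norm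
            ((integrable_ψ z).norm.const_mul B) ?_
          filter_upwards [hb] with x hx
          rw [norm_mul]
          gcongr
      _ ≤ B * (C * (1 + ‖z‖ ^ 2)) := by
          rw [integral_const_mul]
          gcongr
          exact hC z
      _ = _ := by ring
  have hiter : ∀ z ∈ regularPts R, ∀ n, F ((fC R)^[n] z) =
      (∏ k ∈ Finset.range n, fD R ((fC R)^[k] z)) * F z := by
    intro z hz n
    induction n with
    | zero => simp
    | succ n ih =>
      rw [Function.iterate_succ_apply', Finset.prod_range_succ]
      have := potential_fC hR hinf hone hzero hμ hb hinv h0 (hz n)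
      change F (fC R ((fC R)^[n] z)) = fD R ((fC R)^[n] z) * F ((fC R)^[n] z) at this
      rw [this, ih]
      ring
  by_contra hne
  have hpos : 0 < ‖F z‖ := norm_pos_iff.2 hne
  have hev : ∀ᶠ y in 𝓝 z, ‖F z‖ / 2 < ‖F y‖ :=
    hF.norm.continuousAt.eventually (lt_mem_nhds (half_lt_self hpos))
  obtain ⟨ρ, hρ, hball⟩ := Metric.eventually_nhds_iff_ball.1 hev
  -- near `z`, `|(f^n)'| = |F ∘ f^n| / |F| ≤ C (1 + |f^n|²)`
  have hfatou := mem_fatouSet_of_derivative_bound hR hinf (c := z)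
    (L := B * C / (‖F z‖ / 2)) hρ (fun n y hy hreg => by
      have h1 := hball y hy
      have h2 := hgrowth ((fC R)^[n] y)
      rw [hiter y hreg n, norm_mul] at h2
      rw [div_le_div_iff₀ (by positivity) (by positivity)]
      refine le_trans ?_ h2
      gcongr)
  have : (z : OnePoint ℂ) ∈ juliaSet R := by rw [hJ]; trivial
  exact this hfatou

/-- As a function of `z`, `ψ_z(x)` has a simple pole at `x` with residue `-1`, so Cauchy's formula
turns circle integrals of potentials into integrals over discs. -/
lemma circleIntegral_ψ {a x : ℂ} {ρ : ℝ} (hρ : 0 < ρ) (h0 : x ≠ 0) (h1 : x ≠ 1)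
    (hx : x ∉ Metric.sphere a ρ) : (∮ z in C(a, ρ), ψ z x) =
      (Metric.ball a ρ).indicator (fun _ => -(2 * Real.pi * Complex.I : ℂ)) x := by
  have e1 := sub_ne_zero.2 h1
  have hform : ∀ z, ψ z x = (z - x)⁻¹ • (-(z * (z - 1)) / (x * (x - 1))) := by
    intro z
    rw [ψ, smul_eq_mul, ← neg_sub x z, inv_neg]
    simp only [div_eq_mul_inv, mul_inv]
    ring
  have hd : Differentiable ℂ fun z : ℂ => -(z * (z - 1)) / (x * (x - 1)) := by fun_prop
  by_cases hb : x ∈ Metric.ball a ρ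
  · rw [indicator_of_mem hb]
    simp_rw [hform]
    rw [hd.diffContOnCl.circleIntegral_sub_inv_smul hb, smul_eq_mul, neg_div,
      div_self (mul_ne_zero h0 e1), mul_neg_one]
  · rw [indicator_of_notMem hb]
    have hne : ∀ z ∈ Metric.closedBall a ρ, z - x ≠ 0 := by
      intro z hz h
      rw [sub_eq_zero] at h
      subst h
      rcases (Metric.mem_closedBall.1 hz).lt_or_eq with h | h
      · exact hb h
      · exact hx h
    refine DiffContOnCl.circleIntegral_eq_zero hρ.le (DifferentiableOn.diffContOnCl fun z hz => ?_)
    rw [closure_ball a hρ.ne'] at hz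
    have : DifferentiableAt ℂ (fun z => (z - x)⁻¹ • (-(z * (z - 1)) / (x * (x - 1)))) z :=
      ((differentiableAt_id.sub_const x).inv (hne z hz)).smul (hd z)
    exact (this.congr_of_eventuallyEq (Eventually.of_forall hform)).differentiableWithinAt

/-- A bounded function is determined by its potential. -/
lemma ae_eq_zero_of_potential_eq_zero {μ : ℂ → ℂ} {B : ℝ} (hμ : AEMeasurable μ volume)
    (hb : ∀ᵐ x : ℂ, ‖μ x‖ ≤ B) (h0 : ∀ z, ∫ x, μ x * ψ z x = 0) : μ =ᵐ[volume] 0 := by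
  have hB : 0 ≤ B := by
    obtain ⟨x, hx⟩ := hb.exists
    exact (norm_nonneg _).trans hx
  have hloc : LocallyIntegrable μ volume := by
    refine locallyIntegrable_iff.2 fun k hk => ?_
    exact Measure.integrableOn_of_bounded hk.measure_lt_top.ne hμ.aestronglyMeasurable
      (ae_restrict_of_ae hb)
  obtain ⟨C, hC0, hC⟩ := exists_integral_norm_ψ_le
  -- integrate the potential over the circle and exchange the integrals
  have hball : ∀ a : ℂ, ∀ ρ : ℝ, 0 < ρ → ∫ x in Metric.ball a ρ, μ x = 0 := by
    intro a ρ hρ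
    have hmeas : AEStronglyMeasurable (Function.uncurry fun (θ : ℝ) (x : ℂ) =>
        deriv (circleMap a ρ) θ * (μ x * ψ (circleMap a ρ θ) x))
        ((volume.restrict (Ioc 0 (2 * Real.pi))).prod volume) := by
      have m1 : AEStronglyMeasurable (fun p : ℝ × ℂ => μ p.2)
          ((volume.restrict (Ioc 0 (2 * Real.pi))).prod volume) :=
        hμ.aestronglyMeasurable.comp_snd
      have m0 : Measurable (circleMap a ρ) := (continuous_circleMap a ρ).measurable
      have m2 : Measurable fun p : ℝ × ℂ => ψ (circleMap a ρ p.1) p.2 := by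
        unfold ψ
        fun_prop
      have m3 : Measurable fun p : ℝ × ℂ => deriv (circleMap a ρ) p.1 :=
        (measurable_deriv _).comp measurable_fst
      exact m3.aestronglyMeasurable.mul (m1.mul m2.aestronglyMeasurable)
    have hmul : ∀ z, Integrable fun x => μ x * ψ z x := fun s =>
      (integrable_ψ s).bdd_mul hμ.aestronglyMeasurable hb
    have hint : Integrable (Function.uncurry fun (θ : ℝ) (x : ℂ) =>
        deriv (circleMap a ρ) θ * (μ x * ψ (circleMap a ρ θ) x))
        ((volume.restrict (Ioc 0 (2 * Real.pi))).prod volume) := by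
      refine (integrable_prod_iff hmeas).2 ⟨Eventually.of_forall fun θ =>
        (hmul (circleMap a ρ θ)).const_mul (deriv (circleMap a ρ) θ), ?_⟩
      refine Integrable.of_bound hmeas.norm.integral_prod_right'
        (ρ * (B * (C * (1 + (‖a‖ + ρ) ^ 2)))) (Eventually.of_forall fun θ => ?_)
      rw [Real.norm_of_nonneg (integral_nonneg fun _ => norm_nonneg _)]
      have hz : ‖circleMap a ρ θ‖ ≤ ‖a‖ + ρ := by
        have h1 : ‖circleMap a ρ θ - a‖ = ρ := by
          rw [circleMap_sub_center, norm_circleMap_zero, abs_of_pos hρ]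
        have h2 := norm_sub_norm_le (circleMap a ρ θ) a
        linarith
      calc ∫ x, ‖deriv (circleMap a ρ) θ * (μ x * ψ (circleMap a ρ θ) x)‖
          ≤ ∫ x, ρ * (B * ‖ψ (circleMap a ρ θ) x‖) := by
            refine integral_mono_ae ((hmul _).const_mul _).norm
              (((integrable_ψ _).norm.const_mul B).const_mul ρ) ?_
            filter_upwards [hb] with x hx
            rw [norm_mul, norm_mul, deriv_circleMap, norm_mul, norm_circleMap_zero, Complex.norm_I,
              mul_one, abs_of_pos hρ]
            gcongr
        _ = ρ * (B * ∫ x, ‖ψ (circleMap a ρ θ) x‖) := by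
            rw [integral_const_mul, integral_const_mul]
        _ ≤ _ := by
            gcongr
            refine (hC _).trans ?_
            gcongr
    have hswap := integral_integral_swap hint
    have hL : ∫ θ in Ioc 0 (2 * Real.pi), ∫ x, deriv (circleMap a ρ) θ *
        (μ x * ψ (circleMap a ρ θ) x) = 0 := by
      simp_rw [integral_const_mul, h0, mul_zero, integral_zero]
    have hR' : ∫ x, ∫ θ in Ioc 0 (2 * Real.pi), deriv (circleMap a ρ) θ *
        (μ x * ψ (circleMap a ρ θ) x) =
        ∫ x, (Metric.ball a ρ).indicator (fun x => -(2 * Real.pi * Complex.I : ℂ) * μ x) x := by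
      refine integral_congr_ae ?_
      have hsph : ∀ᵐ x : ℂ, x ∉ Metric.sphere a ρ :=
        compl_mem_ae_iff.2 (Measure.addHaar_sphere volume a ρ)
      filter_upwards [ae_ne 0, ae_ne 1, hsph] with x hx0 hx1 hxs
      have h1 := circleIntegral_ψ hρ hx0 hx1 hxs
      rw [circleIntegral, intervalIntegral.integral_of_le (by positivity)] at h1
      have h2 : ∫ θ in Ioc 0 (2 * Real.pi), deriv (circleMap a ρ) θ *
          (μ x * ψ (circleMap a ρ θ) x) =
          μ x * ∫ θ in Ioc 0 (2 * Real.pi), deriv (circleMap a ρ) θ • ψ (circleMap a ρ θ) x := by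
        rw [← integral_const_mul]
        refine integral_congr_ae (Eventually.of_forall fun θ => ?_)
        simp only [smul_eq_mul]
        ring
      rw [h2, h1]
      by_cases hxb : x ∈ Metric.ball a ρ
      · rw [indicator_of_mem hxb, indicator_of_mem hxb, mul_comm]
      · rw [indicator_of_notMem hxb, indicator_of_notMem hxb, mul_zero]
    rw [hL, hR', integral_indicator measurableSet_ball, integral_const_mul] at hswap
    have hc : -(2 * Real.pi * Complex.I : ℂ) ≠ 0 := by
      simp [Real.pi_ne_zero]
    exact (mul_eq_zero.1 hswap.symm).resolve_left hc
  -- Lebesgue differentiation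
  filter_upwards [IsUnifLocDoublingMeasure.ae_tendsto_average volume hloc 1] with x hx
  have hδ : Tendsto (fun n : ℕ => 1 / ((n : ℝ) + 1)) atTop (𝓝[>] 0) :=
    tendsto_nhdsWithin_iff.2 ⟨tendsto_one_div_add_atTop_nhds_zero_nat,
      Eventually.of_forall fun n => by
        simp only [mem_Ioi]
        positivity⟩
  have h := hx (fun _ => x) _ hδ (Eventually.of_forall fun n =>
    Metric.mem_closedBall_self (by positivity))
  refine tendsto_nhds_unique h (tendsto_const_nhds.congr fun n => ?_)
  have hcb : ∫ y in Metric.closedBall x (1 / ((n : ℝ) + 1)), μ y = 0 := by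
    rw [← hball x (1 / ((n : ℝ) + 1)) (by positivity)]
    refine setIntegral_congr_set (eventuallyEq_set.2 ?_)
    filter_upwards [compl_mem_ae_iff.2 (Measure.addHaar_sphere volume x (1 / ((n : ℝ) + 1)))]
      with y hy
    exact ⟨fun h => lt_of_le_of_ne h hy, fun h => Metric.ball_subset_closedBall h⟩
  rw [setAverage_eq, hcb, smul_zero]
  rfl

/-- An invariant line field is detected by the kernels at the critical values. -/
lemma exists_integral_ψ_ne_zero (hR : R.denom.natDegree < R.num.natDegree) (hinf : toMap R ∞ = ∞)
    (hone : toMap R ((1 : ℂ) : OnePoint ℂ) = ((1 : ℂ) : OnePoint ℂ))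
    (hzero : toMap R ((0 : ℂ) : OnePoint ℂ) = ((0 : ℂ) : OnePoint ℂ))
    (hJ : juliaSet R = Set.univ)
    {μ : ℂ → ℂ} {B : ℝ} (hμ : AEMeasurable μ volume) (hb : ∀ᵐ x : ℂ, ‖μ x‖ ≤ B)
    (hinv : push R μ =ᵐ[volume] μ) (hne : ¬ μ =ᵐ[volume] 0) :
    ∃ v ∈ critValues R, ∫ x, μ x * ψ v x ≠ 0 := by
  by_contra! h
  exact hne (ae_eq_zero_of_potential_eq_zero hμ hb
    (potential_eq_zero hR hinf hone hzero hJ hμ hb hinv h))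

end

/-! ### Weak* compactness -/

section

/-- A function whose integral against every test function of modulus at most `1` is bounded by the
`L¹` norm of the test function is bounded by `1`. -/
lemma ae_norm_le_one_of_integral_le {ν : Measure ℂ} [IsFiniteMeasure ν] {u : ℂ → ℂ}
    (hu : Integrable u ν) (h : ∀ g : ℂ → ℂ, AEStronglyMeasurable g ν → (∀ x, ‖g x‖ ≤ 1) →
      ‖∫ x, u x * g x ∂ν‖ ≤ ∫ x, ‖g x‖ ∂ν) : ∀ᵐ x ∂ν, ‖u x‖ ≤ 1 := by
  have hum : AEMeasurable u ν := hu.aestronglyMeasurable.aemeasurable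
  set F := {x | 1 < ‖u x‖}
  have hF : NullMeasurableSet F ν := nullMeasurableSet_lt aemeasurable_const hum.norm
  -- test against the conjugate direction of `u` on the set where the bound fails
  set g : ℂ → ℂ := F.indicator fun x => starRingEnd ℂ (u x) / ‖u x‖
  have hgm : AEStronglyMeasurable g ν := by
    refine AEStronglyMeasurable.indicator₀ ?_ hF
    exact ((Complex.continuous_conj.measurable.comp_aemeasurable hum).div
      (Complex.measurable_ofReal.comp_aemeasurable hum.norm)).aestronglyMeasurable
  have hgF : ∀ x ∈ F, ‖g x‖ = 1 := by
    intro x hx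
    have hpos : ‖u x‖ ≠ 0 := (zero_lt_one.trans hx).ne'
    simp only [g, indicator_of_mem hx, norm_div, RCLike.norm_conj, Complex.norm_real, norm_norm]
    exact div_self hpos
  have hgN : ∀ x ∉ F, g x = 0 := fun x hx => indicator_of_notMem hx _
  have hg1 : ∀ x, ‖g x‖ = F.indicator (fun _ => (1 : ℝ)) x := by
    intro x
    by_cases hx : x ∈ F
    · rw [hgF x hx, indicator_of_mem hx]
    · rw [hgN x hx, norm_zero, indicator_of_notMem hx]
  have hug : ∀ x, u x * g x = ((F.indicator (fun x => ‖u x‖) x : ℝ) : ℂ) := by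
    intro x
    by_cases hx : x ∈ F
    · have hpos : (‖u x‖ : ℂ) ≠ 0 := Complex.ofReal_ne_zero.2 (zero_lt_one.trans hx).ne'
      simp only [g, indicator_of_mem hx]
      rw [mul_div_assoc', Complex.mul_conj, Complex.normSq_eq_norm_sq]
      push_cast
      field_simp
    · rw [hgN x hx, mul_zero, indicator_of_notMem hx, Complex.ofReal_zero]
  have h1 := h g hgm fun x => by
    rw [hg1]
    exact indicator_le_self' (fun _ _ => zero_le_one) x |>.trans le_rfl
  simp_rw [hug, hg1] at h1
  rw [integral_complex_ofReal, Complex.norm_real] at h1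
  have hi1 : Integrable (F.indicator fun x => ‖u x‖) ν := hu.norm.indicator₀ hF
  have hi2 : Integrable (F.indicator fun _ => (1 : ℝ)) ν := (integrable_const 1).indicator₀ hF
  have h2 : ∫ x, (F.indicator (fun x => ‖u x‖) x - F.indicator (fun _ => (1 : ℝ)) x) ∂ν ≤ 0 := by
    rw [integral_sub hi1 hi2]
    linarith [le_abs_self (∫ x, F.indicator (fun x => ‖u x‖) x ∂ν), Real.norm_eq_abs
      (∫ x, F.indicator (fun x => ‖u x‖) x ∂ν)]
  have hnn : 0 ≤ fun x => F.indicator (fun x => ‖u x‖) x - F.indicator (fun _ => (1 : ℝ)) x := by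
    intro x
    by_cases hx : x ∈ F
    · simp only [indicator_of_mem hx, Pi.zero_apply]
      exact sub_nonneg.2 (le_of_lt hx)
    · simp [indicator_of_notMem hx]
  have h3 := (integral_eq_zero_iff_of_nonneg hnn (hi1.sub hi2)).1
    (le_antisymm h2 (integral_nonneg hnn))
  filter_upwards [h3] with x hx
  by_contra! hlt
  have hxF : x ∈ F := hlt
  simp only [indicator_of_mem hxF, Pi.zero_apply] at hx
  linarith

/-- Sequential weak* compactness of the unit ball of `L_∞` of a finite measure. -/
lemma exists_weakStar_limit_of_isFiniteMeasure {ν : Measure ℂ} [IsFiniteMeasure ν]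
    {u : ℕ → ℂ → ℂ} (hu : ∀ n, AEStronglyMeasurable (u n) ν) (hb : ∀ n, ∀ᵐ x ∂ν, ‖u n x‖ ≤ 1) :
    ∃ (w : ℂ → ℂ) (φ : ℕ → ℕ), StrictMono φ ∧ AEStronglyMeasurable w ν ∧ (∀ᵐ x ∂ν, ‖w x‖ ≤ 1) ∧
      ∀ g, Integrable g ν →
        Tendsto (fun n => ∫ x, u (φ n) x * g x ∂ν) atTop (𝓝 (∫ x, w x * g x ∂ν)) := by
  have hmem : ∀ n, MemLp (u n) 2 ν := fun n => MemLp.of_bound (hu n) 1 (hb n)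
  set U : ℕ → Lp ℂ 2 ν := fun n => (hmem n).toLp
  set M : ℝ := (measureUnivNNReal ν : ℝ) ^ (2⁻¹ : ℝ)
  have hU : ∀ n, ‖U n‖ ≤ M := by
    intro n
    have h1 : ∀ᵐ x ∂ν, ‖U n x‖ ≤ 1 := by
      filter_upwards [hb n, (hmem n).coeFn_toLp] with x h1 h2
      rw [h2]
      exact h1
    have := Lp.norm_le_of_ae_bound zero_le_one h1
    simpa [M] using this
  have hball : ∀ n, StrongDual.toWeakDual (InnerProductSpace.toDual ℂ (Lp ℂ 2 ν) (U n)) ∈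
      WeakDual.toStrongDual ⁻¹' Metric.closedBall (0 : StrongDual ℂ (Lp ℂ 2 ν)) M := by
    intro n
    rw [mem_preimage, mem_closedBall_zero_iff]
    change ‖InnerProductSpace.toDual ℂ (Lp ℂ 2 ν) (U n)‖ ≤ M
    rw [LinearIsometryEquiv.norm_map]
    exact hU n
  have : Fact ((2 : ENNReal) ≠ ⊤) := ⟨by norm_num⟩
  -- bounded functions are square integrable, and balls of `L²` are weakly sequentially compact
  obtain ⟨Φ, -, φ, hφ, hlim⟩ := WeakDual.isSeqCompact_closedBall ℂ (Lp ℂ 2 ν) 0 M hball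
  set W : Lp ℂ 2 ν := (InnerProductSpace.toDual ℂ (Lp ℂ 2 ν)).symm (WeakDual.toStrongDual Φ)
  have hinner : ∀ f : Lp ℂ 2 ν, Tendsto (fun n => inner ℂ f (U (φ n))) atTop (𝓝 (inner ℂ f W)) := by
    intro f
    have h1 := ((WeakDual.eval_continuous f).tendsto Φ).comp hlim
    have h2 : Tendsto (fun n => inner ℂ (U (φ n)) f) atTop (𝓝 (inner ℂ W f)) := by
      have e : inner ℂ W f = Φ f := InnerProductSpace.toDual_symm_apply
      rw [e]
      exact h1
    have h3 := (Complex.continuous_conj.tendsto _).comp h2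
    simp only [inner_conj_symm, Function.comp_def] at h3
    exact h3
  -- convergence against square integrable test functions
  have hL2 : ∀ g, MemLp g 2 ν →
      Tendsto (fun n => ∫ x, u (φ n) x * g x ∂ν) atTop (𝓝 (∫ x, W x * g x ∂ν)) := by
    intro g hg
    have hg' : MemLp (fun x => starRingEnd ℂ (g x)) 2 ν := hg.star
    have e1 : ∀ V : Lp ℂ 2 ν, inner ℂ (hg'.toLp) V = ∫ x, V x * g x ∂ν := by
      intro V
      rw [L2.inner_def]
      refine integral_congr_ae ?_
      filter_upwards [hg'.coeFn_toLp] with x hx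
      rw [hx]
      simp
    have e2 : ∀ n, ∫ x, U (φ n) x * g x ∂ν = ∫ x, u (φ n) x * g x ∂ν := by
      intro n
      refine integral_congr_ae ?_
      filter_upwards [(hmem (φ n)).coeFn_toLp] with x hx
      rw [hx]
    have := hinner hg'.toLp
    simp only [e1, e2] at this
    exact this
  have hWm : AEStronglyMeasurable W ν := Lp.aestronglyMeasurable W
  have hWi : Integrable W ν := (Lp.memLp W).integrable (by norm_num)
  have hbound : ∀ n, ∀ g, Integrable g ν → ‖∫ x, u (φ n) x * g x ∂ν‖ ≤ ∫ x, ‖g x‖ ∂ν := by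
    intro n g hg
    refine norm_integral_le_of_norm_le hg.norm ?_
    filter_upwards [hb (φ n)] with x hx
    rw [norm_mul]
    exact mul_le_of_le_one_left (norm_nonneg _) hx
  have hW1 : ∀ᵐ x ∂ν, ‖W x‖ ≤ 1 := by
    refine ae_norm_le_one_of_integral_le hWi fun g hgm hg1 => ?_
    refine le_of_tendsto (hL2 g (MemLp.of_bound hgm 1 (Eventually.of_forall hg1))).norm
      (Eventually.of_forall fun n => hbound n g ?_)
    exact Integrable.of_bound hgm 1 (Eventually.of_forall hg1)
  refine ⟨W, φ, hφ, hWm, hW1, fun g hg => ?_⟩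
  have hmulu : ∀ n g, Integrable g ν → Integrable (fun x => u (φ n) x * g x) ν := fun n g hg =>
    hg.bdd_mul (hu _) (hb _)
  have hmulW : ∀ g, Integrable g ν → Integrable (fun x => W x * g x) ν := fun g hg =>
    hg.bdd_mul hWm hW1
  -- simple functions are square integrable and dense in `L¹`
  rw [Metric.tendsto_atTop]
  intro ε hε
  obtain ⟨s, hs, hsm⟩ := (memLp_one_iff_integrable.2 hg).exists_simpleFunc_eLpNorm_sub_lt
    ENNReal.one_ne_top (ε := ENNReal.ofReal (ε / 3)) (by simpa using by positivity)
  have hsi : Integrable s ν := memLp_one_iff_integrable.1 hsm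
  have hd : ∫ x, ‖g x - s x‖ ∂ν < ε / 3 := by
    have e := integral_norm_eq_lintegral_enorm (hg.sub hsi).aestronglyMeasurable
    simp only [Pi.sub_apply] at e
    rw [e]
    rw [eLpNorm_one_eq_lintegral_enorm] at hs
    exact (ENNReal.toReal_lt_of_lt_ofReal hs)
  obtain ⟨N, hN⟩ := Metric.tendsto_atTop.1 (hL2 s (s.memLp_of_isFiniteMeasure 2 ν)) (ε / 3)
    (by positivity)
  refine ⟨N, fun n hn => ?_⟩
  have h1 : ‖∫ x, u (φ n) x * g x ∂ν - ∫ x, u (φ n) x * s x ∂ν‖ ≤ ∫ x, ‖g x - s x‖ ∂ν := by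
    rw [← integral_sub (hmulu n g hg) (hmulu n s hsi)]
    simp_rw [← mul_sub]
    exact hbound n _ (hg.sub hsi)
  have h2 : ‖∫ x, W x * g x ∂ν - ∫ x, W x * s x ∂ν‖ ≤ ∫ x, ‖g x - s x‖ ∂ν := by
    rw [← integral_sub (hmulW g hg) (hmulW s hsi)]
    simp_rw [← mul_sub]
    refine norm_integral_le_of_norm_le (hg.sub hsi).norm ?_
    filter_upwards [hW1] with x hx
    rw [norm_mul]
    exact mul_le_of_le_one_left (norm_nonneg _) hx
  have h3 := hN n hn
  rw [dist_eq_norm] at h3 ⊢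
  set a := ∫ x, u (φ n) x * g x ∂ν
  set b := ∫ x, u (φ n) x * s x ∂ν
  set c := ∫ x, W x * g x ∂ν
  set d := ∫ x, W x * s x ∂ν
  calc ‖a - c‖ = ‖(a - b) + (b - d) - (c - d)‖ := by ring_nf
    _ ≤ ‖(a - b) + (b - d)‖ + ‖c - d‖ := norm_sub_le _ _
    _ ≤ ‖a - b‖ + ‖b - d‖ + ‖c - d‖ := by gcongr; exact norm_add_le _ _
    _ < ε := by linarith

/-- Sequential weak* compactness of the unit ball of `L_∞(ℂ)`. -/
lemma exists_weakStar_limit {u : ℕ → ℂ → ℂ} (hu : ∀ n, AEMeasurable (u n) volume)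
    (hb : ∀ n, ∀ᵐ x : ℂ, ‖u n x‖ ≤ 1) :
    ∃ (w : ℂ → ℂ) (φ : ℕ → ℕ), StrictMono φ ∧ AEMeasurable w volume ∧ (∀ᵐ x : ℂ, ‖w x‖ ≤ 1) ∧
      WeakStarTendsto (fun n => u (φ n)) w := by
  obtain ⟨d, hd0, hdm, hdi⟩ := exists_pos_lintegral_lt_of_sigmaFinite (volume : Measure ℂ)
    one_ne_zero
  -- a finite measure with the same null sets as the area
  set ν : Measure ℂ := volume.withDensity fun x => (d x : ENNReal)
  have hνfin : IsFiniteMeasure ν := by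
    refine ⟨?_⟩
    rw [withDensity_apply _ MeasurableSet.univ, Measure.restrict_univ]
    exact hdi.trans ENNReal.one_lt_top
  have hν1 : ν ≪ volume := withDensity_absolutelyContinuous _ _
  have hν2 : volume ≪ ν := withDensity_absolutelyContinuous' (by fun_prop)
    (Eventually.of_forall fun x => by simpa using (hd0 x).ne')
  obtain ⟨w, φ, hφ, hwm, hw1, hlim⟩ := exists_weakStar_limit_of_isFiniteMeasure (ν := ν)
    (fun n => ((hu n).mono_ac hν1).aestronglyMeasurable) (fun n => hν1.ae_le (hb n))
  have hwm' : AEMeasurable w volume := hwm.aemeasurable.mono_ac hν2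
  have hw1' : ∀ᵐ x : ℂ, ‖w x‖ ≤ 1 := hν2.ae_le hw1
  refine ⟨w, φ, hφ, hwm', hw1', fun n => memLp_top_of_bound (hu _).aestronglyMeasurable 1 (hb _),
    memLp_top_of_bound hwm'.aestronglyMeasurable 1 hw1', fun g hg => ?_⟩
  have hd0' : ∀ x, ((d x : ℝ) : ℂ) ≠ 0 := fun x =>
    Complex.ofReal_ne_zero.2 (NNReal.coe_ne_zero.2 (hd0 x).ne')
  have hsm : ∀ x (a : ℂ), d x • (a * (g x / ((d x : ℝ) : ℂ))) = a * g x := by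
    intro x a
    rw [NNReal.smul_def, Complex.real_smul]
    field_simp [hd0' x]
  -- `L¹` functions for the area correspond to those for `ν` by division by the density
  have hgi : Integrable (fun x => g x / ((d x : ℝ) : ℂ)) ν := by
    refine (integrable_withDensity_iff_integrable_smul hdm).2 (hg.congr ?_)
    refine Eventually.of_forall fun x => ?_
    have := hsm x 1
    simp only [one_mul] at this
    exact this.symm
  have key := hlim _ hgi
  have e : ∀ h : ℂ → ℂ, ∫ x, h x * (g x / ((d x : ℝ) : ℂ)) ∂ν = ∫ x, h x * g x := by
    intro h
    rw [integral_withDensity_eq_integral_smul hdm]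
    simp_rw [hsm]
  simp only [e] at key
  exact key

end

/-! ### Weak* limits of the line fields spread from the shells -/

section

variable {R : RatFunc ℂ}

/-- The standing hypotheses: a normalized map with full Julia set whose critical orbits attract
almost every point, and a decreasing sequence of fundamental sets. -/
structure Standing (R : RatFunc ℂ) (K : ℕ → Set (OnePoint ℂ)) : Prop where
  map_infty : toMap R ∞ = ∞
  map_one : toMap R ((1 : ℂ) : OnePoint ℂ) = ((1 : ℂ) : OnePoint ℂ)
  map_zero : toMap R ((0 : ℂ) : OnePoint ℂ) = ((0 : ℂ) : OnePoint ℂ)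
  julia : juliaSet R = Set.univ
  attracted : AeAttractedToPostcritical R
  fundamental : ∀ n, IsFundamental R (K n)
  anti : Antitone K

/-- An almost everywhere completely invariant planar set. -/
structure IsAeInvariant (R : RatFunc ℂ) (E : Set ℂ) : Prop where
  nullMeasurable : NullMeasurableSet E
  mem_iff : ∀ᵐ z : ℂ, fC R z ∈ E ↔ z ∈ E

lemma isAeInvariant_univ : IsAeInvariant R univ :=
  ⟨nullMeasurableSet_univ, Eventually.of_forall fun _ => by simp⟩

lemma ae_eq_of_forall_integral_mul_eq {a b : ℂ → ℂ} {C : ℝ} (ha : AEMeasurable a volume)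
    (hb : AEMeasurable b volume) (haC : ∀ᵐ x : ℂ, ‖a x‖ ≤ C) (hbC : ∀ᵐ x : ℂ, ‖b x‖ ≤ C)
    (h : ∀ g : ℂ → ℂ, Integrable g → ∫ x, a x * g x = ∫ x, b x * g x) : a =ᵐ[volume] b := by
  refine ae_eq_of_forall_setIntegral_eq_of_sigmaFinite (fun s hs hfin => ?_) (fun s hs hfin => ?_)
    fun s hs hfin => ?_
  · exact Measure.integrableOn_of_bounded hfin.ne ha.aestronglyMeasurable (ae_restrict_of_ae haC)
  · exact Measure.integrableOn_of_bounded hfin.ne hb.aestronglyMeasurable (ae_restrict_of_ae hbC)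
  · have h1 := h (s.indicator 1) ((integrable_indicator_iff hs).2 (integrableOn_const hfin.ne))
    have e : ∀ f : ℂ → ℂ, ∫ x, f x * s.indicator 1 x = ∫ x in s, f x := by
      intro f
      rw [← integral_indicator hs]
      refine integral_congr_ae (Eventually.of_forall fun x => ?_)
      by_cases hx : x ∈ s <;> simp [hx]
    rwa [e, e] at h1

/-- Dominated convergence for bounded sequences that vanish eventually. -/
lemma tendsto_integral_mul_zero {w : ℕ → ℂ → ℂ} (hw : ∀ n, AEMeasurable (w n) volume)
    (hb : ∀ n, ∀ᵐ x : ℂ, ‖w n x‖ ≤ 1) (h0 : ∀ᵐ x : ℂ, ∀ᶠ n in atTop, w n x = 0)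
    {g : ℂ → ℂ} (hg : Integrable g) : Tendsto (fun n => ∫ x, w n x * g x) atTop (𝓝 0) := by
  have := tendsto_integral_of_dominated_convergence (μ := (volume : Measure ℂ))
    (F := fun n x => w n x * g x) (f := fun _ => (0 : ℂ)) (fun x => ‖g x‖)
    (fun n => (hw n).aestronglyMeasurable.mul hg.aestronglyMeasurable) hg.norm
    (fun n => by
      filter_upwards [hb n] with x hx
      rw [norm_mul]
      exact mul_le_of_le_one_left (norm_nonneg _) hx)
    (by
      filter_upwards [h0] with x hx
      refine tendsto_const_nhds.congr' ?_
      filter_upwards [hx] with n hn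
      rw [hn, zero_mul])
  simpa using this

variable {K : ℕ → Set (OnePoint ℂ)} {E : Set ℂ}

namespace Standing

lemma denom_lt_num (h : Standing R K) : R.denom.natDegree < R.num.natDegree :=
  denom_lt_num_of_map_infty h.map_infty

lemma resolvent (h : Standing R K) {v : ℂ} (hv : v ∈ critValues R) :
    (∀ x ∈ Ω R, Summable fun i : ℕ => ((T R)^[i] (ψ v)) x) ∧
      (∀ x ∈ Ω R, r R v x - T R (r R v) x = ψ v x) ∧ DifferentiableOn ℂ (r R v) (Ω R) :=
  resolvent_on_Ω h.denom_lt_num h.map_infty h.map_one h.map_zero h.julia h.attracted hv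

lemma integrableOn_r_primed (h : Standing R K) {v : ℂ} (hv : v ∈ critValues R) (n : ℕ) :
    IntegrableOn (r R v) (fin (primed R (K n))) :=
  (integral_mul_resolvent h.denom_lt_num (isWandering_primed (h.fundamental n).mapsTo)
    (nullMeasurableSet_primed h.denom_lt_num (h.fundamental n).measurable)
    (ae_primed_subset_Ω h.julia (h.fundamental n)) (h.resolvent hv).1).1

lemma nullMeasurableSet_sample (h : Standing R K) (hE : IsAeInvariant R E) (n : ℕ) :
    NullMeasurableSet (shell R K n ∩ E) :=
  (nullMeasurableSet_shell h.denom_lt_num h.fundamental n).inter hE.nullMeasurable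

lemma isWandering_sample (h : Standing R K) (n : ℕ) : IsWandering R (shell R K n ∩ E) :=
  (isWandering_shell h.fundamental n).mono inter_subset_left

lemma integrableOn_r_sample (h : Standing R K) {v : ℂ} (hv : v ∈ critValues R) (n : ℕ) :
    IntegrableOn (r R v) (shell R K n ∩ E) :=
  (h.integrableOn_r_primed hv n).mono_set (inter_subset_left.trans (shell_subset n))

lemma aemeasurable_sample (h : Standing R K) (hE : IsAeInvariant R E) {v : ℂ}
    (hv : v ∈ critValues R) (n : ℕ) :
    AEMeasurable (spread R (shell R K n ∩ E) (σ R v)) volume :=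
  aemeasurable_spread h.denom_lt_num (h.isWandering_sample n)
    (aemeasurable_indicator_σ (h.nullMeasurableSet_sample hE n) (h.integrableOn_r_sample hv n))

lemma ae_norm_sample_le (h : Standing R K) (v : ℂ) (n : ℕ) :
    ∀ᵐ x : ℂ, ‖spread R (shell R K n ∩ E) (σ R v) x‖ ≤ 1 :=
  ae_norm_spread_le h.denom_lt_num (h.isWandering_sample n)
    (Eventually.of_forall (norm_indicator_σ_le v _))

/-- Pairing the line field spread from a shell with `ψ_v` measures the mass of the resolvent on the
shell, as `σ r = |r|`. -/
lemma integral_sample_mul_ψ (h : Standing R K) (hE : IsAeInvariant R E) {v : ℂ}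
    (hv : v ∈ critValues R) (n : ℕ) :
    ∫ x, spread R (shell R K n ∩ E) (σ R v) x * ψ v x =
      ((∫ x in shell R K n ∩ E, ‖r R v x‖ : ℝ) : ℂ) := by
  have hΩ : ∀ᵐ x : ℂ, x ∈ shell R K n ∩ E → x ∈ Ω R := by
    filter_upwards [ae_primed_subset_Ω h.julia (h.fundamental n)] with x hx hxA
    exact hx (shell_subset n hxA.1)
  rw [← (integral_mul_resolvent h.denom_lt_num (h.isWandering_sample n)
    (h.nullMeasurableSet_sample hE n) hΩ (h.resolvent hv).1).2
    (aemeasurable_indicator_σ (h.nullMeasurableSet_sample hE n) (h.integrableOn_r_sample hv n))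
    (Eventually.of_forall (norm_indicator_σ_le v _)), ← integral_complex_ofReal]
  exact integral_congr_ae (Eventually.of_forall fun x => σ_mul_r v x)

lemma σn_ae_eq (h : Standing R K) (v : ℂ) (n : ℕ) :
    σn R K v n =ᵐ[volume] spread R (shell R K n) (σ R v) := by
  filter_upwards [ae_regularPts h.denom_lt_num] with z hz
  exact σn_eq_spread hz v n

lemma indicator_σn_ae_eq (h : Standing R K) (hE : IsAeInvariant R E) (v : ℂ) (n : ℕ) :
    E.indicator (σn R K v n) =ᵐ[volume] spread R (shell R K n ∩ E) (σ R v) := by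
  filter_upwards [h.σn_ae_eq v n, ae_iterate_mem_iff h.denom_lt_num hE.mem_iff] with z hz hEz
  rw [spread_inter hEz]
  by_cases hzE : z ∈ E
  · rw [indicator_of_mem hzE, indicator_of_mem hzE, hz]
  · rw [indicator_of_notMem hzE, indicator_of_notMem hzE]

lemma memLp_σn (h : Standing R K) {v : ℂ} (hv : v ∈ critValues R) (n : ℕ) :
    MemLp (σn R K v n) ⊤ volume := by
  have hm := h.aemeasurable_sample isAeInvariant_univ hv n
  have hb := h.ae_norm_sample_le (E := univ) v n
  rw [inter_univ] at hm hb
  exact (memLp_top_of_bound hm.aestronglyMeasurable 1 hb).ae_eq (h.σn_ae_eq v n).symm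

lemma nullMeasurableSet_backward_Kinf (h : Standing R K) :
    NullMeasurableSet (fin (backward R (Kinf K))) := by
  refine nullMeasurableSet_congr_ae (B := ⋃ i : ℕ, (fC R)^[i] ⁻¹' fin (Kinf K))
    (NullMeasurableSet.iUnion fun i => nullMeasurableSet_preimage_iterate h.denom_lt_num
      (nullMeasurableSet_Kinf h.fundamental) i) ?_
  filter_upwards [ae_regularPts h.denom_lt_num] with z hz
  rw [mem_fin_backward hz]
  simp

/-- A weak* limit vanishes where the sequence eventually does. -/
lemma ae_eq_zero_of_eventually (h : Standing R K) (hE : IsAeInvariant R E) {v : ℂ}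
    (hv : v ∈ critValues R) {φ : ℕ → ℕ} {ν : ℂ → ℂ} (hνm : AEMeasurable ν volume) {C : ℝ}
    (hνb : ∀ᵐ x : ℂ, ‖ν x‖ ≤ C)
    (hν : WeakStarTendsto (fun k => spread R (shell R K (φ k) ∩ E) (σ R v)) ν) {D : Set ℂ}
    (hD : NullMeasurableSet D)
    (hev : ∀ᵐ x : ℂ, x ∈ D → ∀ᶠ k in atTop, spread R (shell R K (φ k) ∩ E) (σ R v) x = 0) :
    ∀ᵐ x : ℂ, x ∈ D → ν x = 0 := by
  have key : D.indicator ν =ᵐ[volume] 0 := by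
    have hC : 0 ≤ C := by
      obtain ⟨x, hx⟩ := hνb.exists
      exact (norm_nonneg _).trans hx
    refine ae_eq_of_forall_integral_mul_eq (C := C) (hνm.indicator₀ hD) aemeasurable_const ?_
      (Eventually.of_forall fun x => by simpa using hC) fun g hg => ?_
    · filter_upwards [hνb] with x hx
      exact (norm_indicator_le_norm_self _ _).trans hx
    · have h1 := hν.2.2 _ (hg.indicator₀ hD)
      have e : ∀ f : ℂ → ℂ, ∫ x, f x * D.indicator g x = ∫ x, D.indicator f x * g x := by
        intro f
        refine integral_congr_ae (Eventually.of_forall fun x => ?_)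
        by_cases hx : x ∈ D <;> simp [hx]
      simp only [e] at h1
      have h2 := tendsto_integral_mul_zero
        (w := fun k => D.indicator (spread R (shell R K (φ k) ∩ E) (σ R v)))
        (fun k => (h.aemeasurable_sample hE hv _).indicator₀ hD)
        (fun k => by
          filter_upwards [h.ae_norm_sample_le (E := E) v (φ k)] with x hx
          exact (norm_indicator_le_norm_self _ _).trans hx)
        (by
          filter_upwards [hev] with x hx
          by_cases hxD : x ∈ D
          · filter_upwards [hx hxD] with k hk
            rw [indicator_of_mem hxD, hk]
          · exact Eventually.of_forall fun k => indicator_of_notMem hxD _) hg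
      rw [tendsto_nhds_unique h1 h2]
      simp
  filter_upwards [key] with x hx hxD
  rwa [indicator_of_mem hxD] at hx

/-- The weak* limits of the spread line fields are fixed points of `f^*` of norm at most `1`,
supported in `E` off the backward orbit of `K_∞`. -/
lemma weakStar_limit (h : Standing R K) (hE : IsAeInvariant R E) {v : ℂ}
    (hv : v ∈ critValues R) {φ : ℕ → ℕ} (hφ : Tendsto φ atTop atTop) {ν : ℂ → ℂ}
    (hν : WeakStarTendsto (fun k => spread R (shell R K (φ k) ∩ E) (σ R v)) ν) :
    AEMeasurable ν volume ∧ (∀ᵐ x : ℂ, ‖ν x‖ ≤ 1) ∧ push R ν =ᵐ[volume] ν ∧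
      VanishesOn ν (backward R (Kinf K)) ∧ (∀ᵐ x : ℂ, x ∉ E → ν x = 0) ∧
      Tendsto (fun k => ((∫ x in shell R K (φ k) ∩ E, ‖r R v x‖ : ℝ) : ℂ)) atTop
        (𝓝 (∫ x, ν x * ψ v x)) := by
  have hR := h.denom_lt_num
  have hm := fun k => h.aemeasurable_sample hE hv (φ k)
  have hb := fun k => h.ae_norm_sample_le (E := E) v (φ k)
  have hνm : AEMeasurable ν volume := hν.2.1.aestronglyMeasurable.aemeasurable
  obtain ⟨C, hνC⟩ : ∃ C : ℝ, ∀ᵐ x : ℂ, ‖ν x‖ ≤ C := by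
    refine ⟨(eLpNormEssSup ν volume).toReal, ?_⟩
    have hfin : eLpNormEssSup ν volume ≠ ⊤ := by
      have := hν.2.1.eLpNorm_ne_top
      rwa [eLpNorm_exponent_top] at this
    filter_upwards [ae_le_eLpNormEssSup (f := ν) (μ := volume)] with x hx
    rw [← toReal_enorm]
    exact ENNReal.toReal_mono hfin hx
  -- by compactness and uniqueness of limits
  have hbound : ∀ᵐ x : ℂ, ‖ν x‖ ≤ 1 := by
    obtain ⟨w, θ, hθ, hwm, hwb, hw⟩ := exists_weakStar_limit hm hb
    have hνw : ν =ᵐ[volume] w := ae_eq_of_forall_integral_mul_eq (C := max C 1) hνm hwm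
      (hνC.mono fun x hx => hx.trans (le_max_left _ _))
      (hwb.mono fun x hx => hx.trans (le_max_right _ _)) fun g hg =>
        tendsto_nhds_unique ((hν.2.2 g hg).comp hθ.tendsto_atTop) (hw.2.2 g hg)
    filter_upwards [hνw, hwb] with x hx hxb
    rwa [hx]
  have hpush : push R ν =ᵐ[volume] ν := by
    refine ae_eq_of_forall_integral_mul_eq (aemeasurable_push hR hνm) hνm
      (ae_norm_push_le hR hνC) hνC fun g hg => ?_
    rw [integral_push_mul hR hνm hνC hg]
    have h1 := hν.2.2 _ (integrable_T hR hg)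
    have h2 := hν.2.2 _ hg
    -- the defect of invariance is supported in the shells, which eventually avoid almost every
    -- point
    have h3 := tendsto_integral_mul_zero
      (w := fun k => (shell R K (φ k) ∩ E).indicator (σ R v))
      (fun k => aemeasurable_indicator_σ (h.nullMeasurableSet_sample hE _)
        (h.integrableOn_r_sample hv _))
      (fun k => Eventually.of_forall (norm_indicator_σ_le v _))
      (by
        filter_upwards [ae_regularPts hR] with x hx
        filter_upwards [hφ.eventually (eventually_notMem_shell h.anti hx)] with k hk
        exact indicator_of_notMem (fun h' => hk h'.1) _) hg
    have h4 := h2.sub h3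
    rw [sub_zero] at h4
    refine tendsto_nhds_unique (h1.congr fun k => ?_) h4
    rw [← integral_push_mul hR (hm k) (hb k) hg, ← integral_sub]
    · refine integral_congr_ae ?_
      filter_upwards [ae_regularPts hR] with x hx
      rw [push_spread (h.isWandering_sample _) hx, sub_mul]
    · exact hg.bdd_mul (hm k).aestronglyMeasurable (hb k)
    · exact hg.bdd_mul (aemeasurable_indicator_σ (h.nullMeasurableSet_sample hE _)
        (h.integrableOn_r_sample hv _)).aestronglyMeasurable
        (Eventually.of_forall (norm_indicator_σ_le v _))
  refine ⟨hνm, hbound, hpush, ?_, ?_, ?_⟩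
  · refine h.ae_eq_zero_of_eventually hE hv hνm hνC hν h.nullMeasurableSet_backward_Kinf ?_
    filter_upwards [ae_regularPts hR] with x hx hxb
    filter_upwards [hφ.eventually (eventually_iterate_notMem_shell h.fundamental h.anti hx hxb)]
      with k hk
    exact spread_of_notMem (fun i hi => hk i hi.1) _
  · refine h.ae_eq_zero_of_eventually hE hv hνm hνC hν hE.nullMeasurable.compl ?_
    filter_upwards [ae_iterate_mem_iff hR hE.mem_iff] with x hx hxE
    exact Eventually.of_forall fun k => spread_of_notMem (fun i hi => hxE ((hx i).1 hi.2)) _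
  · refine (hν.2.2 _ (integrable_ψ v)).congr fun k => ?_
    exact h.integral_sample_mul_ψ hE hv _

end Standing

end

/-! ### Pairing an invariant line field with the resolvent -/

section

variable {R : RatFunc ℂ} {K : ℕ → Set (OnePoint ℂ)} {E : Set ℂ}

lemma iterate_push_ae_eq (hR : R.denom.natDegree < R.num.natDegree) {μ : ℂ → ℂ}
    (hinv : push R μ =ᵐ[volume] μ) (i : ℕ) : (push R)^[i] μ =ᵐ[volume] μ := by
  induction i with
  | zero => exact EventuallyEq.rfl
  | succ i ih =>
    rw [Function.iterate_succ_apply]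
    exact (iterate_push_congr_ae hR hinv i).trans ih

lemma subset_backward (A : Set (OnePoint ℂ)) : A ⊆ backward R A :=
  fun _ hx => mem_iUnion.2 ⟨0, hx⟩

lemma primed_subset_backward (A : Set (OnePoint ℂ)) : primed R A ⊆ backward R A :=
  fun _ hx => mem_iUnion.2 ⟨1, hx.1⟩

namespace Standing

/-- The integrals of an invariant line field against the resolvent over `K_n'` recover its pairing
with the test function. -/
lemma tendsto_integral_primed (h : Standing R K) {v : ℂ} (hv : v ∈ critValues R) {μ : ℂ → ℂ}
    (hμm : AEMeasurable μ volume) (hμb : ∀ᵐ x : ℂ, ‖μ x‖ ≤ 1) (hinv : push R μ =ᵐ[volume] μ)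
    (hvan : VanishesOn μ (backward R (Kinf K))) :
    Tendsto (fun n => ∫ x in fin (primed R (K n)), μ x * r R v x) atTop
      (𝓝 (∫ x, μ x * ψ v x)) := by
  have hR := h.denom_lt_num
  have hmK := fun n => (h.fundamental n).measurable
  have hmA := fun n => nullMeasurableSet_primed hR (hmK n)
  have hbi : ∀ A : Set ℂ, ∀ᵐ x : ℂ, ‖A.indicator μ x‖ ≤ 1 := fun A => by
    filter_upwards [hμb] with x hx
    exact (norm_indicator_le_norm_self _ _).trans hx
  have h0 := tendsto_integral_mul_zero (w := fun n => (fin (K n)).indicator μ)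
    (fun n => hμm.indicator₀ (hmK n)) (fun n => hbi _)
    (by
      filter_upwards [hvan] with x hx
      filter_upwards [eventually_notMem_diff_Kinf h.anti x] with n hn
      by_cases hxn : x ∈ fin (K n)
      · rw [indicator_of_mem hxn]
        exact hx (subset_backward _ (hn hxn))
      · exact indicator_of_notMem hxn _) (integrable_ψ v)
  have h1 := (tendsto_const_nhds (x := ∫ x, μ x * ψ v x)).sub h0
  rw [sub_zero] at h1
  refine h1.congr fun n => ?_
  rw [(integral_mul_resolvent hR (isWandering_primed (h.fundamental n).mapsTo) (hmA n)
    (ae_primed_subset_Ω h.julia (h.fundamental n)) (h.resolvent hv).1).2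
    (hμm.indicator₀ (hmA n)) (hbi _), ← integral_sub
    ((integrable_ψ v).bdd_mul hμm.aestronglyMeasurable hμb)
    ((integrable_ψ v).bdd_mul (hμm.indicator₀ (hmK n)).aestronglyMeasurable (hbi _))]
  refine integral_congr_ae ?_
  filter_upwards [ae_mem_or_iterate_mem hR h.julia (h.fundamental n), ae_regularPts hR,
    ae_all_iff.2 fun i => iterate_push_ae_eq hR hinv i] with x hx hr hi
  rw [← sub_mul]
  congr 1
  by_cases hxK : x ∈ fin (K n)
  · rw [indicator_of_mem hxK, sub_self, spread_of_notMem]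
    intro i hmem
    exact hx.2 ⟨i, hmem⟩ hxK
  · obtain ⟨i, hmem⟩ := hx.1 hxK
    rw [indicator_of_notMem hxK, sub_zero,
      spread_of_mem (isWandering_primed (h.fundamental n).mapsTo) hr hmem, hi i]

/-- An invariant line field carried by `E` off the backward orbit of `K_∞` vanishes on `K_n'`
outside the shell and outside `E`, and has modulus at most `1`. -/
lemma norm_integral_primed_le (h : Standing R K) {v : ℂ}
    (hv : v ∈ critValues R) {μ : ℂ → ℂ} (hμb : ∀ᵐ x : ℂ, ‖μ x‖ ≤ 1)
    (hvan : VanishesOn μ (backward R (Kinf K))) (hμE : ∀ᵐ x : ℂ, x ∉ E → μ x = 0) (n : ℕ) :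
    ‖∫ x in fin (primed R (K n)), μ x * r R v x‖ ≤ ∫ x in shell R K n ∩ E, ‖r R v x‖ := by
  have hmA := nullMeasurableSet_primed h.denom_lt_num (h.fundamental n).measurable
  have e : ∫ x in fin (primed R (K n)), μ x * r R v x =
      ∫ x in shell R K n ∩ E, μ x * r R v x := by
    refine setIntegral_eq_of_subset_of_ae_sdiff_eq_zero hmA
      (inter_subset_left.trans (shell_subset n)) ?_
    filter_upwards [hvan, hμE] with x hx hxE hmem
    have : μ x = 0 := by
      by_cases hxEm : x ∈ E
      · refine hx (primed_subset_backward _ ?_)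
        by_contra hc
        exact hmem.2 ⟨⟨hmem.1, hc⟩, hxEm⟩
      · exact hxE hxEm
    rw [this, zero_mul]
  rw [e]
  refine (norm_integral_le_integral_norm _).trans ?_
  refine integral_mono_of_nonneg (Eventually.of_forall fun x => norm_nonneg _)
    (h.integrableOn_r_sample hv n).norm (ae_restrict_of_ae ?_)
  filter_upwards [hμb] with x hx
  rw [norm_mul]
  exact mul_le_of_le_one_left (norm_nonneg _) hx

lemma lintegral_shell (h : Standing R K) {v : ℂ} (hv : v ∈ critValues R) (n : ℕ) :
    ∫⁻ x in fin (primed R (K n) \ primed R (Kinf K)), ‖r R v x‖ₑ =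
      ENNReal.ofReal (∫ x in shell R K n, ‖r R v x‖) :=
  (ofReal_integral_norm_eq_lintegral_enorm
    ((h.integrableOn_r_primed hv n).mono_set (shell_subset n))).symm

/-- An invariant line field that pairs nontrivially with `ψ_v` forces the resolvent to keep a
definite mass on the shells. -/
lemma liminf_pos_of_integral_ne_zero (h : Standing R K) {v : ℂ} (hv : v ∈ critValues R)
    {μ : ℂ → ℂ} (hμm : AEMeasurable μ volume) (hμb : ∀ᵐ x : ℂ, ‖μ x‖ ≤ 1)
    (hinv : push R μ =ᵐ[volume] μ) (hvan : VanishesOn μ (backward R (Kinf K)))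
    (hI : ∫ x, μ x * ψ v x ≠ 0) :
    0 < liminf (fun n => ∫⁻ x in fin (primed R (K n) \ primed R (Kinf K)), ‖r R v x‖ₑ) atTop := by
  have hpos : 0 < ‖∫ x, μ x * ψ v x‖ := norm_pos_iff.2 hI
  have ht := (h.tendsto_integral_primed hv hμm hμb hinv hvan).norm
  refine lt_of_lt_of_le (ENNReal.ofReal_pos.2 (half_pos hpos))
    (le_liminf_of_le (by isBoundedDefault) ?_)
  filter_upwards [ht.eventually_const_le (half_lt_self hpos)] with n hn
  rw [h.lintegral_shell hv]
  refine ENNReal.ofReal_le_ofReal (hn.trans ?_)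
  have := h.norm_integral_primed_le (E := univ) hv hμb hvan
    (Eventually.of_forall fun x hx => absurd (mem_univ x) hx) n
  rwa [inter_univ] at this

/-- If the resolvent keeps a definite mass on the shells, then every weak* limit of the spread line
fields is a nontrivial fixed point of `f^*`. -/
lemma weakStar_limit_σn (h : Standing R K) {v : ℂ} (hv : v ∈ critValues R)
    (hlim : 0 < liminf (fun n => ∫⁻ x in fin (primed R (K n) \ primed R (Kinf K)), ‖r R v x‖ₑ)
      atTop) {ν : ℂ → ℂ} {φ : ℕ → ℕ} (hφ : StrictMono φ)
    (hν : WeakStarTendsto (fun k => σn R K v (φ k)) ν) :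
    ¬ (ν =ᵐ[volume] 0) ∧ push R ν =ᵐ[volume] ν ∧ (∀ᵐ x : ℂ, ‖ν x‖ ≤ 1) ∧
      VanishesOn ν (backward R (Kinf K)) := by
  have hν' : WeakStarTendsto (fun k => spread R (shell R K (φ k) ∩ univ) (σ R v)) ν := by
    simp only [inter_univ]
    refine ⟨fun k => (memLp_congr_ae (h.σn_ae_eq v (φ k))).1 (hν.1 k), hν.2.1, fun g hg => ?_⟩
    refine (hν.2.2 g hg).congr fun k => integral_congr_ae ?_
    filter_upwards [h.σn_ae_eq v (φ k)] with x hx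
    rw [hx]
  obtain ⟨-, hb, hp, hvan, -, ht⟩ :=
    h.weakStar_limit isAeInvariant_univ hv hφ.tendsto_atTop hν'
  refine ⟨fun h0 => ?_, hp, hb, hvan⟩
  obtain ⟨c, hc0, hc⟩ := exists_between hlim
  have hI : ∫ x, ν x * ψ v x = 0 := by
    refine integral_eq_zero_of_ae ?_
    filter_upwards [h0] with x hx
    simp [hx]
  rw [hI] at ht
  have ht' : Tendsto (fun k => ENNReal.ofReal (∫ x in shell R K (φ k), ‖r R v x‖)) atTop (𝓝 0) := by
    have := ENNReal.tendsto_ofReal ((Complex.continuous_re.tendsto _).comp ht)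
    simpa [Function.comp_def] using this
  obtain ⟨k, hk1, hk2⟩ := ((hφ.tendsto_atTop.eventually (eventually_lt_of_lt_liminf hc)).and
    (ht'.eventually_lt_const hc0)).exists
  rw [h.lintegral_shell hv] at hk1
  exact lt_asymm hk1 hk2

end Standing

/-! ### Normalizing fixed points of `f^*` -/

/-- The radial projection to the unit circle, cut off to the points with modulus in `U`. -/
def direction (U : Set ℝ) : ℂ → ℂ := (norm ⁻¹' U).indicator fun z => z / ‖z‖

lemma measurable_direction {U : Set ℝ} (hU : MeasurableSet U) : Measurable (direction U) :=
  (measurable_id.div (Complex.measurable_ofReal.comp measurable_norm)).indicator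
    (measurable_norm hU)

lemma norm_direction {U : Set ℝ} (h0 : (0 : ℝ) ∉ U) {z : ℂ} (hz : ‖z‖ ∈ U) :
    ‖direction U z‖ = 1 := by
  have : ‖z‖ ≠ 0 := fun h => h0 (h ▸ hz)
  rw [direction, indicator_of_mem (show z ∈ norm ⁻¹' U from hz), norm_div, Complex.norm_real,
    norm_norm, div_self this]

lemma direction_of_notMem {U : Set ℝ} {z : ℂ} (hz : ‖z‖ ∉ U) : direction U z = 0 :=
  indicator_of_notMem (show z ∉ norm ⁻¹' U from hz) _

lemma direction_mul {U : Set ℝ} {e : ℂ} (he : ‖e‖ = 1) (z : ℂ) :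
    direction U (z * e) = direction U z * e := by
  by_cases hz : ‖z‖ ∈ U
  · rw [direction, indicator_of_mem (show z ∈ norm ⁻¹' U from hz),
      indicator_of_mem (show z * e ∈ norm ⁻¹' U by simpa [he] using hz)]
    simp [he, div_mul_eq_mul_div]
  · rw [direction_of_notMem hz, direction_of_notMem (by simpa [he] using hz), zero_mul]

lemma exists_unimodular_push (x : ℂ) (hx : x ∈ unramified R) :
    ∃ e : ℂ, ‖e‖ = 1 ∧ ∀ ν : ℂ → ℂ, push R ν x = ν (fC R x) * e := by
  refine ⟨(‖fD R x‖ : ℂ) ^ 2 / fD R x ^ 2, ?_, fun ν => rfl⟩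
  have := norm_push hx (fun _ => 1)
  simpa [push] using this

/-- As `f^*` multiplies values by unimodular factors, the part of a fixed point whose modulus lies
in `U` can be normalized to an invariant line field. -/
lemma isInvariantLineField_direction (hR : R.denom.natDegree < R.num.natDegree)
    (hJ : juliaSet R = Set.univ) {ν : ℂ → ℂ} (hm : AEMeasurable ν volume)
    (hν : push R ν =ᵐ[volume] ν) {U : Set ℝ} (hU : MeasurableSet U) (h0 : (0 : ℝ) ∉ U)
    (hpos : volume {x | ‖ν x‖ ∈ U} ≠ 0) : IsInvariantLineField R fun x => direction U (ν x) where
  aemeasurable := (measurable_direction hU).comp_aemeasurable hm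
  unimodular := Eventually.of_forall fun x => by
    by_cases hx : ‖ν x‖ ∈ U
    · exact Or.inr ⟨norm_direction h0 hx, by rw [hJ]; trivial⟩
    · exact Or.inl (direction_of_notMem hx)
  nontrivial := by
    refine (pos_iff_ne_zero.2 hpos).trans_le (measure_mono fun x hx => ?_)
    have := norm_direction h0 (z := ν x) hx
    exact fun hc => by simp [hc] at this
  invariant := by
    filter_upwards [ae_unramified hR, hν] with x hx hxν
    obtain ⟨e, he, hpush⟩ := exists_unimodular_push x hx
    rw [hpush, ← direction_mul he, ← hpush, hxν]

namespace Standing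

/-- Invariant line fields off the backward orbit of `K_∞` exist exactly if some resolvent keeps a
definite mass on the shells. -/
theorem exists_invariantLineField_iff (h : Standing R K) :
    (∃ μ : ℂ → ℂ, IsInvariantLineField R μ ∧ VanishesOn μ (backward R (Kinf K))) ↔
      ∃ v ∈ critValues R, 0 < liminf (fun n =>
        ∫⁻ x in fin (primed R (K n) \ primed R (Kinf K)), ‖r R v x‖ₑ) atTop := by
  constructor
  · rintro ⟨μ, hμ, hvan⟩
    have hb : ∀ᵐ x : ℂ, ‖μ x‖ ≤ 1 := by
      filter_upwards [hμ.unimodular] with x hx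
      rcases hx with hx | hx
      · simp [hx]
      · exact hx.1.le
    obtain ⟨v, hv, hI⟩ := exists_integral_ψ_ne_zero h.denom_lt_num h.map_infty h.map_one
      h.map_zero h.julia hμ.aemeasurable hb hμ.invariant
      fun h0 => hμ.nontrivial.ne' (ae_iff.1 h0)
    exact ⟨v, hv, h.liminf_pos_of_integral_ne_zero hv hμ.aemeasurable hb hμ.invariant hvan hI⟩
  · rintro ⟨v, hv, hlim⟩
    obtain ⟨ν, φ, hφ, hm, -, hν⟩ := exists_weakStar_limit
      (fun n => (h.memLp_σn hv n).aestronglyMeasurable.aemeasurable) (fun n => by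
        filter_upwards [h.σn_ae_eq v n, h.ae_norm_sample_le (E := univ) v n] with x hx hb
        rw [inter_univ] at hb
        rwa [hx])
    obtain ⟨h0, hp, -, hvan⟩ := h.weakStar_limit_σn hv hlim hφ hν
    refine ⟨fun x => direction (Ioi 0) (ν x), isInvariantLineField_direction h.denom_lt_num h.julia
      hm hp measurableSet_Ioi (by simp) fun hc => h0 ?_, ?_⟩
    · refine ae_iff.2 ?_
      simpa using hc
    · filter_upwards [hvan] with x hx hxb
      exact direction_of_notMem (by simp [hx hxb])

end Standing

end

/-! ### Ergodic line fields -/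

section

variable {R : RatFunc ℂ} {K : ℕ → Set (OnePoint ℂ)} {E : Set ℂ} {μ : ℂ → ℂ}

lemma fin_E (μ : ℂ → ℂ) : fin (RatDyn.E μ) = Function.support μ :=
  preimage_image_eq _ OnePoint.coe_injective

lemma notMem_E_iff {x : ℂ} : (x : OnePoint ℂ) ∈ (RatDyn.E μ)ᶜ ↔ x ∉ Function.support μ := by
  rw [← fin_E μ]; rfl

lemma IsInvariantLineField.ae_norm_le (h : IsInvariantLineField R μ) : ∀ᵐ x : ℂ, ‖μ x‖ ≤ 1 := by
  filter_upwards [h.unimodular] with x hx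
  rcases hx with hx | hx
  · simp [hx]
  · exact hx.1.le

lemma IsInvariantLineField.ae_norm_eq (h : IsInvariantLineField R μ) :
    ∀ᵐ x : ℂ, x ∈ Function.support μ → ‖μ x‖ = 1 := by
  filter_upwards [h.unimodular] with x hx hxs
  exact (hx.resolve_left hxs).1

lemma IsInvariantLineField.nullMeasurableSet_support (h : IsInvariantLineField R μ) :
    NullMeasurableSet (Function.support μ) :=
  h.aemeasurable.nullMeasurable (measurableSet_singleton 0).compl

namespace IsErgodicInvariantLineField

lemma isAeInvariant (hR : R.denom.natDegree < R.num.natDegree)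
    (hμ : IsErgodicInvariantLineField R μ) : IsAeInvariant R (Function.support μ) where
  nullMeasurable := hμ.nullMeasurableSet_support
  mem_iff := by
    filter_upwards [hμ.completely_invariant, ae_regularPts hR] with x hx hr
    rw [show toMap R x = _ from toMap_coe_of_ne (hr 0)] at hx
    rwa [← fin_E]

lemma const_mul (hμ : IsErgodicInvariantLineField R μ) {t : ℂ} (ht : ‖t‖ = 1) :
    IsErgodicInvariantLineField R fun x => t * μ x := by
  have ht0 : t ≠ 0 := norm_ne_zero_iff.1 (by simp [ht])
  have hs : Function.support (fun x => t * μ x) = Function.support μ := by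
    ext x; simp [ht0]
  have hE : RatDyn.E (fun x => t * μ x) = RatDyn.E μ := by rw [RatDyn.E, RatDyn.E, hs]
  refine ⟨⟨hμ.aemeasurable.const_mul t, ?_, by rw [hs]; exact hμ.nontrivial, ?_⟩,
    by rw [hE]; exact hμ.completely_invariant, by rw [hE]; exact hμ.ergodic, fun ν hν hvan => ?_⟩
  · filter_upwards [hμ.unimodular] with x hx
    rcases hx with hx | hx
    · simp [hx]
    · exact Or.inr ⟨by simp [ht, hx.1], hx.2⟩
  · filter_upwards [hμ.invariant] with x hx
    rw [← hx, push, push]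
    ring
  · rw [hE] at hvan
    obtain ⟨s, hs1, hs⟩ := hμ.unique ν hν hvan
    refine ⟨s * t⁻¹, by simp [hs1, ht], ?_⟩
    filter_upwards [hs] with x hx
    rw [hx]
    field_simp

/-- Fixed points of `f^*` carried by the support of an ergodic line field are multiples of it: the
level sets of the modulus carry invariant line fields, so the modulus is constant. -/
lemma exists_eq_const_mul (hR : R.denom.natDegree < R.num.natDegree)
    (hJ : juliaSet R = Set.univ) (hμ : IsErgodicInvariantLineField R μ) {ν : ℂ → ℂ}
    (hm : AEMeasurable ν volume) (hν : push R ν =ᵐ[volume] ν)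
    (hsupp : ∀ᵐ x : ℂ, x ∉ Function.support μ → ν x = 0) :
    ∃ c : ℂ, ν =ᵐ[volume] fun x => c * μ x := by
  have hS := hμ.nullMeasurableSet_support
  have hdir : ∀ U : Set ℝ, MeasurableSet U → (0 : ℝ) ∉ U → volume {x | ‖ν x‖ ∈ U} ≠ 0 →
      ∃ t : ℂ, ‖t‖ = 1 ∧ (fun x => direction U (ν x)) =ᵐ[volume] fun x => t * μ x := by
    intro U hU h0 hpos
    refine hμ.unique _ (isInvariantLineField_direction hR hJ hm hν hU h0 hpos) ?_
    filter_upwards [hsupp] with x hx hxE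
    exact direction_of_notMem (by rwa [hx (notMem_E_iff.1 hxE), norm_zero])
  -- the direction of `ν` on a level set of the modulus is a rotation of `μ`, so the level set is
  -- null or the whole support
  have hdich : ∀ U : Set ℝ, MeasurableSet U → (0 : ℝ) ∉ U →
      (∀ᵐ x ∂(volume.restrict (Function.support μ)), ‖ν x‖ ∈ U) ∨
        ∀ᵐ x ∂(volume.restrict (Function.support μ)), ‖ν x‖ ∉ U := by
    intro U hU h0
    by_cases hpos : volume {x | ‖ν x‖ ∈ U} = 0
    · exact Or.inr (ae_restrict_of_ae (compl_mem_ae_iff.2 hpos))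
    · obtain ⟨t, ht, hteq⟩ := hdir U hU h0 hpos
      refine Or.inl ((ae_restrict_iff'₀ hS).2 ?_)
      filter_upwards [hteq] with x hx hxS
      by_contra hc
      rw [direction_of_notMem hc] at hx
      have ht0 : t ≠ 0 := norm_ne_zero_iff.1 (by simp [ht])
      exact (mul_ne_zero ht0 hxS) hx.symm
  obtain ⟨c, hc⟩ := exists_eventuallyEq_const_of_forall_separating
    (l := ae (volume.restrict (Function.support μ))) (f := fun x => ‖ν x‖) MeasurableSet (by
      intro U hU
      by_cases h0 : (0 : ℝ) ∈ U
      · rcases hdich Uᶜ hU.compl (by simpa using h0) with h | h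
        · exact Or.inr h
        · exact Or.inl (by simpa using h)
      · exact hdich U hU h0)
  have hc' : ∀ᵐ x : ℂ, x ∈ Function.support μ → ‖ν x‖ = c := (ae_restrict_iff'₀ hS).1 hc
  by_cases hc0 : c = 0
  · refine ⟨0, ?_⟩
    filter_upwards [hc', hsupp] with x hx hxs
    rw [zero_mul]
    by_cases hxS : x ∈ Function.support μ
    · exact norm_eq_zero.1 ((hx hxS).trans hc0)
    · exact hxs hxS
  · obtain ⟨t, -, hteq⟩ := hdir {0}ᶜ (measurableSet_singleton 0).compl (by simp) fun h0 => by
      refine hμ.nontrivial.ne' (measure_mono_null_ae ?_ h0)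
      filter_upwards [hc'] with x hx hxS
      show ‖ν x‖ ≠ 0
      rwa [hx hxS]
    refine ⟨c * t, ?_⟩
    filter_upwards [hc', hsupp, hteq] with x hx hxs hxt
    by_cases hxS : x ∈ Function.support μ
    · have hne : ‖ν x‖ ≠ 0 := by rwa [hx hxS]
      rw [mul_assoc, ← hxt, ← hx hxS, direction,
        indicator_of_mem (show ν x ∈ norm ⁻¹' {0}ᶜ from hne)]
      have : (‖ν x‖ : ℂ) ≠ 0 := by exact_mod_cast hne
      field_simp
    · rw [hxs hxS, Function.notMem_support.1 hxS, mul_zero]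

end IsErgodicInvariantLineField

/-! ### Convergence in measure -/

/-- A sequence in the unit ball of `L_∞` that converges weak* to a function of modulus `1` on a set
converges to it in measure there, because the unit disc is strictly convex. -/
lemma tendstoInMeasure_of_weakStar {S F : Set ℂ} (hS : NullMeasurableSet S)
    (hF : MeasurableSet F) (hFfin : volume F < ⊤) {u : ℕ → ℂ → ℂ}
    (hub : ∀ n, ∀ᵐ x : ℂ, ‖u n x‖ ≤ 1) (hμS : ∀ᵐ x : ℂ, x ∈ S → ‖μ x‖ = 1)
    (h : WeakStarTendsto u μ) : TendstoInMeasure (volume.restrict (S ∩ F)) u atTop μ := by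
  have hA : NullMeasurableSet (S ∩ F) := hS.inter hF.nullMeasurableSet
  have hAfin : volume (S ∩ F) ≠ ⊤ := (measure_mono inter_subset_right).trans_lt hFfin |>.ne
  have hμm := h.2.1.aestronglyMeasurable
  set g : ℂ → ℂ := (S ∩ F).indicator fun x => (starRingEnd ℂ) (μ x) with hg
  have hgint : Integrable g := by
    refine IntegrableOn.integrable_indicator₀ ?_ hA
    refine Measure.integrableOn_of_bounded (M := 1) hAfin
      (Complex.continuous_conj.comp_aestronglyMeasurable hμm) ?_
    refine (ae_restrict_iff'₀ hA).2 ?_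
    filter_upwards [hμS] with x hx hxA
    simpa using (hx hxA.1).le
  have hui : ∀ n, Integrable fun x => u n x * g x := fun n =>
    hgint.bdd_mul (h.1 n).aestronglyMeasurable (hub n)
  have hμi : Integrable fun x => μ x * g x := by
    refine (hgint.norm.mono' (hμm.mul hgint.aestronglyMeasurable) ?_)
    filter_upwards [hμS] with x hx
    by_cases hxA : x ∈ S ∩ F
    · rw [norm_mul, hx hxA.1, one_mul]
    · simp [hg, hxA]
  -- for `|μ| = 1` and `|u| ≤ 1`, `|u - μ|² ≤ 2 Re ((μ - u) μ̄)`, and the integral of the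
  -- right-hand side tends to `0`
  set d : ℕ → ℂ → ℝ := fun n x => 2 * (μ x * g x - u n x * g x).re with hd
  have hdi : ∀ n, Integrable (d n) := fun n => ((hμi.sub (hui n)).re).const_mul 2
  have hdI : Tendsto (fun n => ∫ x, d n x) atTop (𝓝 0) := by
    have h1 := ((Complex.continuous_re.tendsto _).comp
      ((tendsto_const_nhds (x := ∫ x, μ x * g x)).sub (h.2.2 g hgint))).const_mul 2
    rw [sub_self, Complex.zero_re, mul_zero] at h1
    refine h1.congr fun n => ?_
    simp only [hd, Function.comp_apply]
    rw [integral_const_mul, ← integral_sub hμi (hui n)]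
    congr 1
    exact (integral_re (hμi.sub (hui n))).symm
  have hpt : ∀ n, ∀ᵐ x : ℂ, (x ∈ S ∩ F → ‖u n x - μ x‖ ^ 2 ≤ d n x) ∧ 0 ≤ d n x := by
    intro n
    filter_upwards [hμS, hub n] with x hx hxu
    by_cases hxA : x ∈ S ∩ F
    · have hle : ‖u n x - μ x‖ ^ 2 ≤ d n x := by
        have e1 : ‖μ x‖ ^ 2 = 1 := by rw [hx hxA.1, one_pow]
        have e2 : ‖u n x‖ ^ 2 ≤ 1 := pow_le_one₀ (norm_nonneg _) hxu
        rw [← Complex.normSq_eq_norm_sq, Complex.normSq_apply] at e1 e2 ⊢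
        simp only [hd, hg, indicator_of_mem hxA, Complex.sub_re, Complex.sub_im, Complex.mul_re,
          Complex.conj_re, Complex.conj_im]
        nlinarith
      exact ⟨fun _ => hle, (sq_nonneg _).trans hle⟩
    · exact ⟨fun hc => absurd hc hxA, by simp [hd, hg, hxA]⟩
  refine tendstoInMeasure_iff_norm.2 fun ε hε => ?_
  have hε2 : 0 < ε ^ 2 := pow_pos hε 2
  have hlim : Tendsto (fun n => ENNReal.ofReal (∫ x, d n x) / ENNReal.ofReal (ε ^ 2)) atTop
      (𝓝 0) := by
    have h1 := ENNReal.Tendsto.div_const (ENNReal.tendsto_ofReal hdI)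
      (b := ENNReal.ofReal (ε ^ 2)) (Or.inr (ENNReal.ofReal_pos.2 hε2).ne')
    simpa using h1
  refine tendsto_of_tendsto_of_tendsto_of_le_of_le tendsto_const_nhds hlim
    (fun n => bot_le) fun n => ?_
  have h1 : volume.restrict (S ∩ F) {x | ε ≤ ‖u n x - μ x‖} ≤
      volume {x | ENNReal.ofReal (ε ^ 2) ≤ ENNReal.ofReal (d n x)} := by
    refine (measure_mono_ae ?_).trans (Measure.restrict_apply_le _ _)
    refine (ae_restrict_iff'₀ hA).2 ?_
    filter_upwards [hpt n] with x hx hxA hxε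
    exact ENNReal.ofReal_le_ofReal ((pow_le_pow_left₀ hε.le hxε 2).trans (hx.1 hxA))
  refine h1.trans ?_
  rw [ofReal_integral_eq_lintegral_ofReal (hdi n) ((hpt n).mono fun x hx => hx.2)]
  -- Chebyshev
  exact meas_ge_le_lintegral_div (hdi n).aestronglyMeasurable.aemeasurable.ennreal_ofReal
    (ENNReal.ofReal_pos.2 hε2).ne' ENNReal.ofReal_ne_top

end

/-! ### Asymptotic extremality -/

section

variable {R : RatFunc ℂ} {K : ℕ → Set (OnePoint ℂ)} {μ : ℂ → ℂ} {v : ℂ} {s : ℝ}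

/-- Along an orbit without critical points and poles, `(f^i)^*` multiplies values by a unimodular
factor that does not depend on the line field. -/
lemma exists_unimodular_iterate_push (i : ℕ) : ∀ {x : ℂ}, (∀ k, (fC R)^[k] x ∈ unramified R) →
    ∃ e : ℂ, ‖e‖ = 1 ∧ ∀ ν : ℂ → ℂ, (push R)^[i] ν x = ν ((fC R)^[i] x) * e := by
  induction i with
  | zero => exact fun _ => ⟨1, by simp, fun ν => by simp⟩
  | succ i ih =>
    intro x hx
    obtain ⟨e, he, h⟩ := exists_unimodular_push x (hx 0)
    obtain ⟨e', he', h'⟩ := ih (x := fC R x) fun k => by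
      simpa only [Function.iterate_succ_apply] using hx (k + 1)
    refine ⟨e' * e, by simp [he, he'], fun ν => ?_⟩
    rw [Function.iterate_succ_apply', h, h', Function.iterate_succ_apply, mul_assoc]

/-- The mass of the resolvent on `E_μ ∩ K_n'` is its mass on the part of the shell in `E_μ`. -/
lemma integral_norm_r_E (hvan : VanishesOn μ (backward R (Kinf K))) (v : ℂ) (n : ℕ) :
    ∫ x in fin (RatDyn.E μ ∩ primed R (K n)), ‖r R v x‖ =
      ∫ x in shell R K n ∩ Function.support μ, ‖r R v x‖ := by
  refine setIntegral_congr_set ?_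
  filter_upwards [hvan] with x hx
  refine propext ⟨fun hm => ?_, fun hm => ?_⟩
  · have hxS : x ∈ Function.support μ := by rw [← fin_E μ]; exact hm.1
    exact ⟨⟨hm.2, fun hc => hxS (hx (primed_subset_backward _ hc))⟩, hxS⟩
  · have hxS : x ∈ fin (RatDyn.E μ) := by rw [fin_E]; exact hm.2
    exact ⟨hxS, hm.1.1⟩

namespace Standing

section
variable (h : Standing R K) (hμ : IsErgodicInvariantLineField R μ)
  (hvan : VanishesOn μ (backward R (Kinf K)))
include h hμ hvan

/-- The difference of the spread line field and `μ` has the modulus of `Δ_n`: both fields are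
transported along an orbit by the same unimodular factor. -/
lemma ae_norm_Δn_le (v : ℂ) (n : ℕ) : ∀ᵐ x : ℂ, x ∈ Function.support μ →
    ‖Δn R K v μ n x‖ ≤ ‖(Function.support μ).indicator (σn R K v n) x - μ x‖ := by
  have hR := h.denom_lt_num
  have hE := hμ.isAeInvariant hR
  filter_upwards [ae_regularPts hR, ae_iterate hR (ae_unramified hR), hvan,
    h.indicator_σn_ae_eq hE v n,
    ae_all_iff.2 fun i => iterate_push_ae_eq hR hμ.invariant i] with x hr hu hx hσ hi hxS
  classical
  by_cases hex : ∃ j : ℕ, (toMap R)^[j] (x : OnePoint ℂ) ∈ primed R (K n) ∩ RatDyn.E μ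
  · have hj := Nat.find_spec hex
    simp only [Δn, dif_pos hex]
    generalize Nat.find hex = j at hj ⊢
    rw [iterate_toMap_coe hr] at hj ⊢
    have hjS : (fC R)^[j] x ∈ Function.support μ := by rw [← fin_E μ]; exact hj.2
    have hjA : (fC R)^[j] x ∈ shell R K n ∩ Function.support μ := by
      refine ⟨⟨hj.1, fun hc => hxS (hx ?_)⟩, hjS⟩
      refine mem_iUnion.2 ⟨j + 1, ?_⟩
      rw [mem_preimage, Function.iterate_succ_apply', iterate_toMap_coe hr]
      exact hc.1
    obtain ⟨e, he, hpush⟩ := exists_unimodular_iterate_push j hu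
    rw [hσ, spread_of_mem (h.isWandering_sample n) hr hjA, ← hi j, hpush, hpush, ← sub_mul,
      norm_mul, he, mul_one, norm_sub_rev]
    exact le_rfl
  · simp only [Δn, dif_neg hex, norm_zero]
    exact norm_nonneg _

/-- Almost every orbit in the support passes through the sets `K_n'` once `n` is large. -/
lemma tendsto_volume_notMem_backward {F : Set ℂ} (hF : MeasurableSet F) (hFfin : volume F < ⊤) :
    Tendsto (fun n => volume ((fin (RatDyn.E μ) ∩ F) \
      fin (backward R (primed R (K n) ∩ RatDyn.E μ)))) atTop (𝓝 0) := by
  have hR := h.denom_lt_num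
  have hE := hμ.isAeInvariant hR
  have hlim := tendsto_measure_iInter_atTop (μ := (volume : Measure ℂ))
    (s := fun n => Function.support μ ∩ F ∩ fin (K n))
    (fun n => (hE.nullMeasurable.inter hF.nullMeasurableSet).inter (h.fundamental n).measurable)
    (fun m n hmn x hx => ⟨hx.1, h.anti hmn hx.2⟩)
    ⟨0, ((measure_mono fun x hx => hx.1.2).trans_lt hFfin).ne⟩
  have h0 : volume (⋂ n, Function.support μ ∩ F ∩ fin (K n)) = 0 := by
    refine measure_mono_null (fun x hx => ?_) (ae_iff.1 hvan)
    have hx' := fun n => mem_iInter.1 hx n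
    exact fun hc => (hx' 0).1.1 (hc (subset_backward _ (mem_fin_Kinf.2 fun n => (hx' n).2)))
  rw [h0] at hlim
  refine tendsto_of_tendsto_of_tendsto_of_le_of_le tendsto_const_nhds hlim
    (fun n => bot_le) fun n => measure_mono_ae ?_
  filter_upwards [ae_regularPts hR, ae_iterate_mem_iff hR hE.mem_iff,
    ae_mem_or_iterate_mem hR h.julia (h.fundamental n)] with x hr hi hx hmem
  obtain ⟨⟨hxE, hxF⟩, hxb⟩ := hmem
  rw [fin_E] at hxE
  refine ⟨⟨hxE, hxF⟩, ?_⟩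
  by_contra hc
  obtain ⟨i, hiK⟩ := hx.1 hc
  refine hxb ((mem_fin_backward hr).2 ⟨i, hiK, ?_⟩)
  have : (fC R)^[i] x ∈ fin (RatDyn.E μ) := by rw [fin_E]; exact (hi i).2 hxE
  exact this

variable (hv : v ∈ critValues R) (hs : 0 < s) (hI : ∫ x, μ x * ψ v x = (s : ℂ))
include hv hs hI

/-- Every weak* limit of the line fields spread from the shells inside `E_μ` is `μ`: it is a
multiple `c μ` with `|c| ≤ 1`, and its pairing with `ψ_v` is real and at least that of `μ`. -/
lemma weakStar_limit_eq {φ : ℕ → ℕ} (hφ : Tendsto φ atTop atTop) {ν : ℂ → ℂ}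
    (hν : WeakStarTendsto
      (fun k => spread R (shell R K (φ k) ∩ Function.support μ) (σ R v)) ν) :
    ν =ᵐ[volume] μ ∧
      Tendsto (fun k => ∫ x in shell R K (φ k) ∩ Function.support μ, ‖r R v x‖) atTop (𝓝 s) := by
  have hR := h.denom_lt_num
  obtain ⟨hm, hb, hp, -, hsupp, ht⟩ := h.weakStar_limit (hμ.isAeInvariant hR) hv hφ hν
  obtain ⟨c, hc⟩ := hμ.exists_eq_const_mul hR h.julia hm hp hsupp
  have hνI : ∫ x, ν x * ψ v x = c * s := by
    rw [← hI, ← integral_const_mul]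
    refine integral_congr_ae ?_
    filter_upwards [hc] with x hx
    rw [hx, mul_assoc]
  rw [hνI] at ht
  have hc1 : ‖c‖ ≤ 1 := by
    by_contra hcon
    refine hμ.nontrivial.ne' (measure_eq_zero_iff_ae_notMem.2 ?_)
    filter_upwards [hc, hb, hμ.ae_norm_eq] with x hx hxb hx1 hxS
    rw [hx, norm_mul, hx1 hxS, mul_one] at hxb
    exact hcon hxb
  have htr : Tendsto (fun k => ∫ x in shell R K (φ k) ∩ Function.support μ, ‖r R v x‖) atTop
      (𝓝 (c * s).re) := (Complex.continuous_re.tendsto _).comp ht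
  have hlow := ((h.tendsto_integral_primed hv hμ.aemeasurable hμ.ae_norm_le hμ.invariant
    hvan).norm).comp hφ
  rw [hI, Complex.norm_real, Real.norm_of_nonneg hs.le] at hlow
  -- pass to the limit in `|∫_{K_n'} μ r| ≤ ∫_{S_n ∩ E_μ} |r|`
  have hle : s ≤ (c * s).re := le_of_tendsto_of_tendsto' hlow htr fun k =>
    h.norm_integral_primed_le hv hμ.ae_norm_le hvan
      (Eventually.of_forall fun x hx => Function.notMem_support.1 hx) (φ k)
  rw [Complex.re_mul_ofReal] at hle htr
  have hcre : c.re = 1 := le_antisymm ((Complex.re_le_norm c).trans hc1)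
    (le_of_mul_le_mul_right (by rwa [one_mul]) hs)
  -- `Re c = 1` and `|c| ≤ 1`
  have hcone : c = 1 := by
    refine Complex.ext hcre ?_
    have h2 : ‖c‖ ^ 2 ≤ 1 := pow_le_one₀ (norm_nonneg _) hc1
    rw [← Complex.normSq_eq_norm_sq, Complex.normSq_apply, hcre] at h2
    have h3 : c.im * c.im = 0 := le_antisymm (by linarith) (mul_self_nonneg _)
    simpa using h3
  refine ⟨?_, by rwa [hcre, one_mul] at htr⟩
  filter_upwards [hc] with x hx
  rw [hx, hcone, one_mul]

/-- By weak* compactness every subsequence has a further one along which the line fields converge,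
and the limit is always `μ`. -/
lemma weakStar_and_mass_tendsto :
    WeakStarTendsto (fun n => (Function.support μ).indicator (σn R K v n)) μ ∧
      Tendsto (fun n => ∫ x in shell R K n ∩ Function.support μ, ‖r R v x‖) atTop (𝓝 s) := by
  have hE := hμ.isAeInvariant h.denom_lt_num
  have hm := fun n => h.aemeasurable_sample hE hv n
  have hb := fun n => h.ae_norm_sample_le (E := Function.support μ) v n
  have key : ∀ ns : ℕ → ℕ, Tendsto ns atTop atTop → ∃ ms : ℕ → ℕ,
      (∀ g : ℂ → ℂ, Integrable g → Tendsto (fun k => ∫ x,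
        spread R (shell R K (ns (ms k)) ∩ Function.support μ) (σ R v) x * g x) atTop
          (𝓝 (∫ x, μ x * g x))) ∧
      Tendsto (fun k => ∫ x in shell R K (ns (ms k)) ∩ Function.support μ, ‖r R v x‖) atTop
        (𝓝 s) := by
    intro ns hns
    obtain ⟨w, φ, hφ, -, -, hw⟩ := exists_weakStar_limit (fun k => hm (ns k)) fun k => hb (ns k)
    obtain ⟨hwμ, hmass⟩ := weakStar_limit_eq h hμ hvan hv hs hI
      (hns.comp hφ.tendsto_atTop) hw
    refine ⟨φ, fun g hg => ?_, hmass⟩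
    have e : ∫ x, μ x * g x = ∫ x, w x * g x := integral_congr_ae (by
      filter_upwards [hwμ] with x hx
      rw [hx])
    rw [e]
    exact hw.2.2 g hg
  refine ⟨⟨fun n => ?_, memLp_top_of_bound hμ.aemeasurable.aestronglyMeasurable 1 hμ.ae_norm_le,
    fun g hg => ?_⟩, ?_⟩
  · exact (memLp_top_of_bound (hm n).aestronglyMeasurable 1 (hb n)).ae_eq
      (h.indicator_σn_ae_eq hE v n).symm
  · have h1 : Tendsto (fun n => ∫ x,
        spread R (shell R K n ∩ Function.support μ) (σ R v) x * g x) atTop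
          (𝓝 (∫ x, μ x * g x)) := tendsto_of_subseq_tendsto fun ns hns => by
      obtain ⟨ms, hms, -⟩ := key ns hns
      exact ⟨ms, hms g hg⟩
    refine h1.congr fun n => integral_congr_ae ?_
    filter_upwards [h.indicator_σn_ae_eq hE v n] with x hx
    rw [hx]
  · exact tendsto_of_subseq_tendsto fun ns hns => by
      obtain ⟨ms, -, hms⟩ := key ns hns
      exact ⟨ms, hms⟩

/-- The convergence statements for an ergodic line field `μ` with `∫ μ ψ_v = s > 0`. -/
theorem asymptotic_extremality :
    WeakStarTendsto (fun n => (Function.support μ).indicator (σn R K v n)) μ ∧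
      Tendsto (fun n => ∫ x in fin (RatDyn.E μ ∩ primed R (K n)), ‖r R v x‖) atTop (𝓝 s) ∧
      Tendsto (fun n => ‖∫ x in fin (primed R (K n)), r R v x * μ x‖) atTop (𝓝 s) ∧
      TendstoInMeasureOn (RatDyn.E μ)
        (fun n => (Function.support μ).indicator (σn R K v n)) μ ∧
      TendstoInMeasureOn (RatDyn.E μ) (Δn R K v μ) 0 := by
  have hE := hμ.isAeInvariant h.denom_lt_num
  obtain ⟨hw, hmass⟩ := weakStar_and_mass_tendsto h hμ hvan hv hs hI
  have hmeas : TendstoInMeasureOn (RatDyn.E μ)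
      (fun n => (Function.support μ).indicator (σn R K v n)) μ := fun F hF hFfin => by
    rw [fin_E]
    refine tendstoInMeasure_of_weakStar hE.nullMeasurable hF hFfin (fun n => ?_) hμ.ae_norm_eq hw
    filter_upwards [h.indicator_σn_ae_eq hE v n,
      h.ae_norm_sample_le (E := Function.support μ) v n] with x hx hxb
    rwa [hx]
  refine ⟨hw, ?_, ?_, hmeas, fun F hF hFfin => ?_⟩
  · simpa only [integral_norm_r_E hvan] using hmass
  · have := (h.tendsto_integral_primed hv hμ.aemeasurable hμ.ae_norm_le hμ.invariant hvan).norm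
    rw [hI, Complex.norm_real, Real.norm_of_nonneg hs.le] at this
    simpa only [mul_comm] using this
  · refine tendstoInMeasure_iff_norm.2 fun ε hε => ?_
    refine tendsto_of_tendsto_of_tendsto_of_le_of_le tendsto_const_nhds
      (tendstoInMeasure_iff_norm.1 (hmeas F hF hFfin) ε hε) (fun n => bot_le)
      fun n => measure_mono_ae ?_
    rw [fin_E]
    refine (ae_restrict_iff'₀ (hE.nullMeasurable.inter hF.nullMeasurableSet)).2 ?_
    filter_upwards [ae_norm_Δn_le h hμ hvan v n] with x hx hxS hxε
    have hxε' : ε ≤ ‖Δn R K v μ n x - 0‖ := hxε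
    rw [sub_zero] at hxε'
    exact hxε'.trans (hx hxS.1)

end

end Standing

end

end RatDyn

end

theorem theorem4p1 (R : RatFunc ℂ) (hdeg : 2 ≤ RatDyn.degree R)
    (hJ : RatDyn.juliaSet R = Set.univ)
    (hinf : RatDyn.toMap R ∞ = ∞)
    (hone : RatDyn.toMap R ((1 : ℂ) : OnePoint ℂ) = ((1 : ℂ) : OnePoint ℂ))
    (hzero : RatDyn.toMap R ((0 : ℂ) : OnePoint ℂ) = ((0 : ℂ) : OnePoint ℂ))
    (hlattes : ¬ RatDyn.IsFlexibleLattes R)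
    (hP : RatDyn.postcritical R ≠ Set.univ)
    (hattr : RatDyn.AeAttractedToPostcritical R)
    (K : ℕ → Set (OnePoint ℂ)) (hK : ∀ n, RatDyn.IsFundamental R (K n)) (hanti : Antitone K) :
    -- the objects attached to a test function are well defined
    (∀ v ∈ RatDyn.critValues R,
      Integrable (RatDyn.ψ v) volume ∧
      (∀ x ∈ RatDyn.Ω R, Summable fun i : ℕ => ((RatDyn.T R)^[i] (RatDyn.ψ v)) x) ∧
      (∀ x ∈ RatDyn.Ω R, RatDyn.r R v x - RatDyn.T R (RatDyn.r R v) x = RatDyn.ψ v x) ∧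
      DifferentiableOn ℂ (RatDyn.r R v) (RatDyn.Ω R) ∧
      ∀ n, IntegrableOn (RatDyn.r R v) (RatDyn.fin (RatDyn.primed R (K n))) volume ∧
        MemLp (RatDyn.σn R K v n) ⊤ volume) ∧
    -- existence of an invariant line field
    ((∃ μ : ℂ → ℂ, RatDyn.IsInvariantLineField R μ ∧
        RatDyn.VanishesOn μ (RatDyn.backward R (RatDyn.Kinf K))) ↔
      ∃ v ∈ RatDyn.critValues R,
        0 < liminf (fun n => ∫⁻ x in RatDyn.fin
          (RatDyn.primed R (K n) \ RatDyn.primed R (RatDyn.Kinf K)), ‖RatDyn.r R v x‖ₑ) atTop) ∧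
    -- weak* limit points
    (∀ v ∈ RatDyn.critValues R,
      0 < liminf (fun n => ∫⁻ x in RatDyn.fin
          (RatDyn.primed R (K n) \ RatDyn.primed R (RatDyn.Kinf K)), ‖RatDyn.r R v x‖ₑ) atTop →
      ∀ (ν : ℂ → ℂ) (φ : ℕ → ℕ), StrictMono φ →
        RatDyn.WeakStarTendsto (fun k => RatDyn.σn R K v (φ k)) ν →
        ¬ (ν =ᵐ[volume] 0) ∧ RatDyn.push R ν =ᵐ[volume] ν ∧ (∀ᵐ x : ℂ, ‖ν x‖ ≤ 1) ∧
          RatDyn.VanishesOn ν (RatDyn.backward R (RatDyn.Kinf K))) ∧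
    -- asymptotic extremality
    (∀ μ₀ : ℂ → ℂ, RatDyn.IsErgodicInvariantLineField R μ₀ →
      RatDyn.VanishesOn μ₀ (RatDyn.backward R (RatDyn.Kinf K)) →
      (∃ v ∈ RatDyn.critValues R, ∫ x, μ₀ x * RatDyn.ψ v x ≠ 0) ∧
      ∀ v ∈ RatDyn.critValues R, ∫ x, μ₀ x * RatDyn.ψ v x ≠ 0 →
        ∃ (t : ℂ) (μ : ℂ → ℂ) (s : ℝ), ‖t‖ = 1 ∧ (μ = fun x => t * μ₀ x) ∧
          0 < s ∧ ∫ x, μ x * RatDyn.ψ v x = (s : ℂ) ∧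
          RatDyn.WeakStarTendsto
            (fun n => (Function.support μ).indicator (RatDyn.σn R K v n)) μ ∧
          Tendsto (fun n => ∫ x in RatDyn.fin (RatDyn.E μ ∩ RatDyn.primed R (K n)),
            ‖RatDyn.r R v x‖) atTop (𝓝 s) ∧
          Tendsto (fun n => ‖∫ x in RatDyn.fin (RatDyn.primed R (K n)),
            RatDyn.r R v x * μ x‖) atTop (𝓝 s) ∧
          RatDyn.TendstoInMeasureOn (RatDyn.E μ)
            (fun n => (Function.support μ).indicator (RatDyn.σn R K v n)) μ ∧
          RatDyn.TendstoInMeasureOn (RatDyn.E μ) (RatDyn.Δn R K v μ) 0 ∧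
          -- the sets on which `Δ_n` is defined exhaust the support
          ∀ F : Set ℂ, MeasurableSet F → volume F < ⊤ →
            Tendsto (fun n => volume ((RatDyn.fin (RatDyn.E μ) ∩ F) \
              RatDyn.fin (RatDyn.backward R (RatDyn.primed R (K n) ∩ RatDyn.E μ))))
              atTop (𝓝 0)) := by
  have h : RatDyn.Standing R K := ⟨hinf, hone, hzero, hJ, hattr, hK, hanti⟩
  refine ⟨fun v hv => ⟨RatDyn.integrable_ψ v, (h.resolvent hv).1, (h.resolvent hv).2.1,
    (h.resolvent hv).2.2, fun n => ⟨h.integrableOn_r_primed hv n, h.memLp_σn hv n⟩⟩,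
    h.exists_invariantLineField_iff, fun v hv hlim ν φ hφ hν => h.weakStar_limit_σn hv hlim hφ hν,
    fun μ₀ hμ₀ hvan₀ => ⟨?_, fun v hv hI₀ => ?_⟩⟩
  · exact RatDyn.exists_integral_ψ_ne_zero h.denom_lt_num hinf hone hzero hJ hμ₀.aemeasurable
      hμ₀.ae_norm_le hμ₀.invariant fun h0 => hμ₀.nontrivial.ne' (ae_iff.1 h0)
  · have hs : 0 < ‖∫ x, μ₀ x * RatDyn.ψ v x‖ := norm_pos_iff.2 hI₀
    -- the rotation that makes the pairing with `ψ_v` positive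
    obtain ⟨t, ht, htI⟩ : ∃ t : ℂ, ‖t‖ = 1 ∧
        t * ∫ x, μ₀ x * RatDyn.ψ v x = (‖∫ x, μ₀ x * RatDyn.ψ v x‖ : ℂ) := by
      refine ⟨‖∫ x, μ₀ x * RatDyn.ψ v x‖ / ∫ x, μ₀ x * RatDyn.ψ v x, ?_, div_mul_cancel₀ _ hI₀⟩
      rw [norm_div, Complex.norm_real, norm_norm, div_self hs.ne']
    have hμ := hμ₀.const_mul ht
    have hvan : RatDyn.VanishesOn (fun x => t * μ₀ x) (RatDyn.backward R (RatDyn.Kinf K)) := by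
      filter_upwards [hvan₀] with x hx hxb
      rw [hx hxb, mul_zero]
    have hI : ∫ x, t * μ₀ x * RatDyn.ψ v x = (‖∫ x, μ₀ x * RatDyn.ψ v x‖ : ℂ) := by
      rw [← htI, ← integral_const_mul]
      simp only [mul_assoc]
    obtain ⟨h1, h2, h3, h4, h5⟩ := h.asymptotic_extremality hμ hvan hv hs hI
    exact ⟨t, _, _, ht, rfl, hs, hI, h1, h2, h3, h4, h5,
      fun F hF hFfin => h.tendsto_volume_notMem_backward hμ hvan hF hFfin⟩
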